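/- Let $A$ be a finite alphabet. A (one-sided) shift space is a closed set $X\subset A^{\mathbb N}$ with $\sigma(X)\subset X$, where $\sigma(x)_n=x_{n+1}$. For a finite word $w$ of length $|w|$ let $[w]\subset X$ be the set of points of $X$ beginning with $w$; let $\mathcal L=\{w:[w]\neq\emptyset\}$ be the language of $X$ and $\mathcal D_n=\{w\in\mathcal D:|w|=n\}$ for $\mathcal D\subset\mathcal L$. For $\varphi\in C(X)$ put $S_n\varphi=\sum_{k<n}\varphi\circ\sigma^k$, $\varphi_n(w)=\sup_{[w]}S_n\varphi$ for $w\in\mathcal L_n$, $\Lambda_n(\mathcal D,\varphi)=\sum_{w\in\mathcal D_n}e^{\varphi_n(w)}$, $P(\varphi)=\limsup_n\frac1n\log\Lambda_n(\mathcal L,\varphi)$ and $\mathrm{Per}_n=\{x\in X:\sigma^nx=x\}$. An equilibrium state for a potential $\varphi$ and a measurable map $f$ is an $f$-invariant Borel probability measure maximising $h_\mu(f)+\int\varphi\,d\mu$ among all such measures, where $h_\mu(f)$ is the Kolmogorov--Sinai entropy. A potential $\varphi$ has the Bowen property on $\mathcal G\subset\mathcal L$ if $\sup\{|S_{|w|}\varphi(x)-S_{|w|}\varphi(y)|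 : w\in\mathcal G,\ x,y\in[w]\}<\infty$, and it has the Bowen property if this holds for $\mathcal G=\mathcal L$. A collection $\mathcal G\subset\mathcal L$ has (S)-specification if there is $t\ge0$ such that for all $m\ge1$ and $w^1,\dots,w^m\in\mathcal G$ there are $v^1,\dots,v^{m-1}\in\mathcal L_t$ with $x=w^1v^1w^2\cdots v^{m-1}w^m\in\mathcal L$; it has (Per)-specification if, in addition, the $v^i$ can be chosen so that $[x]$ contains a point fixed by $\sigma^{|x|+t}$. $X$ has the specification property if $\mathcal L$ has (S)-specification. For $\beta>1$, the $\beta$-shift is $\Sigma_\beta=\{x\in\{0,\dots,\lceil\beta\rceil-1\}^{\mathbb N}:\sigma^kx\preceq w^\beta\text{ for all }k\ge0\}$, where $\preceq$ is the lexicographic order and $w^\beta$ is the lexicographically largest $\beta$-expansion of $1$ over these digits not ending in zeros (the quasi-greedy expansion). **Theorem A.** Let $X$ be a $\beta$-shift ($\beta>1$), or a shift space with the specification property and more than one point. Then there is a class $\mathcal B\subset C(X)$, strictly containing the potentials with the Bowen property, such that every $\varphi\in\mathcal B$ has a unique equilibrium state $\mu_\varphi$. Moreover, for every $\varphi\in\mathcal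 B$: 1. $\mu_\varphi$ has the weak Gibbs property: there are $\mathcal C^p,\mathcal G,\mathcal C^s\subset\mathcal L$ such that every word of $\mathcal L$ is of the form $uvw$ with $u\in\mathcal C^p$, $v\in\mathcal G$, $w\in\mathcal C^s$; for every $M$ the collection $\mathcal G(M)=\{uvw\in\mathcal L: u\in\mathcal C^p,v\in\mathcal G,w\in\mathcal C^s,|u|,|w|\le M\}$ has (Per)-specification; $\varphi$ has the Bowen property on $\mathcal G$; $\sum_{n\ge1}\Lambda_n(\mathcal C^p\cup\mathcal C^s,\varphi)e^{-nP(\varphi)}<\infty$; and there are constants $K'>0$ and $K_M>0$ such that for all $M$, $n$ and $w\in\mathcal G(M)_n$ $$K_M\le\frac{\mu_\varphi([w])}{e^{-nP(\varphi)+\varphi_n(w)}}\le K'.$$ 2. $\mu_\varphi$ is the weak* limit, as $n\to\infty$, of the periodic orbit measures $$\frac1{\sum_{x\in\mathrm{Per}_n}e^{S_n\varphi(x)}}\sum_{x\in\mathrm{Per}_n}e^{S_n\varphi(x)}\delta_x .$$ Furthermore, for every $\beta>1$ and every Hölder continuous $\varphi:[0,1)\to\mathbb R$, there is a unique equilibrium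 state for $\varphi$ and the $\beta$-transformation $f:[0,1)\to[0,1)$, $f(x)=\beta x\bmod 1$. -/

import Mathlib

open Filter Topology MeasureTheory Set
open SymbolicDynamics.FullShift (Subshift)
open scoped NNReal ENNReal

noncomputable section

/-! ### Entropy and equilibrium states -/

section Entropy

variable {Ω : Type*} [MeasurableSpace Ω]

/-- Shannon entropy of the join `⋁_{i<n} T⁻ⁱ ξ`, where the finite measurable partition `ξ` is given
by its labelling `ξ : Ω → Fin k`. -/
def joinEntropy (T : Ω → Ω) (μ : Measure Ω) {k : ℕ} (ξ : Ω → Fin k) (n : ℕ) : ℝ :=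
  ∑ c : Fin n → Fin k, Real.negMulLog (μ.real {x | ∀ i : Fin n, ξ (T^[i] x) = c i})

/-- The entropy `h_μ(T)` (Kolmogorov–Sinai): the supremum over all finite measurable partitions `ξ`
of `lim (1/n) H_μ(⋁_{i<n} T⁻ⁱ ξ)`. -/
def measureEntropy (T : Ω → Ω) (μ : Measure Ω) : EReal :=
  ⨆ (k : ℕ) (ξ : Ω → Fin k) (_ : Measurable ξ),
    limsup (fun n : ℕ => ((joinEntropy T μ ξ n / n : ℝ) : EReal)) atTop

/-- `μ` is a `T`-invariant probability measure. -/
def IsInvariantProb (T : Ω → Ω) (μ : Measure Ω) : Prop :=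
  IsProbabilityMeasure μ ∧ MeasurePreserving T μ μ

/-- `μ` is an equilibrium state for `φ`: an invariant probability measure that maximises
`h_μ(T) + ∫ φ dμ` among all invariant probability measures. -/
def IsEquilibriumState (T : Ω → Ω) (φ : Ω → ℝ) (μ : Measure Ω) : Prop :=
  IsInvariantProb T μ ∧ ∀ ν : Measure Ω, IsInvariantProb T ν →
    measureEntropy T ν + ((∫ x, φ x ∂ν : ℝ) : EReal) ≤
      measureEntropy T μ + ((∫ x, φ x ∂μ : ℝ) : EReal)

end Entropy

/-! ### Shift spaces, languages, specification, the Bowen property -/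

section Shift

variable {A : Type*} [TopologicalSpace A]

/-- The shift map `σ(x)_n = x_{n+1}` on a one-sided shift space `X ⊆ A^ℕ`. -/
noncomputable def shiftMap (X : Subshift A ℕ) (x : X.carrier) : X.carrier :=
  ⟨SymbolicDynamics.FullShift.shift 1 x.1, X.mapsTo 1 x.2⟩

/-- The cylinder `[w]` of points of `X` that begin with the word `w`. -/
def wordCylinder (X : Subshift A ℕ) (w : List A) : Set X.carrier :=
  {x | ∀ i : Fin w.length, x.1 i = w.get i}

/-- The language of `X`: the words with non-empty cylinder. -/
def shiftLanguage (X : Subshift A ℕ) : Set (List A) :=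
  {w | (wordCylinder X w).Nonempty}

/-- The word `w⁰ v⁰ w¹ v¹ ⋯ vᵐ⁻¹ wᵐ`. -/
def glue {m : ℕ} (w : Fin (m + 1) → List A) (v : Fin m → List A) : List A :=
  w 0 ++ (List.ofFn fun i : Fin m => v i ++ w i.succ).flatten

/-- (S)-specification of a collection of words `G`, with some gap size `t`. -/
def HasSpecificationOn (X : Subshift A ℕ) (G : Set (List A)) : Prop :=
  ∃ t : ℕ, ∀ (m : ℕ) (w : Fin (m + 1) → List A), (∀ i, w i ∈ G) →
    ∃ v : Fin m → List A, (∀ i, v i ∈ shiftLanguage X ∧ (v i).length = t) ∧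
      glue w v ∈ shiftLanguage X

/-- (Per)-specification of `G`: in addition to (S)-specification, the cylinder of the resulting word
`x` contains a point fixed by `σ^(|x| + t)`. -/
def HasPerSpecificationOn (X : Subshift A ℕ) (G : Set (List A)) : Prop :=
  ∃ t : ℕ, ∀ (m : ℕ) (w : Fin (m + 1) → List A), (∀ i, w i ∈ G) →
    ∃ v : Fin m → List A, (∀ i, v i ∈ shiftLanguage X ∧ (v i).length = t) ∧
      glue w v ∈ shiftLanguage X ∧
      ∃ p ∈ wordCylinder X (glue w v), (shiftMap X)^[(glue w v).length + t] p = p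

/-- The classical specification property of the shift. -/
def HasSpecification (X : Subshift A ℕ) : Prop :=
  HasSpecificationOn X (shiftLanguage X)

/-- The Bowen property of `φ` on a collection of words `G`. -/
def HasBowenOn (X : Subshift A ℕ) (G : Set (List A)) (φ : X.carrier → ℝ) : Prop :=
  ∃ V : ℝ, ∀ w ∈ G, ∀ x ∈ wordCylinder X w, ∀ y ∈ wordCylinder X w,
    |birkhoffSum (shiftMap X) φ w.length x - birkhoffSum (shiftMap X) φ w.length y| ≤ V

/-- The Bowen property of `φ`. -/
def HasBowen (X : Subshift A ℕ) (φ : X.carrier → ℝ) : Prop :=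
  HasBowenOn X (shiftLanguage X) φ

/-- `φ_n(w) = sup_{x ∈ [w]} S_n φ(x)`, where `n = |w|`. -/
def supBirkhoff (X : Subshift A ℕ) (φ : X.carrier → ℝ) (w : List A) : ℝ :=
  sSup (birkhoffSum (shiftMap X) φ w.length '' wordCylinder X w)

open Classical in
/-- `Λ_n(D, φ) = ∑_{w ∈ D_n} exp φ_n(w)`. -/
def partitionSum [Fintype A] (X : Subshift A ℕ) (D : Set (List A)) (φ : X.carrier → ℝ)
    (n : ℕ) : ℝ :=
  ∑ w : Fin n → A, if List.ofFn w ∈ D then Real.exp (supBirkhoff X φ (List.ofFn w)) else 0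

/-- The topological pressure `P(φ) = limsup (1/n) log Λ_n(L, φ)`, with `L` the language of `X`. -/
def topPressure [Fintype A] (X : Subshift A ℕ) (φ : X.carrier → ℝ) : ℝ :=
  limsup (fun n : ℕ => Real.log (partitionSum X (shiftLanguage X) φ n) / n) atTop

/-- `Cp · G · Cs = L`, where all three collections consist of words of the language `L` and only the
products that lie in `L` are taken. -/
def IsDecomposition (X : Subshift A ℕ) (Cp G Cs : Set (List A)) : Prop :=
  Cp ⊆ shiftLanguage X ∧ G ⊆ shiftLanguage X ∧ Cs ⊆ shiftLanguage X ∧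
    ∀ z ∈ shiftLanguage X, ∃ u ∈ Cp, ∃ v ∈ G, ∃ w ∈ Cs, z = u ++ v ++ w

/-- The fattened collection `G(M)`. -/
def fattened (X : Subshift A ℕ) (Cp G Cs : Set (List A)) (M : ℕ) : Set (List A) :=
  {z | z ∈ shiftLanguage X ∧ ∃ u ∈ Cp, ∃ v ∈ G, ∃ w ∈ Cs,
    u.length ≤ M ∧ w.length ≤ M ∧ z = u ++ v ++ w}

/-- A decomposition of the language adapted to `φ`: every `G(M)` has (Per)-specification, `φ` has the
Bowen property on `G`, and `∑_{n ≥ 1} Λ_n(Cp ∪ Cs, φ) exp(-n P(φ)) < ∞`. -/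
def IsGoodDecomposition [Fintype A] (X : Subshift A ℕ) (φ : X.carrier → ℝ)
    (Cp G Cs : Set (List A)) : Prop :=
  IsDecomposition X Cp G Cs ∧
    (∀ M : ℕ, HasPerSpecificationOn X (fattened X Cp G Cs M)) ∧
    HasBowenOn X G φ ∧
    Summable fun n : ℕ =>
      partitionSum X (Cp ∪ Cs) φ (n + 1) * Real.exp (-((n + 1 : ℕ) : ℝ) * topPressure X φ)

/-- The weak Gibbs property of `μ` for `φ`, relative to the collections `Cp`, `G`, `Cs`. -/
def HasWeakGibbs [Fintype A] [MeasurableSpace A] (X : Subshift A ℕ) (φ : X.carrier → ℝ)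
    (μ : Measure X.carrier) (Cp G Cs : Set (List A)) : Prop :=
  ∃ K' : ℝ, 0 < K' ∧ ∀ M : ℕ, ∃ K : ℝ, 0 < K ∧ ∀ w ∈ fattened X Cp G Cs M,
    K ≤ μ.real (wordCylinder X w) /
        Real.exp (-(w.length : ℝ) * topPressure X φ + supBirkhoff X φ w) ∧
      μ.real (wordCylinder X w) /
        Real.exp (-(w.length : ℝ) * topPressure X φ + supBirkhoff X φ w) ≤ K'

/-- `Per_n = {x ∈ X | σⁿ x = x}`. -/
def perPoints (X : Subshift A ℕ) (n : ℕ) : Set X.carrier :=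
  {x | (shiftMap X)^[n] x = x}

/-- The periodic orbit measure
`(∑_{x ∈ Per_n} exp S_n φ(x))⁻¹ ∑_{x ∈ Per_n} exp(S_n φ(x)) δ_x`. -/
noncomputable def perMeasure [MeasurableSpace A] (X : Subshift A ℕ) (φ : X.carrier → ℝ) (n : ℕ) :
    Measure X.carrier :=
  (∑' x : perPoints X n, ENNReal.ofReal (Real.exp (birkhoffSum (shiftMap X) φ n x.1)))⁻¹ •
    Measure.sum fun x : perPoints X n =>
      ENNReal.ofReal (Real.exp (birkhoffSum (shiftMap X) φ n x.1)) • Measure.dirac x.1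

/-- `φ` has a unique equilibrium state `μ`; this `μ` is weak Gibbs, for a decomposition of the
language adapted to `φ`, and is the weak* limit of the periodic orbit measures. -/
def HasUniqueGibbsState [Fintype A] [MeasurableSpace A] (X : Subshift A ℕ)
    (φ : C(X.carrier, ℝ)) : Prop :=
  ∃ μ : Measure X.carrier,
    IsEquilibriumState (shiftMap X) φ μ ∧
    (∀ ν : Measure X.carrier, IsEquilibriumState (shiftMap X) φ ν → ν = μ) ∧
    (∃ Cp G Cs : Set (List A), IsGoodDecomposition X φ Cp G Cs ∧ HasWeakGibbs X φ μ Cp G Cs) ∧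
    ∀ ψ : C(X.carrier, ℝ),
      Tendsto (fun n : ℕ => ∫ x, ψ x ∂(perMeasure X φ n)) atTop (𝓝 (∫ x, ψ x ∂μ))

end Shift

/-! ### β-shifts and β-transformations -/

/-- The remainders `r_0 = 1`, `r_{n+1} = β r_n - (⌈β r_n⌉ - 1) ∈ (0, 1]` of the expansion of `1`. -/
def betaRemainder (β : ℝ) : ℕ → ℝ
  | 0 => 1
  | n + 1 => β * betaRemainder β n - (⌈β * betaRemainder β n⌉ - 1)

/-- The digits `⌈β r_n⌉ - 1` of the (quasi-)greedy `β`-expansion `w^β` of `1`: the lexicographically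
largest expansion of `1` that does not end in zeros. It is the greedy expansion unless the latter
is finite. -/
def betaDigit (β : ℝ) (n : ℕ) : ℤ :=
  ⌈β * betaRemainder β n⌉ - 1

/-- `x ⪯ w` in the lexicographic order: at the first place where they differ (if any), `x` is
smaller. -/
def LexLE (x w : ℕ → ℤ) : Prop :=
  ∀ n, (∀ i < n, x i = w i) → x n ≤ w n

/-- The `β`-shift `{x ∈ {0, …, b-1}^ℕ | σᵏ x ⪯ w^β for all k ≥ 0}`, where `b = ⌈β⌉`. -/
noncomputable def betaShift (β : ℝ) : Subshift (Fin ⌈β⌉₊) ℕ where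
  carrier := {x | ∀ k : ℕ, LexLE (fun i => ((x (k + i) : ℕ) : ℤ)) (betaDigit β)}
  isClosed := by
    have key : ∀ (j : ℕ) (p : Fin ⌈β⌉₊ → Prop), IsClosed {x : ℕ → Fin ⌈β⌉₊ | p (x j)} := by
      intro j p
      exact (isClosed_discrete {a | p a}).preimage (continuous_apply j)
    have opn : ∀ (j : ℕ) (p : Fin ⌈β⌉₊ → Prop), IsOpen {x : ℕ → Fin ⌈β⌉₊ | p (x j)} := by
      intro j p
      exact (isOpen_discrete {a | p a}).preimage (continuous_apply j)
    simp only [LexLE, Set.ofPred_forall]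
    refine isClosed_iInter fun k => isClosed_iInter fun n => ?_
    refine isClosed_imp ?_ (key _ fun a => ((a : ℕ) : ℤ) ≤ betaDigit β n)
    have h : {x : ℕ → Fin ⌈β⌉₊ | ∀ i < n, ((x (k + i) : ℕ) : ℤ) = betaDigit β i} =
        ⋂ i ∈ Set.Iio n, {x : ℕ → Fin ⌈β⌉₊ | ((x (k + i) : ℕ) : ℤ) = betaDigit β i} := by
      ext x; simp
    rw [h]
    exact (Set.finite_Iio n).isOpen_biInter
      fun i _ => opn (k + i) fun a => ((a : ℕ) : ℤ) = betaDigit β i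
  mapsTo := by
    intro g x hx k
    have := hx (g + k)
    simpa only [SymbolicDynamics.FullShift.shift_apply, add_assoc] using this

/-- The `β`-transformation `x ↦ βx mod 1` of `[0, 1)`. -/
def betaTransformation (β : ℝ) (x : Set.Ico (0 : ℝ) 1) : Set.Ico (0 : ℝ) 1 :=
  ⟨Int.fract (β * x), Int.fract_nonneg _, Int.fract_lt_one _⟩

end

/-! The class is the set of all potentials satisfying `HasUniqueGibbsState`. So it must be shown
that a good decomposition forces this property, that every Bowen potential has such a decomposition,
and that some potential without the Bowen property has one too.

Let P be the pressure. Subadditivity gives Λ_n(L) ≥ e^{nP} for every n. Conversely,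
`kraft_inequality` bounds ∑ exp(φ(u) - (|u| + t)P) over prefix-free words that can be glued freely.
Applied to G_n and summed over decompositions, it gives Λ_n(L) ≤ C e^{nP}, and words outside G(M)
contribute at most ε_M e^{nP} with ε_M → 0 (`IsGoodDecomposition.partitionSum_bounds`). Periodic
gluing then shows that every limit of periodic orbit measures has an upper Gibbs bound on all words
and a mixing lower bound on each G(M) (`IsGoodDecomposition.isMixingGibbs`). The upper bound makes
such a limit μ an equilibrium state, the lower bound makes every equilibrium state absolutely
continuous with respect to μ, and the mixing bound makes μ ergodic. Hence the equilibrium state is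
unique, and by compactness the periodic orbit measures converge to it.

Under specification a synchronizing word upgrades gluing to periodic gluing, so G = L serves for
Bowen potentials. In a β-shift, G consists of the words strictly below w^β from every place, which
concatenate freely, and the suffixes are the prefixes of w^β; their weights are summable, again by
`kraft_inequality`. A potential without the Bowen property is -c/(n+1), where n is the first place
of disagreement with a periodic point: its variation on cylinders diverges like the harmonic series.
It is Bowen on words that keep leaving the orbit, and the remaining suffixes are too few to matter.

A Hölder potential on [0,1) lifts to a Bowen potential on the β-shift. The coding is bijective off
the preimages of w^β, which the Gibbs state does not charge, so existence and uniqueness descend to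
the β-transformation. -/

set_option linter.unusedSectionVars false

noncomputable section

/-! ### Words, cylinders and Birkhoff sums -/

section Words

variable {A : Type*} [TopologicalSpace A] {X : Subshift A ℕ}

@[simp]
lemma shiftMap_apply (x : X.carrier) (i : ℕ) : (shiftMap X x).1 i = x.1 (1 + i) := rfl

@[simp]
lemma shiftMap_iterate_apply (n : ℕ) (x : X.carrier) (i : ℕ) :
    ((shiftMap X)^[n] x).1 i = x.1 (n + i) := by
  induction n generalizing x with
  | zero => simp
  | succ n ih => rw [Function.iterate_succ_apply, ih, shiftMap_apply, ← add_assoc, add_comm 1 n]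

lemma carrier_ext {x y : X.carrier} (h : ∀ i, x.1 i = y.1 i) : x = y :=
  Subtype.ext (funext h)

/-- The prefix of length `n` of a point. -/
def wordPrefix (n : ℕ) (x : ℕ → A) : List A := List.ofFn fun i : Fin n => x i

@[simp]
lemma length_wordPrefix (n : ℕ) (x : ℕ → A) : (wordPrefix n x).length = n := by
  simp [wordPrefix]

lemma mem_wordCylinder {w : List A} {x : X.carrier} :
    x ∈ wordCylinder X w ↔ ∀ i (h : i < w.length), x.1 i = w[i] :=
  ⟨fun H i h => H ⟨i, h⟩, fun H i => H i i.2⟩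

lemma mem_wordCylinder_iff_wordPrefix {w : List A} {x : X.carrier} :
    x ∈ wordCylinder X w ↔ wordPrefix w.length x.1 = w := by
  rw [mem_wordCylinder]
  constructor
  · intro H
    apply List.ext_getElem (by simp)
    intro i h1 h2
    simp [wordPrefix, H i h2]
  · intro H i h
    have : (wordPrefix w.length x.1)[i]'(by simpa using h) = w[i] := by simp only [H]
    simpa [wordPrefix] using this

lemma mem_wordCylinder_wordPrefix (n : ℕ) (x : X.carrier) :
    x ∈ wordCylinder X (wordPrefix n x.1) := by
  rw [mem_wordCylinder_iff_wordPrefix]; simp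

lemma wordPrefix_mem_shiftLanguage (n : ℕ) (x : X.carrier) :
    wordPrefix n x.1 ∈ shiftLanguage X := ⟨x, mem_wordCylinder_wordPrefix n x⟩

lemma wordPrefix_eq_iff {n : ℕ} {x y : ℕ → A} :
    wordPrefix n x = wordPrefix n y ↔ ∀ i < n, x i = y i := by
  simp only [wordPrefix, List.ofFn_inj, funext_iff]
  exact ⟨fun h i hi => h ⟨i, hi⟩, fun h i => h i i.2⟩

lemma wordPrefix_add (m n : ℕ) (x : ℕ → A) :
    wordPrefix (m + n) x = wordPrefix m x ++ wordPrefix n (fun i => x (m + i)) := by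
  apply List.ext_getElem (by simp)
  intro i h1 h2
  simp only [length_wordPrefix] at h1
  by_cases h : i < m
  · rw [List.getElem_append_left (by simpa using h)]; simp [wordPrefix]
  · rw [List.getElem_append_right (by simpa using h)]
    simp only [wordPrefix, List.getElem_ofFn]
    congr 1
    simp only [List.length_ofFn]
    omega

@[simp]
lemma wordCylinder_nil : wordCylinder X ([] : List A) = univ := by
  ext x; simp [mem_wordCylinder]

lemma mem_wordCylinder_append {u v : List A} {x : X.carrier} :
    x ∈ wordCylinder X (u ++ v) ↔
      x ∈ wordCylinder X u ∧ (shiftMap X)^[u.length] x ∈ wordCylinder X v := by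
  simp only [mem_wordCylinder, List.length_append, shiftMap_iterate_apply]
  constructor
  · intro H
    refine ⟨fun i h => ?_, fun i h => ?_⟩
    · rw [H i (by omega), List.getElem_append_left h]
    · rw [H (u.length + i) (by omega), List.getElem_append_right (by omega)]
      simp
  · rintro ⟨H1, H2⟩ i h
    by_cases hi : i < u.length
    · rw [H1 i hi, List.getElem_append_left hi]
    · have := H2 (i - u.length) (by omega)
      rw [Nat.add_sub_of_le (by omega)] at this
      rw [List.getElem_append_right (by omega), this]

lemma eq_of_mem_wordCylinder {u v : List A} {x : X.carrier} (hu : x ∈ wordCylinder X u)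
    (hv : x ∈ wordCylinder X v) (h : u.length = v.length) : u = v := by
  rw [mem_wordCylinder_iff_wordPrefix] at hu hv
  rw [← hu, ← hv, h]

lemma mem_wordCylinder_of_agree {w : List A} {x y : X.carrier} {n : ℕ}
    (hx : x ∈ wordCylinder X w) (hn : w.length ≤ n) (h : ∀ i < n, x.1 i = y.1 i) :
    y ∈ wordCylinder X w := by
  rw [mem_wordCylinder] at hx ⊢
  intro i hi
  rw [← h i (by omega), hx]

lemma shiftLanguage_of_append {u v : List A} (h : u ++ v ∈ shiftLanguage X) :
    u ∈ shiftLanguage X ∧ v ∈ shiftLanguage X := by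
  obtain ⟨x, hx⟩ := h
  rw [mem_wordCylinder_append] at hx
  exact ⟨⟨_, hx.1⟩, ⟨_, hx.2⟩⟩

/-- The words `ws` appear one after another in `p`, separated by gaps of length `t`. -/
def Follows (X : Subshift A ℕ) (t : ℕ) : List (List A) → X.carrier → Prop
  | [], _ => True
  | w :: ws, p => p ∈ wordCylinder X w ∧ Follows X t ws ((shiftMap X)^[w.length + t] p)

/-- Total length of the words `ws`, each one followed by a gap of length `t`. -/
def gapLength (t : ℕ) (ws : List (List A)) : ℕ := (ws.map fun w => w.length + t).sum

@[simp] lemma gapLength_nil (t : ℕ) : gapLength t ([] : List (List A)) = 0 := rfl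

@[simp] lemma gapLength_cons (t : ℕ) (w : List A) (ws : List (List A)) :
    gapLength t (w :: ws) = w.length + t + gapLength t ws := by simp [gapLength]

lemma glue_succ {m : ℕ} (w : Fin (m + 2) → List A) (v : Fin (m + 1) → List A) :
    glue w v = w 0 ++ (v 0 ++ glue (fun i => w i.succ) (fun i => v i.succ)) := by
  simp [glue, List.ofFn_succ, List.append_assoc]

lemma glue_zero (w : Fin 1 → List A) (v : Fin 0 → List A) : glue w v = w 0 := by
  simp [glue]

lemma length_glue {m : ℕ} (t : ℕ) (w : Fin (m + 1) → List A) (v : Fin m → List A)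
    (hv : ∀ i, (v i).length = t) : (glue w v).length + t = gapLength t (List.ofFn w) := by
  induction m with
  | zero => simp [glue_zero]
  | succ m ih =>
    have := ih (fun i => w i.succ) (fun i => v i.succ) (fun i => hv _)
    rw [glue_succ, List.ofFn_succ, gapLength_cons, ← this]
    simp [hv]; ring

lemma follows_of_mem_glue {m : ℕ} {t : ℕ} {w : Fin (m + 1) → List A} {v : Fin m → List A}
    (hv : ∀ i, (v i).length = t) {p : X.carrier} (hp : p ∈ wordCylinder X (glue w v)) :
    Follows X t (List.ofFn w) p := by
  induction m generalizing p with
  | zero => simpa [glue_zero, Follows] using hp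
  | succ m ih =>
    rw [glue_succ, mem_wordCylinder_append, mem_wordCylinder_append,
      ← Function.iterate_add_apply, hv 0, add_comm t] at hp
    rw [List.ofFn_succ]
    refine ⟨hp.1, ?_⟩
    exact ih (fun i => hv _) hp.2.2

/-- Every nonempty list of words of `G` is realised, with gaps `t`, by a point. -/
def GluesPer (X : Subshift A ℕ) (G : Set (List A)) (t : ℕ) : Prop :=
  ∀ ws : List (List A), ws ≠ [] → (∀ w ∈ ws, w ∈ G) →
    ∃ p : X.carrier, Follows X t ws p ∧ (shiftMap X)^[gapLength t ws] p = p

/-- The connecting words are forgotten: later arguments use only the positions of the given words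
and the closing gap of the same length `t`. -/
lemma HasPerSpecificationOn.gluesPer {G : Set (List A)} (h : HasPerSpecificationOn X G) :
    ∃ t, GluesPer X G t := by
  obtain ⟨t, ht⟩ := h
  refine ⟨t, fun ws hne hws => ?_⟩
  obtain ⟨m, hm⟩ : ∃ m, ws.length = m + 1 := ⟨ws.length - 1, by
    have := List.length_pos_iff.2 hne; omega⟩
  obtain ⟨w, rfl⟩ : ∃ w : Fin (m + 1) → List A, ws = List.ofFn w :=
    ⟨fun i => ws[i.1]'(by omega), by
      apply List.ext_getElem (by simp [hm])
      intro i h1 h2; simp [-List.ofFn_succ]⟩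
  obtain ⟨v, hv, -, p, hp, hper⟩ := ht m w (fun i => hws _ (List.mem_ofFn.2 ⟨i, rfl⟩))
  refine ⟨p, follows_of_mem_glue (fun i => (hv i).2) hp, ?_⟩
  rwa [← length_glue t w v (fun i => (hv i).2)]

lemma HasPerSpecificationOn.mono {G G' : Set (List A)} (h : HasPerSpecificationOn X G)
    (hG : G' ⊆ G) : HasPerSpecificationOn X G' := by
  obtain ⟨t, ht⟩ := h
  exact ⟨t, fun m w hw => ht m w fun i => hG (hw i)⟩

lemma HasBowenOn.mono {G G' : Set (List A)} {φ : X.carrier → ℝ} (h : HasBowenOn X G φ)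
    (hG : G' ⊆ G) : HasBowenOn X G' φ := by
  obtain ⟨V, hV⟩ := h
  exact ⟨V, fun w hw => hV w (hG hw)⟩

/-- Two different words of `U` have disjoint cylinders. -/
def PrefixFree (X : Subshift A ℕ) (U : Set (List A)) : Prop :=
  ∀ u ∈ U, ∀ v ∈ U, (wordCylinder X u ∩ wordCylinder X v).Nonempty → u = v

/-- Prefix-freeness identifies the first word from the common letters; both points are then shifted
past it and the gap. The letters in the gaps play no role, so the list can be read back from any
gluing. -/
lemma Follows.injective {U : Set (List A)} (hU : PrefixFree X U) {t : ℕ}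
    {ws ws' : List (List A)} (hlen : ws.length = ws'.length) (hws : ∀ w ∈ ws, w ∈ U)
    (hws' : ∀ w ∈ ws', w ∈ U) {p p' : X.carrier} (hp : Follows X t ws p)
    (hp' : Follows X t ws' p') (h : ∀ i < gapLength t ws, p.1 i = p'.1 i) : ws = ws' := by
  induction ws generalizing ws' p p' with
  | nil => exact (List.length_eq_zero_iff.1 hlen.symm).symm
  | cons w ws ih =>
    obtain _ | ⟨w', ws'⟩ := ws'
    · simp at hlen
    have hw : w = w' := by
      refine hU _ (hws _ (by simp)) _ (hws' _ (by simp)) ⟨p', ?_, hp'.1⟩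
      exact mem_wordCylinder_of_agree hp.1 (n := gapLength t (w :: ws))
        (by rw [gapLength_cons]; omega) h
    subst hw
    congr 1
    refine ih (by simpa using hlen) (fun w hw => hws w (by simp [hw]))
      (fun w hw => hws' w (by simp [hw])) hp.2 hp'.2 fun i hi => ?_
    rw [shiftMap_iterate_apply, shiftMap_iterate_apply]
    exact h _ (by rw [gapLength_cons]; omega)

end Words

/-! ### Continuity, compactness and bounds for Birkhoff sums -/

section Topology

variable {A : Type*} [TopologicalSpace A] [DiscreteTopology A] {X : Subshift A ℕ}

lemma continuous_shiftMap (X : Subshift A ℕ) : Continuous (shiftMap X) := by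
  apply Continuous.subtype_mk
  exact (SymbolicDynamics.FullShift.continuous_shift 1).comp continuous_subtype_val

lemma isClopen_wordCylinder (w : List A) : IsClopen (wordCylinder X w) := by
  have : wordCylinder X w = ⋂ i : Fin w.length, {x : X.carrier | x.1 i = w.get i} := by
    ext x; simp [wordCylinder]
  rw [this]
  refine isClopen_iInter_of_finite fun i => ?_
  exact (isClopen_discrete {w.get i}).preimage
    ((continuous_apply (i : ℕ)).comp continuous_subtype_val)

lemma mem_carrier_of_wordPrefix {x : ℕ → A}
    (h : ∀ n, wordPrefix n x ∈ shiftLanguage X) : x ∈ X.carrier := by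
  choose y hy using h
  have : Tendsto (fun n => (y n).1) atTop (𝓝 x) := by
    rw [tendsto_pi_nhds]
    intro i
    apply tendsto_const_nhds.congr'
    filter_upwards [eventually_gt_atTop i] with n hn
    have := mem_wordCylinder.1 (hy n) i (by simpa using hn)
    rw [this]; simp [wordPrefix]
  exact X.isClosed.mem_of_tendsto this (Eventually.of_forall fun n => (y n).2)

instance [Finite A] : CompactSpace X.carrier := isCompact_iff_compactSpace.1 X.isClosed.isCompact

variable [Finite A] (φ : C(X.carrier, ℝ))

lemma abs_birkhoffSum_le (n : ℕ) (x : X.carrier) :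
    |birkhoffSum (shiftMap X) φ n x| ≤ n * ‖φ‖ := by
  unfold birkhoffSum
  refine (Finset.abs_sum_le_sum_abs _ _).trans ?_
  refine (Finset.sum_le_sum fun i _ => φ.norm_coe_le_norm _).trans ?_
  simp

lemma bddAbove_birkhoffSum (n : ℕ) (s : Set X.carrier) :
    BddAbove (birkhoffSum (shiftMap X) φ n '' s) := by
  refine ⟨n * ‖φ‖, ?_⟩
  rintro _ ⟨x, -, rfl⟩
  exact (abs_le.1 (abs_birkhoffSum_le φ n x)).2

variable {φ}

lemma birkhoffSum_le_supBirkhoff {w : List A} {x : X.carrier} (hx : x ∈ wordCylinder X w) :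
    birkhoffSum (shiftMap X) φ w.length x ≤ supBirkhoff X φ w :=
  le_csSup (bddAbove_birkhoffSum φ _ _) (mem_image_of_mem _ hx)

lemma birkhoffSum_le_supBirkhoff_wordPrefix (n : ℕ) (x : X.carrier) :
    birkhoffSum (shiftMap X) φ n x ≤ supBirkhoff X φ (wordPrefix n x.1) := by
  have := birkhoffSum_le_supBirkhoff (φ := φ) (mem_wordCylinder_wordPrefix n x)
  rwa [length_wordPrefix] at this

lemma supBirkhoff_le {w : List A} (hw : w ∈ shiftLanguage X) {c : ℝ}
    (h : ∀ x ∈ wordCylinder X w, birkhoffSum (shiftMap X) φ w.length x ≤ c) :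
    supBirkhoff X φ w ≤ c := by
  apply csSup_le (hw.image _)
  rintro _ ⟨x, hx, rfl⟩
  exact h x hx

lemma supBirkhoff_append_le {u v : List A} (h : u ++ v ∈ shiftLanguage X) :
    supBirkhoff X φ (u ++ v) ≤ supBirkhoff X φ u + supBirkhoff X φ v := by
  refine supBirkhoff_le h fun x hx => ?_
  rw [mem_wordCylinder_append] at hx
  rw [List.length_append, birkhoffSum_add]
  exact add_le_add (birkhoffSum_le_supBirkhoff hx.1) (birkhoffSum_le_supBirkhoff hx.2)

lemma abs_supBirkhoff_le {w : List A} (hw : w ∈ shiftLanguage X) :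
    |supBirkhoff X φ w| ≤ w.length * ‖φ‖ := by
  rw [abs_le]
  constructor
  · obtain ⟨x, hx⟩ := hw
    exact (abs_le.1 (abs_birkhoffSum_le φ _ x)).1.trans (birkhoffSum_le_supBirkhoff hx)
  · exact supBirkhoff_le hw fun x _ => (abs_le.1 (abs_birkhoffSum_le φ _ x)).2

lemma supBirkhoff_le_of_bowen {V : ℝ} {w : List A}
    (hV : ∀ x ∈ wordCylinder X w, ∀ y ∈ wordCylinder X w,
      |birkhoffSum (shiftMap X) φ w.length x - birkhoffSum (shiftMap X) φ w.length y| ≤ V)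
    {x : X.carrier} (hx : x ∈ wordCylinder X w) :
    supBirkhoff X φ w ≤ birkhoffSum (shiftMap X) φ w.length x + V :=
  supBirkhoff_le ⟨x, hx⟩ fun y hy => by linarith [(abs_le.1 (hV y hy x hx)).2]

/-- The loss in Birkhoff sums over a concatenation with gaps. -/
lemma Follows.sum_le {V : ℝ} {t : ℕ} {ws : List (List A)} (hV : ∀ w ∈ ws,
      ∀ x ∈ wordCylinder X w, ∀ y ∈ wordCylinder X w,
      |birkhoffSum (shiftMap X) φ w.length x - birkhoffSum (shiftMap X) φ w.length y| ≤ V)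
    {p : X.carrier} (hp : Follows X t ws p) :
    (ws.map fun w => supBirkhoff X φ w - (V + t * ‖φ‖)).sum ≤
      birkhoffSum (shiftMap X) φ (gapLength t ws) p := by
  induction ws generalizing p with
  | nil => simp
  | cons w ws ih =>
    rw [gapLength_cons, birkhoffSum_add, birkhoffSum_add, List.map_cons, List.sum_cons]
    have h1 := ih (fun w hw => hV w (by simp [hw])) hp.2
    have h2 := supBirkhoff_le_of_bowen (hV w (by simp)) hp.1
    have h3 := (abs_le.1 (abs_birkhoffSum_le φ t ((shiftMap X)^[w.length] p))).1
    linarith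

end Topology

/-! ### Partition sums and the pressure -/

section Counting

variable {A : Type*} [Fintype A]

open Classical in
/-- The words of length `n` in `D`. -/
def wordsOf (D : Set (List A)) (n : ℕ) : Finset (List A) :=
  (Finset.univ.filter fun w : Fin n → A => List.ofFn w ∈ D).image List.ofFn

lemma mem_wordsOf {D : Set (List A)} {n : ℕ} {w : List A} :
    w ∈ wordsOf D n ↔ w.length = n ∧ w ∈ D := by
  simp only [wordsOf, Finset.mem_image, Finset.mem_filter, Finset.mem_univ, true_and]
  constructor
  · rintro ⟨v, hv, rfl⟩
    exact ⟨by simp, hv⟩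
  · rintro ⟨rfl, hw⟩
    exact ⟨w.get, by simpa using hw, by simp⟩

variable [TopologicalSpace A] [DiscreteTopology A] {X : Subshift A ℕ} (φ : C(X.carrier, ℝ))

lemma partitionSum_eq (D : Set (List A)) (φ : X.carrier → ℝ) (n : ℕ) :
    partitionSum X D φ n = ∑ w ∈ wordsOf D n, Real.exp (supBirkhoff X φ w) := by
  classical
  rw [partitionSum, wordsOf, Finset.sum_image (fun _ _ _ _ h => List.ofFn_injective h),
    Finset.sum_filter]

lemma partitionSum_nonneg (D : Set (List A)) (φ : X.carrier → ℝ) (n : ℕ) :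
    0 ≤ partitionSum X D φ n := by
  rw [partitionSum_eq]; positivity

lemma partitionSum_mono {D E : Set (List A)} (h : D ⊆ E) (φ : X.carrier → ℝ) (n : ℕ) :
    partitionSum X D φ n ≤ partitionSum X E φ n := by
  rw [partitionSum_eq, partitionSum_eq]
  exact Finset.sum_le_sum_of_subset_of_nonneg
    (fun w hw => mem_wordsOf.2 ⟨(mem_wordsOf.1 hw).1, h (mem_wordsOf.1 hw).2⟩)
    fun _ _ _ => (Real.exp_pos _).le

/-- A sum over a finite set is at most a sum over another one into which it injects. -/
lemma Finset.sum_le_sum_of_inj {ι κ : Type*} {s : Finset ι} {t : Finset κ} {f : ι → ℝ}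
    {g : κ → ℝ} (e : ι → κ) (he : ∀ i ∈ s, e i ∈ t)
    (hinj : ∀ i ∈ s, ∀ j ∈ s, e i = e j → i = j) (hle : ∀ i ∈ s, f i ≤ g (e i))
    (hg : ∀ k ∈ t, 0 ≤ g k) : ∑ i ∈ s, f i ≤ ∑ k ∈ t, g k := by
  classical
  calc ∑ i ∈ s, f i ≤ ∑ i ∈ s, g (e i) := Finset.sum_le_sum hle
    _ = ∑ k ∈ s.image e, g k := by
      rw [Finset.sum_image fun i hi j hj h => hinj i hi j hj h]
    _ ≤ ∑ k ∈ t, g k := Finset.sum_le_sum_of_subset_of_nonneg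
      (Finset.image_subset_iff.2 he) fun k hk _ => hg k hk

lemma sum_exp_birkhoffSum_le {ι : Type*} (s : Finset ι) (p : ι → X.carrier) (n : ℕ)
    (hinj : ∀ i ∈ s, ∀ j ∈ s, (∀ k < n, (p i).1 k = (p j).1 k) → i = j) :
    ∑ i ∈ s, Real.exp (birkhoffSum (shiftMap X) φ n (p i)) ≤
      partitionSum X (shiftLanguage X) φ n := by
  rw [partitionSum_eq]
  refine Finset.sum_le_sum_of_inj (fun i => wordPrefix n (p i).1)
    (fun i _ => mem_wordsOf.2 ⟨by simp, wordPrefix_mem_shiftLanguage _ _⟩)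
    (fun i hi j hj h => hinj i hi j hj (wordPrefix_eq_iff.1 h))
    (fun i _ => Real.exp_le_exp.2 (birkhoffSum_le_supBirkhoff_wordPrefix n _))
    fun _ _ => (Real.exp_pos _).le

lemma partitionSum_add_le (m n : ℕ) :
    partitionSum X (shiftLanguage X) φ (m + n) ≤
      partitionSum X (shiftLanguage X) φ m * partitionSum X (shiftLanguage X) φ n := by
  simp only [partitionSum_eq]
  rw [Finset.sum_mul_sum, ← Finset.sum_product']
  refine Finset.sum_le_sum_of_inj (fun w => (w.take m, w.drop m)) ?_ ?_ ?_
    fun _ _ => by positivity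
  · intro w hw
    obtain ⟨hl, hw⟩ := mem_wordsOf.1 hw
    have := shiftLanguage_of_append (u := w.take m) (v := w.drop m)
      (by rwa [List.take_append_drop])
    simp only [Finset.mem_product, mem_wordsOf]
    exact ⟨⟨by simp [hl], this.1⟩, ⟨by simp [hl], this.2⟩⟩
  · intro w _ w' _ h
    simp only [Prod.mk.injEq] at h
    rw [← List.take_append_drop m w, ← List.take_append_drop m w', h.1, h.2]
  · intro w hw
    obtain ⟨hl, hw⟩ := mem_wordsOf.1 hw
    rw [← Real.exp_add, Real.exp_le_exp]
    have := supBirkhoff_append_le (φ := φ) (u := w.take m) (v := w.drop m)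
      (by rwa [List.take_append_drop])
    rwa [List.take_append_drop] at this

variable [Nonempty X.carrier]

lemma exp_le_partitionSum (n : ℕ) :
    Real.exp (-(n * ‖φ‖)) ≤ partitionSum X (shiftLanguage X) φ n := by
  obtain ⟨x⟩ := ‹Nonempty X.carrier›
  have := sum_exp_birkhoffSum_le φ {()} (fun _ => x) n (by simp)
  simp only [Finset.sum_singleton] at this
  refine le_trans (Real.exp_le_exp.2 ?_) this
  linarith [(abs_le.1 (abs_birkhoffSum_le φ n x)).1]

lemma partitionSum_pos (n : ℕ) : 0 < partitionSum X (shiftLanguage X) φ n :=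
  (Real.exp_pos _).trans_le (exp_le_partitionSum φ n)

lemma subadditive_log_partitionSum :
    Subadditive fun n => Real.log (partitionSum X (shiftLanguage X) φ n) := by
  intro m n
  rw [← Real.log_mul (partitionSum_pos φ m).ne' (partitionSum_pos φ n).ne']
  exact Real.log_le_log (partitionSum_pos φ _) (partitionSum_add_le φ m n)

lemma bddBelow_log_partitionSum :
    BddBelow (range fun n : ℕ => Real.log (partitionSum X (shiftLanguage X) φ n) / n) := by
  refine ⟨-‖φ‖, ?_⟩
  rintro _ ⟨n, rfl⟩
  rcases Nat.eq_zero_or_pos n with rfl | hn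
  · simp
  have hn' : (0 : ℝ) < n := by exact_mod_cast hn
  simp only
  rw [le_div_iff₀ hn', Real.le_log_iff_exp_le (partitionSum_pos φ n)]
  convert exp_le_partitionSum φ n using 2
  ring

lemma tendsto_topPressure :
    Tendsto (fun n : ℕ => Real.log (partitionSum X (shiftLanguage X) φ n) / n) atTop
      (𝓝 (topPressure X φ)) := by
  have h := (subadditive_log_partitionSum φ).tendsto_lim (bddBelow_log_partitionSum φ)
  rwa [show topPressure X φ = _ from h.limsup_eq]

/-- By Fekete's lemma the pressure is an infimum, so the bound holds at every `n` without a
constant. It is the source of the lower bounds on weights of words. -/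
lemma exp_topPressure_le (n : ℕ) :
    Real.exp (n * topPressure X φ) ≤ partitionSum X (shiftLanguage X) φ n := by
  rcases Nat.eq_zero_or_pos n with rfl | hn
  · simpa using exp_le_partitionSum φ 0
  have h := (subadditive_log_partitionSum φ).tendsto_lim (bddBelow_log_partitionSum φ)
  have h1 : topPressure X φ = (subadditive_log_partitionSum φ).lim := h.limsup_eq
  have h2 := (subadditive_log_partitionSum φ).lim_le_div (bddBelow_log_partitionSum φ) hn.ne'
  rw [← h1, le_div_iff₀ (by exact_mod_cast hn), Real.le_log_iff_exp_le (partitionSum_pos φ n)]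
    at h2
  rwa [mul_comm]

lemma le_topPressure_of_frequently {c : ℝ}
    (h : ∃ᶠ n : ℕ in atTop, Real.exp (n * c) ≤ partitionSum X (shiftLanguage X) φ n) :
    c ≤ topPressure X φ := by
  refine ge_of_tendsto_of_frequently (tendsto_topPressure φ) ?_
  refine (h.and_eventually (eventually_gt_atTop 0)).mono fun n hn => ?_
  rw [le_div_iff₀ (by exact_mod_cast hn.2), Real.le_log_iff_exp_le (partitionSum_pos φ n), mul_comm]
  exact hn.1

/-- A first upper bound with an arbitrarily small exponential loss, which `kraft_inequality` later
removes. -/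
lemma exists_partitionSum_le {ε : ℝ} (hε : 0 < ε) :
    ∃ C : ℝ, 0 < C ∧ ∀ n, partitionSum X (shiftLanguage X) φ n ≤
      C * Real.exp (n * (topPressure X φ + ε)) := by
  have h := (tendsto_topPressure φ).eventually_lt_const (lt_add_of_pos_right _ hε)
  obtain ⟨N, hN⟩ := eventually_atTop.1 (h.and (eventually_gt_atTop 0))
  have hb : ∀ n ≥ N, partitionSum X (shiftLanguage X) φ n ≤
      Real.exp (n * (topPressure X φ + ε)) := by
    intro n hn
    obtain ⟨h1, h2⟩ := hN n hn
    rw [div_lt_iff₀ (by exact_mod_cast h2)] at h1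
    rw [← Real.log_le_iff_le_exp (partitionSum_pos φ n), mul_comm]
    exact h1.le
  -- The sum of ratios covers the finitely many `n < N`, the `1` all others.
  refine ⟨1 + ∑ n ∈ Finset.range N, partitionSum X (shiftLanguage X) φ n /
    Real.exp (n * (topPressure X φ + ε)), ?_, fun n => ?_⟩
  · have : 0 ≤ ∑ n ∈ Finset.range N, partitionSum X (shiftLanguage X) φ n /
      Real.exp (n * (topPressure X φ + ε)) :=
      Finset.sum_nonneg fun n _ => div_nonneg (partitionSum_pos φ n).le (Real.exp_pos _).le
    linarith
  · rw [← div_le_iff₀ (Real.exp_pos _)]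
    have h0 : ∀ n ∈ Finset.range N, 0 ≤ partitionSum X (shiftLanguage X) φ n /
      Real.exp (n * (topPressure X φ + ε)) := fun n _ =>
      div_nonneg (partitionSum_pos φ n).le (Real.exp_pos _).le
    by_cases hn : n < N
    · have := Finset.single_le_sum h0 (Finset.mem_range.2 hn)
      linarith
    · have h1 := hb n (by omega)
      rw [← div_le_one (Real.exp_pos _)] at h1
      linarith [Finset.sum_nonneg h0]

/-- If `a > b`, the powers of `a / b` outgrow every linear bound. This lets counting factors
disappear after taking high powers. -/
lemma le_of_forall_pow_le {a b C : ℝ} (hb : 0 < b) (k : ℕ)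
    (h : ∀ m : ℕ, 1 ≤ m → a ^ m ≤ C * (m * k + 1) * b ^ m) : a ≤ b := by
  by_contra! hab
  have hr : 1 < a / b := (one_lt_div hb).2 hab
  have h1 : ∀ m : ℕ, 1 ≤ m → (a / b) ^ m ≤ C * (m * k + 1) := by
    intro m hm
    rw [div_pow, div_le_iff₀ (by positivity)]
    exact h m hm
  have h2 : Tendsto (fun m : ℕ => (C * (m * k + 1)) / (a / b) ^ m) atTop (𝓝 0) := by
    have e1 := tendsto_pow_const_div_const_pow_of_one_lt 1 hr
    have e0 := tendsto_pow_const_div_const_pow_of_one_lt 0 hr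
    have := (e1.const_mul (C * k)).add (e0.const_mul C)
    simp only [mul_zero, add_zero] at this
    refine this.congr fun m => ?_
    ring
  have h3 := h2.eventually_lt_const one_pos
  obtain ⟨m, hm, hm1⟩ := (h3.and (eventually_ge_atTop 1)).exists
  rw [div_lt_one (by positivity)] at hm
  exact absurd (h1 m hm1) (not_le.2 hm)

/-- Kraft inequality for the pressure. -/
theorem kraft_inequality (U : Finset (List A)) (hU : PrefixFree X U) {t : ℕ} {V : ℝ}
    (hglue : ∀ ws : List (List A), ws ≠ [] → (∀ w ∈ ws, w ∈ U) →
      ∃ p : X.carrier, Follows X t ws p)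
    (hV : ∀ w ∈ U, ∀ x ∈ wordCylinder X w, ∀ y ∈ wordCylinder X w,
      |birkhoffSum (shiftMap X) φ w.length x - birkhoffSum (shiftMap X) φ w.length y| ≤ V) :
    ∑ u ∈ U, Real.exp (supBirkhoff X φ u - (u.length + t) * topPressure X φ) ≤
      Real.exp (V + t * ‖φ‖) := by
  set P := topPressure X φ
  set J := ∑ u ∈ U, (u.length + t)
  have hJ : ∀ u ∈ U, u.length + t ≤ J := fun u hu =>
    Finset.single_le_sum (f := fun u : List A => u.length + t) (fun _ _ => Nat.zero_le _) hu
  set s := ∑ u ∈ U, Real.exp (supBirkhoff X φ u - (u.length + t) * P)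
  -- `J` does not depend on `ε`, so the right-hand side tends to 1.
  suffices H : ∀ ε : ℝ, 0 < ε → s * Real.exp (-(V + t * ‖φ‖)) ≤ Real.exp (J * ε) by
    have hlim : Tendsto (fun ε : ℝ => Real.exp (J * ε)) (𝓝[>] 0) (𝓝 1) := by
      have : Continuous fun ε : ℝ => Real.exp (J * ε) := by fun_prop
      simpa using (this.tendsto 0).mono_left nhdsWithin_le_nhds
    have := ge_of_tendsto hlim (eventually_nhdsWithin_of_forall fun ε hε => H ε hε)
    rwa [Real.exp_neg, ← div_eq_mul_inv, div_le_one (Real.exp_pos _)] at this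
  intro ε hε
  obtain ⟨C, hC, hCb⟩ := exists_partitionSum_le φ hε
  -- The `m`-th power of the sum runs over `m`-tuples of words of `U`. Their total lengths take at
  -- most `m * J + 1` values, and the tuples of each total length weigh at most one partition sum.
  refine le_of_forall_pow_le (C := C) (Real.exp_pos _) J fun m hm => ?_
  have hp : ∀ g : Fin m → List A, (∀ i, g i ∈ U) → ∃ p : X.carrier, Follows X t (List.ofFn g) p := by
    intro g hg
    apply hglue
    · intro h
      have := congrArg List.length h
      simp at this; omega
    · intro w hw
      obtain ⟨i, rfl⟩ := List.mem_ofFn.1 hw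
      exact hg i
  have hp' : ∀ g : Fin m → List A, ∃ p : X.carrier, (∀ i, g i ∈ U) → Follows X t (List.ofFn g) p := by
    intro g
    by_cases hg : ∀ i, g i ∈ U
    · obtain ⟨p, hp⟩ := hp g hg; exact ⟨p, fun _ => hp⟩
    · exact ⟨Classical.arbitrary _, fun h => absurd h hg⟩
  choose p hpF using hp'
  have hlen : ∀ g : Fin m → List A, (gapLength t (List.ofFn g) : ℕ) = ∑ i, ((g i).length + t) := by
    intro g
    simp [gapLength, List.map_ofFn, List.sum_ofFn]
  -- Each word with its gap loses at most `V + t * ‖φ‖`, which the factor `exp (-(V + t * ‖φ‖))`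
  -- pays for.
  have key : ∀ g ∈ Fintype.piFinset (fun _ : Fin m => U),
      ∏ i, (Real.exp (supBirkhoff X φ (g i) - ((g i).length + t) * P) *
          Real.exp (-(V + t * ‖φ‖))) ≤
        Real.exp (birkhoffSum (shiftMap X) φ (gapLength t (List.ofFn g)) (p g)) *
          Real.exp (-(gapLength t (List.ofFn g) * P)) := by
    intro g hg
    rw [Fintype.mem_piFinset] at hg
    have h1 := (hpF g hg).sum_le (φ := φ) (V := V) (by
      intro w hw
      obtain ⟨i, rfl⟩ := List.mem_ofFn.1 hw
      exact hV _ (hg i))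
    simp only [← Real.exp_add]
    rw [← Real.exp_sum, Real.exp_le_exp]
    rw [List.map_ofFn, List.sum_ofFn] at h1
    simp only [Function.comp] at h1
    have h2 : ((gapLength t (List.ofFn g) : ℕ) : ℝ) = ∑ i, (((g i).length : ℝ) + t) := by
      rw [hlen]; push_cast; rfl
    have h3 : ∑ i, (supBirkhoff X φ (g i) - (((g i).length : ℝ) + t) * P + -(V + t * ‖φ‖)) =
        ∑ i, (supBirkhoff X φ (g i) - (V + t * ‖φ‖)) - (∑ i, (((g i).length : ℝ) + t)) * P := by
      rw [Finset.sum_mul, ← Finset.sum_sub_distrib]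
      exact Finset.sum_congr rfl fun i _ => by ring
    rw [h3, h2]
    linarith
  have hle : ∀ g ∈ Fintype.piFinset (fun _ : Fin m => U),
      gapLength t (List.ofFn g) ∈ Finset.range (m * J + 1) := by
    intro g hg
    rw [Fintype.mem_piFinset] at hg
    rw [Finset.mem_range, hlen]
    have : ∑ i, ((g i).length + t) ≤ ∑ i : Fin m, J := Finset.sum_le_sum fun i _ => hJ _ (hg i)
    simp at this
    simp; omega
  calc (s * Real.exp (-(V + t * ‖φ‖))) ^ m
      = ∑ g ∈ Fintype.piFinset (fun _ : Fin m => U),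
        ∏ i, (Real.exp (supBirkhoff X φ (g i) - ((g i).length + t) * P) *
          Real.exp (-(V + t * ‖φ‖))) := by
        rw [Finset.sum_mul, Finset.sum_pow']
    _ ≤ ∑ g ∈ Fintype.piFinset (fun _ : Fin m => U),
        Real.exp (birkhoffSum (shiftMap X) φ (gapLength t (List.ofFn g)) (p g)) *
          Real.exp (-(gapLength t (List.ofFn g) * P)) := Finset.sum_le_sum key
    _ = ∑ N ∈ Finset.range (m * J + 1), ∑ g ∈ Fintype.piFinset (fun _ : Fin m => U) with
          gapLength t (List.ofFn g) = N,
        Real.exp (birkhoffSum (shiftMap X) φ (gapLength t (List.ofFn g)) (p g)) *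
          Real.exp (-(gapLength t (List.ofFn g) * P)) :=
        (Finset.sum_fiberwise_of_maps_to hle _).symm
    _ ≤ ∑ N ∈ Finset.range (m * J + 1), C * Real.exp (J * ε) ^ m := by
        refine Finset.sum_le_sum fun N hN => ?_
        have e1 : ∀ g ∈ (Fintype.piFinset (fun _ : Fin m => U)).filter
            (fun g => gapLength t (List.ofFn g) = N),
            Real.exp (birkhoffSum (shiftMap X) φ (gapLength t (List.ofFn g)) (p g)) *
              Real.exp (-(gapLength t (List.ofFn g) * P)) =
            Real.exp (birkhoffSum (shiftMap X) φ N (p g)) * Real.exp (-(N * P)) := by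
          intro g hg
          rw [(Finset.mem_filter.1 hg).2]
        rw [Finset.sum_congr rfl e1, ← Finset.sum_mul]
        -- For a fixed total length the tuple is recovered from the first `N` letters of its glued
        -- point.
        have e2 := sum_exp_birkhoffSum_le φ ((Fintype.piFinset (fun _ : Fin m => U)).filter
            (fun g => gapLength t (List.ofFn g) = N)) p N (by
          intro g hg g' hg' h
          obtain ⟨hg, hgN⟩ := Finset.mem_filter.1 hg
          obtain ⟨hg', hgN'⟩ := Finset.mem_filter.1 hg'
          rw [Fintype.mem_piFinset] at hg hg'
          apply List.ofFn_injective
          refine Follows.injective hU (by simp) ?_ ?_ (hpF g hg) (hpF g' hg') (by rwa [hgN])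
          · intro w hw
            obtain ⟨i, rfl⟩ := List.mem_ofFn.1 hw
            exact hg i
          · intro w hw
            obtain ⟨i, rfl⟩ := List.mem_ofFn.1 hw
            exact hg' i)
        refine (mul_le_mul_of_nonneg_right (e2.trans (hCb N)) (Real.exp_pos _).le).trans ?_
        rw [mul_assoc, ← Real.exp_add, ← Real.exp_nat_mul]
        refine mul_le_mul_of_nonneg_left (Real.exp_le_exp.2 ?_) hC.le
        have : (N : ℝ) ≤ m * J := by
          have := Finset.mem_range.1 hN
          exact_mod_cast (by omega : N ≤ m * J)
        nlinarith
    _ = C * (m * J + 1) * Real.exp (J * ε) ^ m := by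
        rw [Finset.sum_const, Finset.card_range]
        simp
        ring

end Counting

/-! ### Counting with a decomposition of the language -/

section Decomposition

variable {A : Type*} [TopologicalSpace A] {X : Subshift A ℕ}
  {Cp G Cs : Set (List A)}

lemma IsDecomposition.nil_mem [Nonempty X.carrier] (h : IsDecomposition X Cp G Cs) :
    [] ∈ Cp ∧ [] ∈ G ∧ [] ∈ Cs := by
  obtain ⟨-, -, -, h4⟩ := h
  obtain ⟨u, hu, v, hv, w, hw, e⟩ := h4 [] ⟨Classical.arbitrary _, by simp⟩
  have h1 : u = [] ∧ v = [] ∧ w = [] := by simpa [eq_comm, and_assoc] using e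
  obtain ⟨rfl, rfl, rfl⟩ := h1
  exact ⟨hu, hv, hw⟩

lemma fattened_subset (M : ℕ) : fattened X Cp G Cs M ⊆ shiftLanguage X := fun _ h => h.1

lemma fattened_mono {M N : ℕ} (h : M ≤ N) : fattened X Cp G Cs M ⊆ fattened X Cp G Cs N := by
  rintro z ⟨hz, u, hu, v, hv, w, hw, h1, h2, rfl⟩
  exact ⟨hz, u, hu, v, hv, w, hw, h1.trans h, h2.trans h, rfl⟩

lemma IsDecomposition.subset_fattened [Nonempty X.carrier] (h : IsDecomposition X Cp G Cs)
    (M : ℕ) : G ⊆ fattened X Cp G Cs M := fun z hz =>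
  ⟨h.2.1 hz, [], h.nil_mem.1, z, hz, [], h.nil_mem.2.2, by simp, by simp, by simp⟩

variable [DiscreteTopology A]

/-- Each outer piece has at most `M` letters, so between two points of the cylinder it changes the
Birkhoff sum by at most `2 * M * ‖φ‖`. -/
lemma HasBowenOn.fattened [Finite A] {φ : C(X.carrier, ℝ)} (h : HasBowenOn X G φ) (M : ℕ) :
    HasBowenOn X (fattened X Cp G Cs M) φ := by
  obtain ⟨V, hV⟩ := h
  refine ⟨V + 4 * M * ‖φ‖, ?_⟩
  rintro z ⟨-, u, -, v, hv, w, -, hu, hw, rfl⟩ x hx y hy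
  simp only [mem_wordCylinder_append, List.length_append] at hx hy
  simp only [List.length_append, birkhoffSum_add]
  have h1 := abs_le.1 (hV v hv _ hx.1.2 _ hy.1.2)
  have hu' : (u.length : ℝ) * ‖φ‖ ≤ M * ‖φ‖ := by gcongr
  have hw' : (w.length : ℝ) * ‖φ‖ ≤ M * ‖φ‖ := by gcongr
  have a1 := abs_le.1 (abs_birkhoffSum_le φ u.length x)
  have a2 := abs_le.1 (abs_birkhoffSum_le φ u.length y)
  have a3 := abs_le.1 (abs_birkhoffSum_le φ w.length ((shiftMap X)^[u.length + v.length] x))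
  have a4 := abs_le.1 (abs_birkhoffSum_le φ w.length ((shiftMap X)^[u.length + v.length] y))
  rw [abs_le]
  constructor <;> linarith

variable [Fintype A]

lemma prefixFree_wordsOf (D : Set (List A)) (n : ℕ) : PrefixFree X (wordsOf D n : Set (List A)) := by
  rintro u hu v hv ⟨x, hxu, hxv⟩
  exact eq_of_mem_wordCylinder hxu hxv ((mem_wordsOf.1 hu).1.trans (mem_wordsOf.1 hv).1.symm)

variable [Nonempty X.carrier] {φ : C(X.carrier, ℝ)}

/-- Words of one length are prefix-free, so `kraft_inequality` applies at every `n` with the same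
constants. -/
lemma partitionSum_le_of_gluesPer {D : Set (List A)} {t : ℕ} (ht : GluesPer X D t)
    (hB : HasBowenOn X D φ) :
    ∃ B : ℝ, 0 < B ∧ ∀ n, partitionSum X D φ n ≤ B * Real.exp (n * topPressure X φ) := by
  obtain ⟨V, hV⟩ := hB
  refine ⟨Real.exp (V + t * ‖φ‖ + t * topPressure X φ), Real.exp_pos _, fun n => ?_⟩
  have h := kraft_inequality φ (wordsOf D n) (prefixFree_wordsOf D n) (t := t) (V := V)
    (fun ws h1 h2 => by
      obtain ⟨p, hp, -⟩ := ht ws h1 fun w hw => (mem_wordsOf.1 (h2 w hw)).2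
      exact ⟨p, hp⟩)
    (fun w hw => hV w (mem_wordsOf.1 hw).2)
  have e : ∀ u ∈ wordsOf D n, Real.exp (supBirkhoff X φ u - (u.length + t) * topPressure X φ) =
      Real.exp (supBirkhoff X φ u) * Real.exp (-((n + t) * topPressure X φ)) := by
    intro u hu
    rw [← Real.exp_add, (mem_wordsOf.1 hu).1]; ring_nf
  rw [Finset.sum_congr rfl e, ← Finset.sum_mul, ← partitionSum_eq, Real.exp_neg,
    ← div_eq_mul_inv, div_le_iff₀ (Real.exp_pos _), ← Real.exp_add] at h
  rw [← Real.exp_add]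
  refine h.trans (Real.exp_le_exp.2 (by linarith))

/-- Words whose decompositions have prefix and suffix lengths in a set `E`. -/
lemma sum_exp_le_of_decomposition (hd : IsDecomposition X Cp G Cs) {P B : ℝ}
    (hB : ∀ n, partitionSum X G φ n ≤ B * Real.exp (n * P)) (n : ℕ) (S : Finset (List A))
    (hS : ∀ z ∈ S, z.length = n ∧ z ∈ shiftLanguage X) (E : Set (ℕ × ℕ))
    (hE : ∀ u ∈ Cp, ∀ v ∈ G, ∀ w ∈ Cs, u ++ v ++ w ∈ S → (u.length, w.length) ∈ E) :
    ∃ T : Finset (ℕ × ℕ), (∀ p ∈ T, p ∈ E) ∧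
      ∑ z ∈ S, Real.exp (supBirkhoff X φ z) ≤
        (B * ∑ p ∈ T, (partitionSum X Cp φ p.1 * Real.exp (-(p.1 * P))) *
          (partitionSum X Cs φ p.2 * Real.exp (-(p.2 * P)))) * Real.exp (n * P) := by
  classical
  set T := (Finset.range (n + 1) ×ˢ Finset.range (n + 1)).filter
    (fun p => p ∈ E ∧ p.1 + p.2 ≤ n)
  refine ⟨T, fun p hp => (Finset.mem_filter.1 hp).2.1, ?_⟩
  have hdec : ∀ z : List A, ∃ u v w : List A, z ∈ S → u ∈ Cp ∧ v ∈ G ∧ w ∈ Cs ∧ z = u ++ v ++ w := by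
    intro z
    by_cases hz : z ∈ S
    · obtain ⟨u, hu, v, hv, w, hw, e⟩ := hd.2.2.2 z (hS z hz).2
      exact ⟨u, v, w, fun _ => ⟨hu, hv, hw, e⟩⟩
    · exact ⟨[], [], [], fun h => absurd h hz⟩
  choose u v w huvw using hdec
  -- Each `z` goes to the pieces of one chosen decomposition and the lengths of its outer pieces.
  -- Concatenation undoes this map, and subadditivity of `supBirkhoff` compares the weights.
  calc ∑ z ∈ S, Real.exp (supBirkhoff X φ z)
      ≤ ∑ q ∈ T.sigma (fun p => wordsOf Cp p.1 ×ˢ (wordsOf G (n - p.1 - p.2) ×ˢ wordsOf Cs p.2)),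
        Real.exp (supBirkhoff X φ q.2.1) * (Real.exp (supBirkhoff X φ q.2.2.1) *
          Real.exp (supBirkhoff X φ q.2.2.2)) := by
        refine Finset.sum_le_sum_of_inj
          (fun z => (⟨((u z).length, (w z).length), (u z, v z, w z)⟩ :
            Σ _ : ℕ × ℕ, List A × List A × List A)) ?_ ?_ ?_ fun _ _ => by positivity
        · intro z hz
          obtain ⟨h1, h2, h3, h4⟩ := huvw z hz
          have hl := (hS z hz).1
          rw [h4] at hl
          simp only [List.length_append] at hl
          simp only [Finset.mem_sigma, Finset.mem_product, mem_wordsOf, T, Finset.mem_filter,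
            Finset.mem_range]
          refine ⟨⟨⟨by omega, by omega⟩, hE _ h1 _ h2 _ h3 (h4 ▸ hz), by omega⟩,
            ⟨trivial, h1⟩, ⟨by omega, h2⟩, trivial, h3⟩
        · intro z hz z' hz' h
          have e1 := (huvw z hz).2.2.2
          have e2 := (huvw z' hz').2.2.2
          simp only [Sigma.mk.injEq, Prod.mk.injEq, heq_eq_eq] at h
          rw [e1, e2, h.2.1, h.2.2.1, h.2.2.2]
        · intro z hz
          have e1 := (huvw z hz).2.2.2
          have hL := (hS z hz).2
          rw [← Real.exp_add, ← Real.exp_add, Real.exp_le_exp, ← add_assoc]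
          rw [e1] at hL
          conv_lhs => rw [e1]
          have h1 := supBirkhoff_append_le (φ := φ) hL
          have h2 := supBirkhoff_append_le (φ := φ) (shiftLanguage_of_append hL).1
          simp only
          linarith
    _ = ∑ p ∈ T, partitionSum X Cp φ p.1 * (partitionSum X G φ (n - p.1 - p.2) *
          partitionSum X Cs φ p.2) := by
        rw [Finset.sum_sigma]
        refine Finset.sum_congr rfl fun p _ => ?_
        simp only [partitionSum_eq]
        rw [Finset.sum_product, Finset.sum_mul]
        refine Finset.sum_congr rfl fun a _ => ?_
        rw [Finset.sum_mul_sum, ← Finset.sum_product', Finset.mul_sum]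
    _ ≤ ∑ p ∈ T, B * ((partitionSum X Cp φ p.1 * Real.exp (-(p.1 * P))) *
          (partitionSum X Cs φ p.2 * Real.exp (-(p.2 * P)))) * Real.exp (n * P) := by
        refine Finset.sum_le_sum fun p hp => ?_
        have hp' := (Finset.mem_filter.1 hp).2.2
        have h1 := hB (n - p.1 - p.2)
        have h2 : Real.exp (((n - p.1 - p.2 : ℕ) : ℝ) * P) =
            Real.exp (-(p.1 * P)) * Real.exp (-(p.2 * P)) * Real.exp (n * P) := by
          rw [← Real.exp_add, ← Real.exp_add]
          congr 1
          rw [Nat.sub_sub, Nat.cast_sub hp']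
          push_cast; ring
        rw [h2] at h1
        have h3 : partitionSum X Cp φ p.1 * (partitionSum X G φ (n - p.1 - p.2) *
            partitionSum X Cs φ p.2) ≤ partitionSum X Cp φ p.1 * ((B * (Real.exp (-(p.1 * P)) *
              Real.exp (-(p.2 * P)) * Real.exp (n * P))) * partitionSum X Cs φ p.2) :=
          mul_le_mul_of_nonneg_left (mul_le_mul_of_nonneg_right h1 (partitionSum_nonneg _ _ _))
            (partitionSum_nonneg _ _ _)
        refine h3.trans (le_of_eq (by ring))
    _ = _ := by rw [← Finset.sum_mul, ← Finset.mul_sum]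

/-- The estimates on partition sums that follow from a good decomposition. -/
theorem IsGoodDecomposition.partitionSum_bounds (h : IsGoodDecomposition X φ Cp G Cs) :
    ∃ C₀ : ℝ, 1 ≤ C₀ ∧ (∀ n, partitionSum X (shiftLanguage X) φ n ≤
        C₀ * Real.exp (n * topPressure X φ)) ∧
      ∃ ε : ℕ → ℝ, Tendsto ε atTop (𝓝 0) ∧ ∀ M n,
        partitionSum X (shiftLanguage X \ fattened X Cp G Cs M) φ n ≤
          ε M * Real.exp (n * topPressure X φ) := by
  obtain ⟨hd, hper, hbow, hsum⟩ := h
  set P := topPressure X φ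
  obtain ⟨t, ht⟩ := ((hper 0).mono (hd.subset_fattened 0)).gluesPer
  obtain ⟨B, hB0, hB⟩ := partitionSum_le_of_gluesPer ht hbow
  have hs : Summable fun n : ℕ => partitionSum X (Cp ∪ Cs) φ n * Real.exp (-(n * P)) := by
    rw [← summable_nat_add_iff 1]
    refine hsum.congr fun n => by rw [neg_mul]
  have hsub : ∀ D ⊆ Cp ∪ Cs, Summable fun n : ℕ => partitionSum X D φ n * Real.exp (-(n * P)) :=
    fun D hD => hs.of_nonneg_of_le
      (fun n => mul_nonneg (partitionSum_nonneg _ _ _) (Real.exp_pos _).le)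
      (fun n => mul_le_mul_of_nonneg_right (partitionSum_mono hD _ _) (Real.exp_pos _).le)
  have hf := (hsub Cp subset_union_left).mul_of_nonneg (hsub Cs subset_union_right)
    (fun n => mul_nonneg (partitionSum_nonneg _ _ _) (Real.exp_pos _).le)
    (fun n => mul_nonneg (partitionSum_nonneg _ _ _) (Real.exp_pos _).le)
  set f : ℕ × ℕ → ℝ := fun p => (partitionSum X Cp φ p.1 * Real.exp (-(p.1 * P))) *
          (partitionSum X Cs φ p.2 * Real.exp (-(p.2 * P)))
  have hf0 : ∀ p, 0 ≤ f p := fun p => mul_nonneg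
    (mul_nonneg (partitionSum_nonneg _ _ _) (Real.exp_pos _).le)
    (mul_nonneg (partitionSum_nonneg _ _ _) (Real.exp_pos _).le)
  -- The error is the tail of a convergent double series outside a square: in every decomposition of
  -- a word not in `G(M)`, the prefix or the suffix is longer than `M`.
  refine ⟨max 1 (B * ∑' p, f p), le_max_left _ _, fun n => ?_,
    fun M => B * (∑' p, f p - ∑ p ∈ Finset.range (M + 1) ×ˢ Finset.range (M + 1), f p), ?_,
    fun M n => ?_⟩
  · obtain ⟨T, -, hT⟩ := sum_exp_le_of_decomposition (φ := φ) hd hB n (wordsOf (shiftLanguage X) n)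
      (fun z hz => mem_wordsOf.1 hz) univ (fun _ _ _ _ _ _ _ => mem_univ _)
    rw [← partitionSum_eq] at hT
    refine hT.trans (mul_le_mul_of_nonneg_right ?_ (Real.exp_pos _).le)
    refine le_trans ?_ (le_max_right _ _)
    exact mul_le_mul_of_nonneg_left (hf.sum_le_tsum _ fun _ _ => hf0 _) hB0.le
  · have h1 : Tendsto (fun M : ℕ => Finset.range (M + 1) ×ˢ Finset.range (M + 1)) atTop atTop := by
      refine tendsto_atTop_finset_of_monotone ?_ fun p => ⟨max p.1 p.2, ?_⟩
      · intro a b hab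
        apply Finset.product_subset_product <;>
          exact Finset.range_mono (by omega)
      · simp
    have h2 := (tendsto_const_nhds (x := ∑' p, f p)).sub (hf.hasSum.comp h1)
    rw [sub_self] at h2
    simpa using h2.const_mul B
  · classical
    obtain ⟨T, hT1, hT⟩ := sum_exp_le_of_decomposition (φ := φ) hd hB n
      (wordsOf (shiftLanguage X \ fattened X Cp G Cs M) n)
      (fun z hz => ⟨(mem_wordsOf.1 hz).1, (mem_wordsOf.1 hz).2.1⟩)
      {p | p ∉ Finset.range (M + 1) ×ˢ Finset.range (M + 1)} (by
        intro u hu v hv w hw hz hmem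
        obtain ⟨-, hL, hz⟩ := mem_wordsOf.1 hz
        refine hz ⟨hL, u, hu, v, hv, w, hw, ?_⟩
        simp only [Finset.mem_product, Finset.mem_range] at hmem
        exact ⟨by omega, by omega, rfl⟩)
    rw [← partitionSum_eq] at hT
    refine hT.trans (mul_le_mul_of_nonneg_right ?_ (Real.exp_pos _).le)
    refine mul_le_mul_of_nonneg_left ?_ hB0.le
    have hdisj : Disjoint T (Finset.range (M + 1) ×ˢ Finset.range (M + 1)) :=
      Finset.disjoint_left.2 fun p hp => hT1 p hp
    have := hf.sum_le_tsum (T ∪ Finset.range (M + 1) ×ˢ Finset.range (M + 1)) fun _ _ => hf0 _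
    rw [Finset.sum_union hdisj] at this
    linarith

lemma partitionSum_eq_add_diff {D : Set (List A)} (hD : D ⊆ shiftLanguage X) (n : ℕ) :
    partitionSum X (shiftLanguage X) φ n =
      partitionSum X D φ n + partitionSum X (shiftLanguage X \ D) φ n := by
  classical
  simp only [partitionSum_eq]
  rw [← Finset.sum_union]
  · congr 1
    ext w
    simp only [Finset.mem_union, mem_wordsOf, Set.mem_sdiff]
    have := @hD w
    tauto
  · rw [Finset.disjoint_left]
    intro w h1 h2
    exact (mem_wordsOf.1 h2).2.2 (mem_wordsOf.1 h1).2

end Decomposition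

/-! ### Weighted sums over periodic points -/

section Periodic

variable {A : Type*} [Fintype A] [TopologicalSpace A] [DiscreteTopology A] {X : Subshift A ℕ}
  (φ : C(X.carrier, ℝ))

lemma iterate_eq_of_agree {n : ℕ} {x y : X.carrier} (hn : 0 < n)
    (hx : (shiftMap X)^[n] x = x) (hy : (shiftMap X)^[n] y = y)
    (h : ∀ i < n, x.1 i = y.1 i) : x = y := by
  apply carrier_ext
  intro i
  induction i using Nat.strong_induction_on with
  | _ i ih =>
    by_cases hi : i < n
    · exact h i hi
    · have e : i = n + (i - n) := by omega
      have h1 := shiftMap_iterate_apply n x (i - n)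
      have h2 := shiftMap_iterate_apply n y (i - n)
      rw [hx, ← e] at h1
      rw [hy, ← e] at h2
      rw [← h1, ← h2]
      exact ih _ (by omega)

lemma finite_perPoints {n : ℕ} (hn : 0 < n) : (perPoints X n).Finite := by
  refine Set.Finite.of_finite_image (f := fun x : X.carrier => fun i : Fin n => x.1 i)
    (Set.toFinite _) ?_
  intro x hx y hy h
  exact iterate_eq_of_agree hn hx hy fun i hi => congrFun h ⟨i, hi⟩

open Classical in
/-- The points of period `n`, as a finite set (for `n > 0`). -/
def perFinset (X : Subshift A ℕ) (n : ℕ) : Finset X.carrier :=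
  if h : (perPoints X n).Finite then h.toFinset else ∅

lemma mem_perFinset {n : ℕ} (hn : 0 < n) {x : X.carrier} :
    x ∈ perFinset X n ↔ (shiftMap X)^[n] x = x := by
  rw [perFinset, dif_pos (finite_perPoints hn)]
  simp [perPoints]

open Classical in
/-- `∑ exp S_n φ(x)` over the points `x ∈ S` of period `n`. -/
def perSum (φ : X.carrier → ℝ) (n : ℕ) (S : Set X.carrier) : ℝ :=
  ∑ x ∈ perFinset X n with x ∈ S, Real.exp (birkhoffSum (shiftMap X) φ n x)

open Classical in
lemma mem_filter_perFinset {n : ℕ} (hn : 0 < n) {S : Set X.carrier} {x : X.carrier} :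
    x ∈ (perFinset X n).filter (fun x => x ∈ S) ↔ (shiftMap X)^[n] x = x ∧ x ∈ S := by
  rw [Finset.mem_filter, mem_perFinset hn]

lemma perSum_nonneg (n : ℕ) (S : Set X.carrier) : 0 ≤ perSum φ n S := by
  unfold perSum; positivity

/-- The shift permutes the points of period `n`, with inverse its iterate `n - 1`, and preserves
Birkhoff sums over a full period. -/
lemma perSum_preimage {n : ℕ} (hn : 0 < n) (S : Set X.carrier) :
    perSum φ n (shiftMap X ⁻¹' S) = perSum φ n S := by
  classical
  unfold perSum
  have hcomm : ∀ x : X.carrier, (shiftMap X)^[n] x = x →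
      (shiftMap X)^[n] (shiftMap X x) = shiftMap X x := by
    intro x hx
    rw [← Function.iterate_succ_apply, Function.iterate_succ_apply', hx]
  have hback : ∀ x : X.carrier, (shiftMap X)^[n] x = x →
      shiftMap X ((shiftMap X)^[n - 1] x) = x := by
    intro x hx
    rw [← Function.iterate_succ_apply' (shiftMap X), Nat.succ_eq_add_one, Nat.sub_add_cancel hn, hx]
  refine Finset.sum_nbij' (shiftMap X) ((shiftMap X)^[n - 1]) ?_ ?_ ?_ ?_ ?_
  · intro x hx
    rw [Finset.mem_filter, mem_perFinset hn] at hx ⊢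
    exact ⟨hcomm x hx.1, hx.2⟩
  · intro x hx
    rw [Finset.mem_filter, mem_perFinset hn] at hx ⊢
    refine ⟨?_, ?_⟩
    · rw [← Function.iterate_add_apply, add_comm, Function.iterate_add_apply, hx.1]
    · rw [mem_preimage, hback x hx.1]; exact hx.2
  · intro x hx
    rw [Finset.mem_filter, mem_perFinset hn] at hx
    rw [← Function.iterate_succ_apply, Nat.succ_eq_add_one, Nat.sub_add_cancel hn, hx.1]
  · intro x hx
    rw [Finset.mem_filter, mem_perFinset hn] at hx
    exact hback x hx.1
  · intro x hx
    rw [Finset.mem_filter, mem_perFinset hn] at hx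
    have := birkhoffSum_apply_sub_birkhoffSum (shiftMap X) φ n x
    rw [hx.1, sub_self, sub_eq_zero] at this
    rw [this]

/-- Once `w` is known, a point of period `n` is determined by its remaining `n - |w|` letters; the
Birkhoff sum is split at the same place. -/
lemma perSum_wordCylinder_le {n : ℕ} (hn : 0 < n) {w : List A} (hw : w.length ≤ n) :
    perSum φ n (wordCylinder X w) ≤ Real.exp (supBirkhoff X φ w) *
      partitionSum X (shiftLanguage X) φ (n - w.length) := by
  classical
  unfold perSum
  have h := sum_exp_birkhoffSum_le φ
    ((perFinset X n).filter fun x => x ∈ wordCylinder X w)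
    (fun x => (shiftMap X)^[w.length] x) (n - w.length) (by
      intro x hx y hy h
      rw [Finset.mem_filter, mem_perFinset hn] at hx hy
      refine iterate_eq_of_agree hn hx.1 hy.1 fun i hi => ?_
      by_cases hiw : i < w.length
      · rw [mem_wordCylinder.1 hx.2 i hiw, mem_wordCylinder.1 hy.2 i hiw]
      · have := h (i - w.length) (by omega)
        simp only [shiftMap_iterate_apply] at this
        rwa [Nat.add_sub_of_le (by omega)] at this)
  refine le_trans ?_ (mul_le_mul_of_nonneg_left h (Real.exp_pos _).le)
  rw [Finset.mul_sum]
  refine Finset.sum_le_sum fun x hx => ?_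
  rw [Finset.mem_filter] at hx
  rw [← Real.exp_add, Real.exp_le_exp]
  have e : birkhoffSum (shiftMap X) φ n x = birkhoffSum (shiftMap X) φ w.length x +
      birkhoffSum (shiftMap X) φ (n - w.length) ((shiftMap X)^[w.length] x) := by
    rw [← birkhoffSum_add, Nat.add_sub_of_le hw]
  rw [e]
  gcongr
  exact birkhoffSum_le_supBirkhoff hx.2

lemma perSum_univ_le {n : ℕ} (hn : 0 < n) :
    perSum φ n univ ≤ partitionSum X (shiftLanguage X) φ n := by
  have := perSum_wordCylinder_le φ hn (w := ([] : List A)) (by simp)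
  simpa [supBirkhoff, birkhoffSum_zero'] using this.trans (mul_le_of_le_one_left
    (partitionSum_nonneg _ _ _) (by
      rw [Real.exp_le_one_iff]
      apply Real.sSup_nonpos
      rintro _ ⟨x, -, rfl⟩
      simp))

/-- Glue `w`, `u`, `w'`, `u'` into a periodic orbit, where `u` and `u'` run over the words of `D` of
lengths `j - |w| - 2t` and `n - j - |w'| - 2t`. Distinct pairs give distinct periodic points. The
constant collects four losses `V + t * ‖φ‖`, four gaps and two factors `1 / 2`. -/
lemma le_perSum_inter {D : Set (List A)} {t : ℕ} (ht : GluesPer X D t) {V P : ℝ}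
    (hV : ∀ w ∈ D, ∀ x ∈ wordCylinder X w, ∀ y ∈ wordCylinder X w,
      |birkhoffSum (shiftMap X) φ w.length x - birkhoffSum (shiftMap X) φ w.length y| ≤ V)
    (hΛ : ∀ n : ℕ, Real.exp (n * P) / 2 ≤ partitionSum X D φ n)
    {w w' : List A} (hw : w ∈ D) (hw' : w' ∈ D) {j n : ℕ} (hj : w.length + 2 * t ≤ j)
    (hn : j + w'.length + 2 * t ≤ n) (hn0 : 0 < n) :
    Real.exp (-(4 * (V + t * ‖φ‖) + 4 * t * P)) / 4 *
      Real.exp (supBirkhoff X φ w - w.length * P) *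
      Real.exp (supBirkhoff X φ w' - w'.length * P) * Real.exp (n * P) ≤
      perSum φ n (wordCylinder X w ∩ (shiftMap X)^[j] ⁻¹' wordCylinder X w') := by
  classical
  obtain ⟨a, rfl⟩ := Nat.exists_eq_add_of_le hj
  obtain ⟨b, rfl⟩ := Nat.exists_eq_add_of_le hn
  have hglue : ∀ u : List A × List A, ∃ p : X.carrier, u ∈ wordsOf D a ×ˢ wordsOf D b →
      Follows X t [w, u.1, w', u.2] p ∧ (shiftMap X)^[gapLength t [w, u.1, w', u.2]] p = p := by
    intro u
    by_cases hu : u ∈ wordsOf D a ×ˢ wordsOf D b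
    · simp only [Finset.mem_product, mem_wordsOf] at hu
      obtain ⟨p, hp⟩ := ht [w, u.1, w', u.2] (by simp) (by
        simp only [List.mem_cons, List.not_mem_nil, or_false]
        rintro _ (rfl | rfl | rfl | rfl)
        exacts [hw, hu.1.2, hw', hu.2.2])
      exact ⟨p, fun _ => hp⟩
    · obtain ⟨p, -⟩ := ht [w] (by simp) (by simpa using hw)
      exact ⟨p, fun h => absurd h hu⟩
  choose p hp using hglue
  have hlen : ∀ u ∈ wordsOf D a ×ˢ wordsOf D b, gapLength t [w, u.1, w', u.2] =
      w.length + 2 * t + a + w'.length + 2 * t + b := by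
    intro u hu
    simp only [Finset.mem_product, mem_wordsOf] at hu
    simp [hu.1.1, hu.2.1]; ring
  have hmem : ∀ u ∈ wordsOf D a ×ˢ wordsOf D b, p u ∈ wordCylinder X w ∧
      (shiftMap X)^[w.length + t] (p u) ∈ wordCylinder X u.1 ∧
      (shiftMap X)^[w.length + 2 * t + a] (p u) ∈ wordCylinder X w' ∧
      (shiftMap X)^[w.length + 2 * t + a + w'.length + t] (p u) ∈ wordCylinder X u.2 := by
    intro u hu
    obtain ⟨⟨h1, h2, h3, h4, -⟩, -⟩ := hp u hu
    simp only [Finset.mem_product, mem_wordsOf] at hu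
    rw [← Function.iterate_add_apply] at h3 h4
    rw [← Function.iterate_add_apply, hu.1.1] at h4
    rw [hu.1.1] at h3
    refine ⟨h1, h2, ?_, ?_⟩
    · convert h3 using 2; ring_nf
    · convert h4 using 2; ring_nf
  calc _ = Real.exp (supBirkhoff X φ w + supBirkhoff X φ w' - 4 * (V + t * ‖φ‖)) *
        ((Real.exp (a * P) / 2) * (Real.exp (b * P) / 2)) := by
        have : Real.exp (supBirkhoff X φ w + supBirkhoff X φ w' - 4 * (V + t * ‖φ‖)) *
          ((Real.exp (a * P) / 2) * (Real.exp (b * P) / 2)) =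
          Real.exp (supBirkhoff X φ w + supBirkhoff X φ w' - 4 * (V + t * ‖φ‖)) *
          ((Real.exp (a * P)) * (Real.exp (b * P))) / 4 := by ring
        rw [this, ← Real.exp_add, ← Real.exp_add, div_mul_eq_mul_div, div_mul_eq_mul_div,
          div_mul_eq_mul_div, ← Real.exp_add, ← Real.exp_add, ← Real.exp_add]
        congr 2
        push_cast; ring
    _ ≤ Real.exp (supBirkhoff X φ w + supBirkhoff X φ w' - 4 * (V + t * ‖φ‖)) *
        (partitionSum X D φ a * partitionSum X D φ b) := by
        gcongr
        · exact partitionSum_nonneg _ _ _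
        · exact hΛ a
        · exact hΛ b
    _ = ∑ u ∈ wordsOf D a ×ˢ wordsOf D b,
        Real.exp (supBirkhoff X φ w + supBirkhoff X φ w' - 4 * (V + t * ‖φ‖)) *
          (Real.exp (supBirkhoff X φ u.1) * Real.exp (supBirkhoff X φ u.2)) := by
        rw [partitionSum_eq, partitionSum_eq, Finset.sum_mul_sum, ← Finset.sum_product',
          Finset.mul_sum]
    _ ≤ _ := by
        unfold perSum
        refine Finset.sum_le_sum_of_inj p ?_ ?_ ?_ fun _ _ => (Real.exp_pos _).le
        · intro u hu
          refine (mem_filter_perFinset hn0).2 ⟨?_, (hmem u hu).1, (hmem u hu).2.2.1⟩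
          rw [← hlen u hu]
          exact (hp u hu).2
        · intro u hu u' hu' h
          have h1 := hmem u hu
          have h2 := hmem u' hu'
          rw [← h] at h2
          simp only [Finset.mem_product, mem_wordsOf] at hu hu'
          exact Prod.ext (eq_of_mem_wordCylinder h1.2.1 h2.2.1 (hu.1.1.trans hu'.1.1.symm))
            (eq_of_mem_wordCylinder h1.2.2.2 h2.2.2.2 (hu.2.1.trans hu'.2.1.symm))
        · intro u hu
          rw [← Real.exp_add, ← Real.exp_add, Real.exp_le_exp, ← hlen u hu]
          have hu' := hu
          simp only [Finset.mem_product, mem_wordsOf] at hu'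
          have := (hp u hu).1.sum_le (φ := φ) (V := V) (by
            simp only [List.mem_cons, List.not_mem_nil, or_false]
            rintro _ (rfl | rfl | rfl | rfl)
            exacts [hV _ hw, hV _ hu'.1.2, hV _ hw', hV _ hu'.2.2])
          refine le_trans (le_of_eq ?_) this
          simp only [List.map_cons, List.map_nil, List.sum_cons, List.sum_nil]
          ring

variable [MeasurableSpace A] [DiscreteMeasurableSpace A]

instance : BorelSpace X.carrier := Subtype.borelSpace _

lemma measurableSet_wordCylinder (w : List A) : MeasurableSet (wordCylinder X w) :=
  (isClopen_wordCylinder w).isOpen.measurableSet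

lemma measurable_shiftMap (X : Subshift A ℕ) : Measurable (shiftMap X) :=
  (continuous_shiftMap X).measurable

lemma perMeasure_apply {n : ℕ} (hn : 0 < n) {S : Set X.carrier} (hS : MeasurableSet S) :
    perMeasure X φ n S =
      (ENNReal.ofReal (perSum φ n univ))⁻¹ * ENNReal.ofReal (perSum φ n S) := by
  classical
  have hfin := finite_perPoints (X := X) hn
  have e : perFinset X n = hfin.toFinset := by rw [perFinset, dif_pos hfin]
  have tsum_eq : ∀ F : X.carrier → ℝ≥0∞, ∑' x : perPoints X n, F x = ∑ x ∈ perFinset X n, F x := by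
    intro F
    have := Finset.tsum_subtype' hfin.toFinset F
    rw [hfin.coe_toFinset] at this
    rw [this, e]
  rw [perMeasure, Measure.smul_apply, Measure.sum_apply _ hS, smul_eq_mul]
  congr 2
  · rw [tsum_eq fun x => ENNReal.ofReal (Real.exp (birkhoffSum (shiftMap X) φ n x)), perSum,
      ENNReal.ofReal_sum_of_nonneg fun _ _ => (Real.exp_pos _).le]
    simp
  · have h1 : ∀ x : perPoints X n, (ENNReal.ofReal (Real.exp (birkhoffSum (shiftMap X) φ n x.1)) •
        Measure.dirac x.1) S = (fun y => if y ∈ S then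
          ENNReal.ofReal (Real.exp (birkhoffSum (shiftMap X) φ n y)) else 0) x.1 := by
      intro x
      rw [Measure.smul_apply, Measure.dirac_apply' _ hS, smul_eq_mul]
      by_cases hx : x.1 ∈ S <;> simp [hx]
    rw [tsum_congr h1, tsum_eq (fun y => if y ∈ S then
          ENNReal.ofReal (Real.exp (birkhoffSum (shiftMap X) φ n y)) else 0), perSum,
      ENNReal.ofReal_sum_of_nonneg fun _ _ => (Real.exp_pos _).le, Finset.sum_filter]

lemma perMeasure_real_apply {n : ℕ} (hn : 0 < n) {S : Set X.carrier} (hS : MeasurableSet S) :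
    (perMeasure X φ n).real S = perSum φ n S / perSum φ n univ := by
  rw [Measure.real, perMeasure_apply φ hn hS, ENNReal.toReal_mul, ENNReal.toReal_inv,
    ENNReal.toReal_ofReal (perSum_nonneg _ _ _), ENNReal.toReal_ofReal (perSum_nonneg _ _ _)]
  field_simp

lemma isProbabilityMeasure_perMeasure {n : ℕ} (hn : 0 < n) (h : 0 < perSum φ n univ) :
    IsProbabilityMeasure (perMeasure X φ n) := by
  constructor
  rw [perMeasure_apply φ hn MeasurableSet.univ]
  exact ENNReal.inv_mul_cancel (by simpa using h) ENNReal.ofReal_ne_top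

lemma map_perMeasure {n : ℕ} (hn : 0 < n) :
    (perMeasure X φ n).map (shiftMap X) = perMeasure X φ n := by
  ext S hS
  rw [Measure.map_apply (measurable_shiftMap X) hS,
    perMeasure_apply φ hn (measurable_shiftMap X hS), perMeasure_apply φ hn hS,
    perSum_preimage φ hn]

end Periodic

/-! ### Approximation by unions of cylinders -/

section Approximation

variable {A : Type*} [TopologicalSpace A] {X : Subshift A ℕ}

/-- The set of points whose prefix of length `n` belongs to `D`. -/
def prefixSet (X : Subshift A ℕ) (n : ℕ) (D : Set (List A)) : Set X.carrier :=
  {x | wordPrefix n x.1 ∈ D}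

lemma wordPrefix_take {m n : ℕ} (h : m ≤ n) (x : ℕ → A) :
    (wordPrefix n x).take m = wordPrefix m x := by
  obtain ⟨k, rfl⟩ := Nat.exists_eq_add_of_le h
  rw [wordPrefix_add, List.take_left']
  simp

lemma prefixSet_of_le {m n : ℕ} (h : m ≤ n) (D : Set (List A)) :
    prefixSet X m D = prefixSet X n {w | w.take m ∈ D} := by
  ext x
  simp [prefixSet, wordPrefix_take h]

lemma prefixSet_eq_biUnion [Fintype A] (n : ℕ) (D : Set (List A)) :
    prefixSet X n D = ⋃ w ∈ wordsOf D n, wordCylinder X w := by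
  ext x
  simp only [prefixSet, Set.mem_ofPred_eq, mem_iUnion, mem_wordsOf, exists_prop]
  constructor
  · intro h
    exact ⟨_, ⟨by simp, h⟩, mem_wordCylinder_wordPrefix n x⟩
  · rintro ⟨w, ⟨rfl, hw⟩, hx⟩
    rwa [mem_wordCylinder_iff_wordPrefix.1 hx]

variable [Fintype A] [DiscreteTopology A] [MeasurableSpace A] [DiscreteMeasurableSpace A]

lemma measurableSet_prefixSet (n : ℕ) (D : Set (List A)) : MeasurableSet (prefixSet X n D) := by
  rw [prefixSet_eq_biUnion]
  exact Finset.measurableSet_biUnion _ fun w _ => measurableSet_wordCylinder w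

lemma measureReal_prefixSet (μ : Measure X.carrier) [IsFiniteMeasure μ] (n : ℕ)
    (D : Set (List A)) :
    μ.real (prefixSet X n D) = ∑ w ∈ wordsOf D n, μ.real (wordCylinder X w) := by
  rw [prefixSet_eq_biUnion]
  refine measureReal_biUnion_finset ?_ fun w _ => measurableSet_wordCylinder w
  intro u hu v hv huv
  refine Set.disjoint_left.2 fun x hx hx' => huv ?_
  exact prefixFree_wordsOf D n u hu v hv ⟨x, hx, hx'⟩

lemma isSetAlgebra_prefixSet (X : Subshift A ℕ) :
    IsSetAlgebra {S : Set X.carrier | ∃ n D, S = prefixSet X n D} where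
  empty_mem := ⟨0, ∅, by ext; simp [prefixSet]⟩
  compl_mem := by
    rintro _ ⟨n, D, rfl⟩
    exact ⟨n, Dᶜ, rfl⟩
  union_mem := by
    rintro _ _ ⟨m, D, rfl⟩ ⟨n, E, rfl⟩
    refine ⟨max m n, {w | w.take m ∈ D} ∪ {w | w.take n ∈ E}, ?_⟩
    rw [prefixSet_of_le (le_max_left m n), prefixSet_of_le (le_max_right m n)]
    rfl

lemma generateFrom_prefixSet (X : Subshift A ℕ) :
    (inferInstance : MeasurableSpace X.carrier) =
      MeasurableSpace.generateFrom {S : Set X.carrier | ∃ n D, S = prefixSet X n D} := by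
  apply le_antisymm
  · rintro _ ⟨S, hS, rfl⟩
    have : @Measurable _ _ (MeasurableSpace.generateFrom
        {S : Set X.carrier | ∃ n D, S = prefixSet X n D}) _ (Subtype.val : X.carrier → ℕ → A) := by
      refine @measurable_pi_lambda _ _ _ (_) _ _ fun i => ?_
      intro s _
      refine MeasurableSpace.measurableSet_generateFrom ⟨i + 1, {w | ∃ a ∈ s, w[i]? = some a}, ?_⟩
      ext x
      simp [prefixSet, wordPrefix, -List.ofFn_succ]
    exact this hS
  · refine MeasurableSpace.generateFrom_le ?_
    rintro _ ⟨n, D, rfl⟩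
    exact measurableSet_prefixSet n D

/-- Sets of prefixes form a generating algebra and are therefore dense in measure. What `N` letters
decide, any `n ≥ N` letters decide as well. -/
lemma exists_prefixSet_approx (μ : Measure X.carrier) [IsFiniteMeasure μ] {S : Set X.carrier}
    (hS : MeasurableSet S) {ε : ℝ} (hε : 0 < ε) :
    ∃ N, ∀ n ≥ N, ∃ D : Set (List A), μ.real (symmDiff S (prefixSet X n D)) < ε := by
  have hd := Measure.MeasureDense.of_generateFrom_isSetAlgebra_finite (μ := μ)
    (isSetAlgebra_prefixSet X) (generateFrom_prefixSet X)
  obtain ⟨_, ⟨N, D, rfl⟩, h⟩ := hd.approx S hS (measure_ne_top _ _) ε hε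
  refine ⟨N, fun n hn => ⟨{w | w.take N ∈ D}, ?_⟩⟩
  rw [← prefixSet_of_le hn]
  rwa [Measure.real, ← ENNReal.lt_ofReal_iff_toReal_lt (measure_ne_top _ _)]

end Approximation

/-! ### Limits of periodic orbit measures -/

section Limit

variable {A : Type*} [Fintype A] [TopologicalSpace A] [DiscreteTopology A] [MeasurableSpace A]
  [DiscreteMeasurableSpace A] {X : Subshift A ℕ} {φ : C(X.carrier, ℝ)} {Cp G Cs : Set (List A)}

/-- An invariant measure with the upper Gibbs bound on all words, and with a uniform mixing lower
bound on each collection `G(M)`. -/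
structure IsMixingGibbs (X : Subshift A ℕ) (φ : X.carrier → ℝ) (Cp G Cs : Set (List A))
    (μ : Measure X.carrier) : Prop where
  isProb : IsProbabilityMeasure μ
  invariant : MeasurePreserving (shiftMap X) μ μ
  upper : ∃ K : ℝ, 0 < K ∧ ∀ w ∈ shiftLanguage X, μ.real (wordCylinder X w) ≤
    K * Real.exp (supBirkhoff X φ w - w.length * topPressure X φ)
  mixing : ∀ M, ∃ c : ℝ, 0 < c ∧ ∃ N : ℕ, ∀ w ∈ fattened X Cp G Cs M,
    ∀ w' ∈ fattened X Cp G Cs M, ∀ j ≥ w.length + N,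
      c * Real.exp (supBirkhoff X φ w - w.length * topPressure X φ) *
        Real.exp (supBirkhoff X φ w' - w'.length * topPressure X φ) ≤
      μ.real (wordCylinder X w ∩ (shiftMap X)^[j] ⁻¹' wordCylinder X w')

lemma isClopen_preimage_iterate (j : ℕ) (w : List A) :
    IsClopen ((shiftMap X)^[j] ⁻¹' wordCylinder X w) :=
  (isClopen_wordCylinder w).preimage ((continuous_shiftMap X).iterate j)

variable [Nonempty X.carrier]

@[simp] lemma supBirkhoff_nil : supBirkhoff X φ ([] : List A) = 0 := by
  simp [supBirkhoff, birkhoffSum_zero']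

/-- Lower bounds for weighted sums over periodic points. -/
lemma IsGoodDecomposition.perSum_bounds (h : IsGoodDecomposition X φ Cp G Cs) (M : ℕ) :
    ∃ c : ℝ, 0 < c ∧ ∃ N : ℕ, ∀ w ∈ fattened X Cp G Cs M,
    ∀ w' ∈ fattened X Cp G Cs M, ∀ j ≥ w.length + N, ∀ n ≥ j + w'.length + N, 0 < n →
      c * Real.exp (supBirkhoff X φ w - w.length * topPressure X φ) *
        Real.exp (supBirkhoff X φ w' - w'.length * topPressure X φ) *
        Real.exp (n * topPressure X φ) ≤
      perSum φ n (wordCylinder X w ∩ (shiftMap X)^[j] ⁻¹' wordCylinder X w') := by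
  obtain ⟨C₀, hC₀, hC, ε, hε, hεb⟩ := h.partitionSum_bounds
  -- Words outside `G(M₀)` weigh less than half of e^{nP}, so `G(M₀)` carries at least the other
  -- half; `M₀ ≥ M` keeps the given words inside.
  obtain ⟨M₀, hM₀, hMM₀⟩ := ((hε.eventually_lt_const (by norm_num : (0 : ℝ) < 1 / 2)).and
    (eventually_ge_atTop M)).exists
  obtain ⟨hd, hper, hbow, -⟩ := h
  obtain ⟨t, ht⟩ := (hper M₀).gluesPer
  obtain ⟨V, hV⟩ := hbow.fattened (Cp := Cp) (Cs := Cs) M₀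
  refine ⟨Real.exp (-(4 * (V + t * ‖φ‖) + 4 * t * topPressure X φ)) / 4, by positivity, 2 * t,
    fun w hw w' hw' j hj n hn hn0 => ?_⟩
  refine le_perSum_inter φ ht hV (fun n => ?_) (fattened_mono hMM₀ hw) (fattened_mono hMM₀ hw')
    hj hn hn0
  have h1 := exp_topPressure_le φ n
  rw [partitionSum_eq_add_diff (fattened_subset (Cp := Cp) (G := G) (Cs := Cs) M₀) n] at h1
  have h2 := hεb M₀ n
  have h3 : ε M₀ * Real.exp (n * topPressure X φ) ≤ 1 / 2 * Real.exp (n * topPressure X φ) := by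
    gcongr
  linarith

lemma IsGoodDecomposition.perSum_univ (h : IsGoodDecomposition X φ Cp G Cs) :
    ∃ c C : ℝ, 0 < c ∧ 0 < C ∧ ∀ᶠ n : ℕ in atTop, 0 < n ∧
      c * Real.exp (n * topPressure X φ) ≤ perSum φ n univ ∧
      perSum φ n univ ≤ C * Real.exp (n * topPressure X φ) := by
  obtain ⟨C₀, hC₀, hC, -⟩ := h.partitionSum_bounds
  obtain ⟨c, hc, N, hN⟩ := h.perSum_bounds 0
  refine ⟨c, C₀, hc, by linarith, ?_⟩
  filter_upwards [eventually_gt_atTop (2 * N)] with n hn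
  have hnil := h.1.subset_fattened 0 h.1.nil_mem.2.1
  refine ⟨by omega, ?_, (perSum_univ_le φ (by omega)).trans (hC n)⟩
  have := hN [] hnil [] hnil N (by simp) n (by simp; omega) (by omega)
  simpa using this

/-- The bounds concern clopen sets, whose frontier is empty, so they pass to weak* limits. The
filter is arbitrary below `atTop`, because convergence of the whole sequence only comes later, from
uniqueness. -/
theorem IsGoodDecomposition.isMixingGibbs (h : IsGoodDecomposition X φ Cp G Cs)
    {pm : ℕ → ProbabilityMeasure X.carrier}
    (hpm : ∀ᶠ n in atTop, (pm n : Measure X.carrier) = perMeasure X φ n)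
    {U : Filter ℕ} [U.NeBot] (hU : U ≤ atTop) {ν : ProbabilityMeasure X.carrier}
    (hν : Tendsto pm U (𝓝 ν)) : IsMixingGibbs X φ Cp G Cs (ν : Measure X.carrier) := by
  obtain ⟨C₀, hC₀, hC, -⟩ := h.partitionSum_bounds
  obtain ⟨c, C, hc, hC', hcC⟩ := h.perSum_univ
  have hlim : ∀ S : Set X.carrier, IsClopen S →
      Tendsto (fun n => perSum φ n S / perSum φ n univ) U (𝓝 ((ν : Measure X.carrier).real S)) := by
    intro S hS
    have h1 := ProbabilityMeasure.tendsto_measure_of_null_frontier_of_tendsto' hν (E := S)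
      (by simp [hS.frontier_eq])
    have h2 := (ENNReal.tendsto_toReal (measure_ne_top (ν : Measure X.carrier) S)).comp h1
    refine h2.congr' ?_
    filter_upwards [hU hpm, hU hcC] with n hn hn'
    rw [Function.comp, hn, ← perMeasure_real_apply φ hn'.1 hS.isOpen.measurableSet, Measure.real]
  have hfin : ∀ n : ℕ, 0 < n → ∀ S, c * Real.exp (n * topPressure X φ) ≤ perSum φ n univ → ∀ K,
      perSum φ n S ≤ K * Real.exp (n * topPressure X φ) → 0 ≤ K → perSum φ n S / perSum φ n univ ≤ K / c := by
    intro n hn S h1 K h2 hK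
    have hpos : 0 < c * Real.exp (n * topPressure X φ) := by positivity
    calc perSum φ n S / perSum φ n univ ≤ (K * Real.exp (n * topPressure X φ)) / (c * Real.exp (n * topPressure X φ)) := by
          gcongr
      _ = K / c := by field_simp
  refine ⟨inferInstance, ⟨measurable_shiftMap X, ?_⟩, ⟨C₀ / c, by positivity, fun w hw => ?_⟩,
    fun M => ?_⟩
  · have h1 := ProbabilityMeasure.tendsto_map_of_tendsto_of_continuous pm ν hν
      (continuous_shiftMap X)
    have h2 : Tendsto pm U (𝓝 (ν.map (continuous_shiftMap X).measurable.aemeasurable)) := by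
      refine h1.congr' ?_
      filter_upwards [hU hpm, hU hcC] with n hn hn'
      apply Subtype.ext
      change Measure.map (shiftMap X) (pm n : Measure X.carrier) = pm n
      rw [hn, map_perMeasure φ hn'.1]
    have := congrArg (fun m : ProbabilityMeasure X.carrier => (m : Measure X.carrier))
      (tendsto_nhds_unique h2 hν)
    exact this
  · refine le_of_tendsto (hlim _ (isClopen_wordCylinder w)) ?_
    filter_upwards [hU hcC, hU (eventually_ge_atTop w.length)] with n hn hnw
    rw [div_mul_eq_mul_div]
    refine hfin n hn.1 _ hn.2.1 _ ?_ (by positivity)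
    refine (perSum_wordCylinder_le φ hn.1 hnw).trans ?_
    refine (mul_le_mul_of_nonneg_left (hC _) (Real.exp_pos _).le).trans (le_of_eq ?_)
    rw [mul_assoc, ← Real.exp_add, mul_left_comm, ← Real.exp_add, Nat.cast_sub hnw]
    congr 2; ring
  · obtain ⟨c', hc', N, hN⟩ := h.perSum_bounds M
    refine ⟨c' / C, by positivity, N, fun w hw w' hw' j hj => ?_⟩
    refine ge_of_tendsto (hlim _ ((isClopen_wordCylinder w).inter
      (isClopen_preimage_iterate j w'))) ?_
    filter_upwards [hU hcC, hU (eventually_ge_atTop (j + w'.length + N))] with n hn hnw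
    have h1 := hN w hw w' hw' j hj n hnw hn.1
    have hpos : 0 < perSum φ n univ := lt_of_lt_of_le (by positivity) hn.2.1
    rw [le_div_iff₀ hpos]
    refine le_trans (mul_le_mul_of_nonneg_left hn.2.2 (by positivity)) (le_trans (le_of_eq ?_) h1)
    generalize Real.exp (n * topPressure X φ) = E
    field_simp

end Limit

/-! ### Entropy of finite-valued maps -/

section FiniteEntropy

variable {Ω : Type*} [MeasurableSpace Ω] {ι κ : Type*} [Fintype ι] [MeasurableSpace ι]
  [MeasurableSingletonClass ι] [Fintype κ] [MeasurableSpace κ] [MeasurableSingletonClass κ]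
  {μ : Measure Ω} [IsProbabilityMeasure μ]

/-- Shannon entropy of a finite-valued map. -/
def shannonEntropy (μ : Measure Ω) (f : Ω → ι) : ℝ :=
  ∑ c, Real.negMulLog (μ.real (f ⁻¹' {c}))

lemma integrable_comp_finite {f : Ω → ι} (hf : Measurable f) (F : ι → ℝ) :
    Integrable (fun x => F (f x)) μ := by
  have : IsFiniteMeasure (μ.map f) := by infer_instance
  exact (Integrable.of_finite (μ := μ.map f) (f := F)).comp_measurable hf

lemma integral_comp_finite {f : Ω → ι} (hf : Measurable f) (F : ι → ℝ) :
    ∫ x, F (f x) ∂μ = ∑ c, μ.real (f ⁻¹' {c}) * F c := by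
  rw [← integral_map (f := F) hf.aemeasurable (by
    exact (Measurable.of_discrete (f := F)).aestronglyMeasurable), integral_fintype Integrable.of_finite]
  refine Finset.sum_congr rfl fun c _ => ?_
  rw [Measure.real, Measure.map_apply hf (measurableSet_singleton c)]
  rfl

lemma ae_fiber_pos (f : Ω → ι) : ∀ᵐ x ∂μ, 0 < μ.real (f ⁻¹' {f x}) := by
  have h : ∀ c : ι, ∀ᵐ x ∂μ, f x = c → 0 < μ.real (f ⁻¹' {c}) := by
    intro c
    rcases eq_or_lt_of_le (measureReal_nonneg (μ := μ) (s := f ⁻¹' {c})) with h0 | h0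
    · rw [eq_comm, measureReal_eq_zero_iff] at h0
      have : ∀ᵐ x ∂μ, x ∉ f ⁻¹' {c} := measure_eq_zero_iff_ae_notMem.1 h0
      filter_upwards [this] with x hx hxc
      exact absurd hxc hx
    · exact Eventually.of_forall fun _ _ => h0
  filter_upwards [ae_all_iff.2 h] with x hx using hx _ rfl

lemma shannonEntropy_eq_integral {f : Ω → ι} (hf : Measurable f) :
    shannonEntropy μ f = ∫ x, -Real.log (μ.real (f ⁻¹' {f x})) ∂μ := by
  rw [integral_comp_finite hf fun c => -Real.log (μ.real (f ⁻¹' {c}))]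
  exact Finset.sum_congr rfl fun c _ => by rw [Real.negMulLog]; ring

/-- Gibbs' inequality for a subprobability `q`, from `log t ≤ t - 1`. The main upper bounds for
entropy below consist in a good choice of `q`. -/
lemma shannonEntropy_le_integral {f : Ω → ι} (hf : Measurable f) {q : ι → ℝ} (hq : ∀ c, 0 ≤ q c)
    (hsum : ∑ c, q c ≤ 1) (hpos : ∀ᵐ x ∂μ, 0 < q (f x)) :
    shannonEntropy μ f ≤ ∫ x, -Real.log (q (f x)) ∂μ := by
  rw [shannonEntropy_eq_integral hf, ← sub_nonneg,
    ← integral_sub (integrable_comp_finite hf fun c => -Real.log (q c))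
      (integrable_comp_finite hf fun c => -Real.log (μ.real (f ⁻¹' {c})))]
  have h1 : ∫ x, (1 - q (f x) / μ.real (f ⁻¹' {f x})) ∂μ ≤
      ∫ x, (-Real.log (q (f x)) - -Real.log (μ.real (f ⁻¹' {f x}))) ∂μ := by
    refine integral_mono_ae (integrable_comp_finite hf fun c => 1 - q c / μ.real (f ⁻¹' {c}))
      (integrable_comp_finite hf fun c => -Real.log (q c) - -Real.log (μ.real (f ⁻¹' {c}))) ?_
    filter_upwards [hpos, ae_fiber_pos f] with x h1 h2
    have := Real.log_le_sub_one_of_pos (div_pos h1 h2)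
    rw [Real.log_div h1.ne' h2.ne'] at this
    linarith
  refine le_trans ?_ h1
  rw [integral_comp_finite hf fun c => 1 - q c / μ.real (f ⁻¹' {c})]
  have h2 : ∀ c, μ.real (f ⁻¹' {c}) - q c ≤ μ.real (f ⁻¹' {c}) * (1 - q c / μ.real (f ⁻¹' {c})) := by
    intro c
    rcases eq_or_lt_of_le (measureReal_nonneg (μ := μ) (s := f ⁻¹' {c})) with h0 | h0
    · rw [← h0]; simpa using hq c
    · apply le_of_eq; field_simp
  refine le_trans ?_ (Finset.sum_le_sum fun c _ => h2 c)
  rw [Finset.sum_sub_distrib]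
  have h3 := integral_comp_finite (μ := μ) hf fun _ => (1 : ℝ)
  simp only [integral_const, probReal_univ, smul_eq_mul, mul_one] at h3
  linarith

lemma shannonEntropy_comp_le {f : Ω → ι} (hf : Measurable f) (g : ι → κ) :
    shannonEntropy μ (fun x => g (f x)) ≤ shannonEntropy μ f := by
  have hg : Measurable g := Measurable.of_discrete
  rw [shannonEntropy_eq_integral hf, shannonEntropy_eq_integral (f := fun x => g (f x)) (hg.comp hf)]
  refine integral_mono_ae (integrable_comp_finite hf
      fun c => -Real.log (μ.real ((fun x => g (f x)) ⁻¹' {g c})))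
    (integrable_comp_finite hf fun c => -Real.log (μ.real (f ⁻¹' {c}))) ?_
  filter_upwards [ae_fiber_pos f] with x h2
  apply neg_le_neg
  apply Real.log_le_log h2
  apply measureReal_mono _ (measure_ne_top _ _)
  intro y hy
  exact congrArg g hy

/-- The comparison distribution is the product of the two marginals. -/
lemma shannonEntropy_prod_le {f : Ω → ι} (hf : Measurable f) {g : Ω → κ} (hg : Measurable g) :
    shannonEntropy μ (fun x => (f x, g x)) ≤ shannonEntropy μ f + shannonEntropy μ g := by
  have h := shannonEntropy_le_integral (μ := μ) (hf.prodMk hg)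
    (q := fun c => μ.real (f ⁻¹' {c.1}) * μ.real (g ⁻¹' {c.2}))
    (fun c => mul_nonneg measureReal_nonneg measureReal_nonneg) (by
      simp only [Fintype.sum_prod_type]
      rw [← Finset.sum_mul_sum]
      have h3 := integral_comp_finite (μ := μ) hf fun _ => (1 : ℝ)
      have h4 := integral_comp_finite (μ := μ) hg fun _ => (1 : ℝ)
      simp only [integral_const, probReal_univ, smul_eq_mul, mul_one] at h3 h4
      rw [← h3, ← h4, mul_one]) (by
      filter_upwards [ae_fiber_pos f, ae_fiber_pos g] with x h1 h2 using mul_pos h1 h2)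
  refine h.trans (le_of_eq ?_)
  rw [shannonEntropy_eq_integral hf, shannonEntropy_eq_integral hg,
    ← integral_add (integrable_comp_finite hf fun c => -Real.log (μ.real (f ⁻¹' {c})))
      (integrable_comp_finite hg fun c => -Real.log (μ.real (g ⁻¹' {c})))]
  refine integral_congr_ae ?_
  filter_upwards [ae_fiber_pos f, ae_fiber_pos g] with x h1 h2
  rw [Real.log_mul h1.ne' h2.ne']; ring

lemma shannonEntropy_comp_measurePreserving {T : Ω → Ω} (hT : MeasurePreserving T μ μ) {f : Ω → ι}
    (hf : Measurable f) : shannonEntropy μ (fun x => f (T x)) = shannonEntropy μ f := by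
  unfold shannonEntropy
  refine Finset.sum_congr rfl fun c _ => ?_
  congr 1
  exact hT.measureReal_preimage (hf (measurableSet_singleton c)).nullMeasurableSet

lemma shannonEntropy_nonneg (f : Ω → ι) : 0 ≤ shannonEntropy μ f :=
  Finset.sum_nonneg fun _ _ => Real.negMulLog_nonneg measureReal_nonneg measureReal_le_one

/-- The itinerary of length `n` with respect to the labelling `ξ`. -/
def itinerary (T : Ω → Ω) (ξ : Ω → ι) (n : ℕ) (x : Ω) : Fin n → ι := fun i => ξ (T^[i] x)

lemma measurable_itinerary {T : Ω → Ω} (hT : Measurable T) {ξ : Ω → ι} (hξ : Measurable ξ) (n : ℕ) :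
    Measurable (itinerary T ξ n) :=
  measurable_pi_lambda _ fun i => hξ.comp (hT.iterate i)

lemma joinEntropy_eq (T : Ω → Ω) {k : ℕ} (ξ : Ω → Fin k) (n : ℕ) :
    joinEntropy T μ ξ n = shannonEntropy μ (itinerary T ξ n) := by
  unfold joinEntropy shannonEntropy
  refine Finset.sum_congr rfl fun c _ => ?_
  congr 2
  ext x
  simp [itinerary, funext_iff]

lemma shannonEntropy_itinerary_add_le {T : Ω → Ω} (hT : MeasurePreserving T μ μ) {ξ : Ω → ι}
    (hξ : Measurable ξ) (m n : ℕ) :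
    shannonEntropy μ (itinerary T ξ (m + n)) ≤
      shannonEntropy μ (itinerary T ξ m) + shannonEntropy μ (itinerary T ξ n) := by
  have hm := measurable_itinerary hT.measurable hξ m
  have hn := measurable_itinerary hT.measurable hξ n
  have hn' : Measurable fun x => itinerary T ξ n (T^[m] x) := hn.comp (hT.measurable.iterate m)
  have e : itinerary T ξ (m + n) = fun x => (fun p : (Fin m → ι) × (Fin n → ι) =>
      Fin.append p.1 p.2) (itinerary T ξ m x, itinerary T ξ n (T^[m] x)) := by
    funext x i
    refine Fin.addCases (fun i => ?_) (fun i => ?_) i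
    · simp [itinerary]
    · simp only [itinerary, Fin.append_right, Fin.val_natAdd]
      rw [← Function.iterate_add_apply, add_comm]
  have h1 := shannonEntropy_comp_le (μ := μ) (hm.prodMk hn')
    (fun p : (Fin m → ι) × (Fin n → ι) => Fin.append p.1 p.2)
  have h2 := shannonEntropy_prod_le (μ := μ) hm hn'
  have h3 := shannonEntropy_comp_measurePreserving (hT.iterate m) hn
  rw [e]
  linarith

lemma subadditive_itinerary {T : Ω → Ω} (hT : MeasurePreserving T μ μ) {ξ : Ω → ι}
    (hξ : Measurable ξ) : Subadditive fun n => shannonEntropy μ (itinerary T ξ n) :=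
  shannonEntropy_itinerary_add_le hT hξ

lemma bddBelow_itinerary (T : Ω → Ω) (ξ : Ω → ι) :
    BddBelow (range fun n : ℕ => shannonEntropy μ (itinerary T ξ n) / n) := by
  refine ⟨0, ?_⟩
  rintro _ ⟨n, rfl⟩
  exact div_nonneg (shannonEntropy_nonneg _) (Nat.cast_nonneg _)

/-- If a labelling is mostly determined by a finite piece of the itinerary of another one, then
its entropy is not much larger. -/
lemma shannonEntropy_itinerary_le_of_approx {T : Ω → Ω} (hT : MeasurePreserving T μ μ)
    {ξ : Ω → ι} (hξ : Measurable ξ) {α : Ω → κ} (hα : Measurable α) {N : ℕ}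
    (η : (Fin N → κ) → ι) {ε : ℝ} (hε : 0 < ε) (hε1 : ε < 1) (n : ℕ) :
    shannonEntropy μ (itinerary T ξ n) ≤ shannonEntropy μ (itinerary T α (n + N)) +
      n * (-Real.log (1 - ε) +
        μ.real {x | ξ x ≠ η (itinerary T α N x)} * Real.log (Fintype.card ι / ε)) := by
  classical
  obtain ⟨x₀⟩ := μ.nonempty_of_neZero
  have : Nonempty ι := ⟨ξ x₀⟩
  set k : ℝ := (Fintype.card ι : ℝ)
  have hk : 1 ≤ k := by
    have : 1 ≤ Fintype.card ι := Fintype.card_pos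
    change (1 : ℝ) ≤ (Fintype.card ι : ℝ)
    exact_mod_cast this
  -- A noisy guess: for the prediction `b`, the label `b` gets weight `1 - ε` and every other label
  -- `ε / k`. This keeps the cross entropy finite where the prediction fails and takes the place of
  -- conditional entropy.
  set r : ι → ι → ℝ := fun a b => if a = b then 1 - ε else ε / k
  have hr0 : ∀ a b, 0 < r a b := by
    intro a b
    simp only [r]
    split_ifs
    · linarith
    · positivity
  have hr1 : ∀ b, ∑ a, r a b ≤ 1 := by
    intro b
    have h1 : ∀ a, r a b ≤ (if a = b then 1 - ε else 0) + ε / k := by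
      intro a
      have : 0 ≤ ε / k := by positivity
      simp only [r]
      split_ifs <;> linarith
    refine (Finset.sum_le_sum fun a _ => h1 a).trans (le_of_eq ?_)
    rw [Finset.sum_add_distrib]
    simp only [Finset.sum_ite_eq', Finset.mem_univ, if_true, Finset.sum_const, Finset.card_univ,
      nsmul_eq_mul]
    change 1 - ε + k * (ε / k) = 1
    field_simp
    ring
  set sub : (Fin (n + N) → κ) → Fin n → Fin N → κ := fun w i l => w ⟨i + l, by omega⟩
  have hmξ := measurable_itinerary hT.measurable hξ n
  have hmα := measurable_itinerary hT.measurable hα (n + N)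
  have hmα' := measurable_itinerary hT.measurable hα N
  have hsub : ∀ x (i : Fin n), sub (itinerary T α (n + N) x) i = itinerary T α N (T^[i] x) := by
    intro x i
    funext l
    simp only [sub, itinerary]
    rw [← Function.iterate_add_apply, add_comm]
  -- The law of the itinerary of `α` times one noisy guess for each time. The last windows of length
  -- `N` reach beyond `n`, hence the itinerary of length `n + N`.
  set q : (Fin n → ι) × (Fin (n + N) → κ) → ℝ := fun p =>
    μ.real (itinerary T α (n + N) ⁻¹' {p.2}) * ∏ i, r (p.1 i) (η (sub p.2 i))
  have h1 : shannonEntropy μ (itinerary T ξ n) ≤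
      ∫ x, -Real.log (q (itinerary T ξ n x, itinerary T α (n + N) x)) ∂μ := by
    refine (shannonEntropy_comp_le (hmξ.prodMk hmα) Prod.fst).trans ?_
    refine shannonEntropy_le_integral (hmξ.prodMk hmα) (fun c => ?_) ?_ ?_
    · exact mul_nonneg measureReal_nonneg (Finset.prod_nonneg fun i _ => (hr0 _ _).le)
    · rw [Fintype.sum_prod_type_right]
      have h3 := integral_comp_finite (μ := μ) hmα fun _ => (1 : ℝ)
      simp only [integral_const, probReal_univ, smul_eq_mul, mul_one] at h3
      rw [h3]
      refine Finset.sum_le_sum fun w _ => ?_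
      simp only [q]
      rw [← Finset.mul_sum]
      refine mul_le_of_le_one_right measureReal_nonneg ?_
      have := Finset.prod_univ_sum (fun _ : Fin n => (Finset.univ : Finset ι))
        (fun i a => r a (η (sub w i)))
      rw [Fintype.piFinset_univ] at this
      rw [← this]
      exact Finset.prod_le_one (fun i _ => Finset.sum_nonneg fun a _ => (hr0 _ _).le)
        fun i _ => hr1 _
    · filter_upwards [ae_fiber_pos (itinerary T α (n + N))] with x hx
      exact mul_pos hx (Finset.prod_pos fun i _ => hr0 _ _)
  refine h1.trans ?_
  have hmpair : Measurable fun x => (ξ x, itinerary T α N x) := hξ.prodMk hmα'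
  have h2 : ∀ᵐ x ∂μ, -Real.log (q (itinerary T ξ n x, itinerary T α (n + N) x)) =
      -Real.log (μ.real (itinerary T α (n + N) ⁻¹' {itinerary T α (n + N) x})) +
        ∑ i : Fin n, -Real.log (r (ξ (T^[i] x)) (η (itinerary T α N (T^[i] x)))) := by
    filter_upwards [ae_fiber_pos (itinerary T α (n + N))] with x hx
    simp only [q]
    rw [Real.log_mul hx.ne' (Finset.prod_pos fun i _ => hr0 _ _).ne',
      Real.log_prod fun i _ => (hr0 _ _).ne', Finset.sum_neg_distrib, neg_add]
    congr 2
    refine Finset.sum_congr rfl fun i _ => ?_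
    rw [hsub]; rfl
  have hint : ∀ i : ℕ, Integrable
      (fun x => -Real.log (r (ξ (T^[i] x)) (η (itinerary T α N (T^[i] x))))) μ := fun i =>
    integrable_comp_finite (hmpair.comp (hT.measurable.iterate i))
      fun p => -Real.log (r p.1 (η p.2))
  rw [integral_congr_ae h2, integral_add
    (integrable_comp_finite hmα fun c => -Real.log (μ.real (itinerary T α (n + N) ⁻¹' {c})))
    (integrable_finsetSum Finset.univ fun (i : Fin n) _ => hint i), ← shannonEntropy_eq_integral hmα,
    integral_finsetSum Finset.univ fun (i : Fin n) _ => hint i]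
  gcongr
  have h3 : ∀ i : ℕ, ∫ x, -Real.log (r (ξ (T^[i] x)) (η (itinerary T α N (T^[i] x)))) ∂μ ≤
      -Real.log (1 - ε) + μ.real {x | ξ x ≠ η (itinerary T α N x)} * Real.log (k / ε) := by
    intro i
    have hη : Measurable η := Measurable.of_discrete
    have e1 : ∫ x, -Real.log (r (ξ (T^[i] x)) (η (itinerary T α N (T^[i] x)))) ∂μ =
        ∫ x, -Real.log (r (ξ x) (η (itinerary T α N x))) ∂μ := by
      have hc : Measurable fun x => (ξ (T^[i] x), itinerary T α N (T^[i] x)) :=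
        hmpair.comp (hT.measurable.iterate i)
      rw [integral_comp_finite hc
        fun p => -Real.log (r p.1 (η p.2)), integral_comp_finite hmpair
        fun p => -Real.log (r p.1 (η p.2))]
      refine Finset.sum_congr rfl fun c _ => ?_
      congr 1
      exact (hT.iterate i).measureReal_preimage
        (hmpair (measurableSet_singleton c)).nullMeasurableSet
    rw [e1]
    have hms : MeasurableSet {x | ξ x ≠ η (itinerary T α N x)} :=
      (measurableSet_eq_fun hξ (hη.comp hmα')).compl
    have e2 : ∫ x, (-Real.log (1 - ε) + {x | ξ x ≠ η (itinerary T α N x)}.indicator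
        (fun _ => Real.log (k / ε)) x) ∂μ =
        -Real.log (1 - ε) + μ.real {x | ξ x ≠ η (itinerary T α N x)} * Real.log (k / ε) := by
      rw [integral_add (integrable_const _) ((integrable_const _).indicator hms),
        integral_indicator_const _ hms]
      simp
    rw [← e2]
    refine integral_mono (integrable_comp_finite hmpair fun p => -Real.log (r p.1 (η p.2)))
      ((integrable_const _).add ((integrable_const _).indicator hms)) fun x => ?_
    simp only [r, indicator]
    by_cases hx : ξ x = η (itinerary T α N x)
    · simp [hx]
    · have h0 : 0 ≤ -Real.log (1 - ε) :=
        neg_nonneg.2 (Real.log_nonpos (by linarith) (by linarith))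
      have h4 : -Real.log (ε / k) = Real.log (k / ε) := by
        rw [← Real.log_inv, inv_div]
      simp only [hx, if_false, h4, Set.mem_ofPred_eq, ne_eq, not_false_eq_true, if_true]
      linarith
  refine (Finset.sum_le_sum fun (i : Fin n) _ => h3 i).trans (le_of_eq ?_)
  rw [Finset.sum_const, Finset.card_univ, Fintype.card_fin, nsmul_eq_mul]

end FiniteEntropy

/-! ### Entropy under factor maps -/

section Factor

variable {Ω Ω' : Type*} [MeasurableSpace Ω] [MeasurableSpace Ω'] {μ : Measure Ω}

/-- Entropy does not increase under factor maps. -/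
lemma measureEntropy_map_le {T : Ω → Ω} {T' : Ω' → Ω'} (hT : MeasurePreserving T μ μ)
    (hT' : Measurable T') {F : Ω → Ω'} (hF : Measurable F)
    (hcomm : ∀ᵐ x ∂μ, F (T x) = T' (F x)) :
    measureEntropy T' (μ.map F) ≤ measureEntropy T μ := by
  have hcomm' : ∀ᵐ x ∂μ, ∀ i : ℕ, F (T^[i] x) = T'^[i] (F x) := by
    rw [ae_all_iff]
    intro i
    induction i with
    | zero => simp
    | succ i ih =>
      filter_upwards [ih, (hT.iterate i).quasiMeasurePreserving.ae hcomm] with x h1 h2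
      rw [Function.iterate_succ_apply', Function.iterate_succ_apply', h2, h1]
  refine iSup_le fun k => iSup_le fun ξ => iSup_le fun hξ => ?_
  refine le_trans (le_of_eq ?_) (le_iSup_of_le k (le_iSup_of_le (fun x => ξ (F x))
    (le_iSup_of_le (hξ.comp hF) le_rfl)))
  congr 1
  funext n
  congr 2
  unfold joinEntropy
  refine Finset.sum_congr rfl fun c _ => ?_
  congr 1
  have hm : MeasurableSet {y | ∀ i : Fin n, ξ (T'^[i] y) = c i} := by
    rw [ofPred_forall]
    exact MeasurableSet.iInter fun i =>
      (hξ.comp (hT'.iterate i)) (measurableSet_singleton (c i))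
  rw [Measure.real, Measure.real, Measure.map_apply hF hm]
  congr 1
  refine measure_congr ?_
  filter_upwards [hcomm'] with x hx
  apply propext
  change (∀ i : Fin n, ξ (T'^[i] (F x)) = c i) ↔ ∀ i : Fin n, ξ (F (T^[i] x)) = c i
  simp only [hx]

end Factor

/-! ### Entropy of shift spaces -/

section ShiftEntropy

variable {A : Type*} [Fintype A] [TopologicalSpace A] [DiscreteTopology A] [MeasurableSpace A]
  [DiscreteMeasurableSpace A] {X : Subshift A ℕ}

/-- The entropy of the partition of `X` into cylinders of length `n`. -/
def cylinderEntropy (μ : Measure X.carrier) (n : ℕ) : ℝ :=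
  shannonEntropy μ (itinerary (shiftMap X) (fun x : X.carrier => x.1 0) n)

lemma measurable_firstLetter (X : Subshift A ℕ) : Measurable fun x : X.carrier => x.1 0 :=
  (measurable_pi_apply 0).comp measurable_subtype_coe

lemma ofFn_itinerary (n : ℕ) (x : X.carrier) :
    List.ofFn (itinerary (shiftMap X) (fun x : X.carrier => x.1 0) n x) = wordPrefix n x.1 := by
  rw [wordPrefix, List.ofFn_inj]
  funext i
  simp [itinerary]

lemma itinerary_preimage (n : ℕ) (w : Fin n → A) :
    itinerary (shiftMap X) (fun x : X.carrier => x.1 0) n ⁻¹' {w} =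
      wordCylinder X (List.ofFn w) := by
  ext x
  rw [mem_wordCylinder_iff_wordPrefix, List.length_ofFn, ← ofFn_itinerary, List.ofFn_inj]
  rfl

/-- The level sets of `ξ` are approximated by sets of prefixes at one common level. `η` picks a
label whose set contains the prefix, or a default label if there is none; every error lies in one of
the symmetric differences. -/
lemma exists_cylinder_approx {μ : Measure X.carrier} [IsProbabilityMeasure μ] {k : ℕ}
    {ξ : X.carrier → Fin k} (hξ : Measurable ξ) {δ : ℝ} (hδ : 0 < δ) :
    ∃ (N : ℕ) (η : (Fin N → A) → Fin k), μ.real {x | ξ x ≠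
      η (itinerary (shiftMap X) (fun x : X.carrier => x.1 0) N x)} < δ := by
  classical
  obtain ⟨x₀⟩ := μ.nonempty_of_neZero
  have hk : 0 < k := (ξ x₀).pos
  have h := fun j : Fin k => exists_prefixSet_approx μ (hξ (measurableSet_singleton j))
    (ε := δ / k) (by positivity)
  choose N hN using h
  set n := Finset.univ.sup N
  have h2 := fun j : Fin k => hN j n (Finset.le_sup (f := N) (Finset.mem_univ j))
  choose D hD using h2
  refine ⟨n, fun w => if h : ∃ j, List.ofFn w ∈ D j then h.choose else ξ x₀, ?_⟩
  have hsub : {x | ξ x ≠ (fun w : Fin n → A => if h : ∃ j, List.ofFn w ∈ D j then h.choose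
      else ξ x₀) (itinerary (shiftMap X) (fun x : X.carrier => x.1 0) n x)} ⊆
      ⋃ j : Fin k, symmDiff (ξ ⁻¹' {j}) (prefixSet X n (D j)) := by
    intro x hx
    simp only [ofFn_itinerary, Set.mem_ofPred_eq] at hx
    rw [mem_iUnion]
    by_cases hex : ∃ j, wordPrefix n x.1 ∈ D j
    · rw [dif_pos hex] at hx
      refine ⟨hex.choose, Or.inr ⟨hex.choose_spec, hx⟩⟩
    · exact ⟨ξ x, Or.inl ⟨rfl, fun h => hex ⟨_, h⟩⟩⟩
  refine (measureReal_mono hsub (measure_ne_top _ _)).trans_lt ?_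
  refine (measureReal_iUnion_fintype_le _).trans_lt ?_
  have : Nonempty (Fin k) := ⟨ξ x₀⟩
  calc ∑ j, μ.real (symmDiff (ξ ⁻¹' {j}) (prefixSet X n (D j))) < ∑ _j : Fin k, δ / k :=
        Finset.sum_lt_sum_of_nonempty Finset.univ_nonempty fun j _ => hD j
    _ = δ := by
        rw [Finset.sum_const, Finset.card_univ, Fintype.card_fin, nsmul_eq_mul]
        field_simp

/-- The Kolmogorov–Sinai theorem for shift spaces: cylinders generate. -/
theorem exists_measureEntropy_eq {μ : Measure X.carrier} (hμ : IsInvariantProb (shiftMap X) μ) :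
    ∃ h : ℝ, measureEntropy (shiftMap X) μ = h ∧
      Tendsto (fun n : ℕ => cylinderEntropy μ n / n) atTop (𝓝 h) ∧
      ∀ n : ℕ, n * h ≤ cylinderEntropy μ n := by
  obtain ⟨hprob, hinv⟩ := hμ
  set T := shiftMap X
  set α : X.carrier → A := fun x => x.1 0
  have hα : Measurable α := measurable_firstLetter X
  have hsub := subadditive_itinerary hinv hα
  have hbdd := bddBelow_itinerary (μ := μ) T α
  have hlim := hsub.tendsto_lim hbdd
  refine ⟨hsub.lim, ?_, hlim, fun n => ?_⟩
  swap
  · rcases Nat.eq_zero_or_pos n with rfl | hn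
    · rw [Nat.cast_zero, zero_mul]; exact shannonEntropy_nonneg _
    · have := hsub.lim_le_div hbdd hn.ne'
      rw [le_div_iff₀ (by exact_mod_cast hn), mul_comm] at this
      exact this
  apply le_antisymm
  · refine iSup_le fun k => iSup_le fun ξ => iSup_le fun hξ => ?_
    obtain ⟨x₀⟩ := μ.nonempty_of_neZero
    have hk : (1 : ℝ) ≤ k := by exact_mod_cast (ξ x₀).pos
    refine EReal.le_of_forall_lt_iff_le.1 fun z hz => ?_
    rw [EReal.coe_lt_coe_iff] at hz
    -- One `δ` for `-log (1 - ε)`, one for the wrong predictions, one for the convergence of the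
    -- cylinder entropy; the fourth is slack.
    set δ := (z - hsub.lim) / 4
    have hδ : 0 < δ := by simp only [δ]; linarith
    set ε := 1 - Real.exp (-δ)
    have hε : 0 < ε := by simp only [ε]; linarith [Real.exp_lt_exp.2 (neg_lt_zero.2 hδ), Real.exp_zero]
    have hε1 : ε < 1 := by simp only [ε]; linarith [Real.exp_pos (-δ)]
    have hlogε : -Real.log (1 - ε) = δ := by simp [ε]
    have hlogk : 0 < Real.log (k / ε) := by
      apply Real.log_pos
      rw [one_lt_div hε]; linarith
    obtain ⟨N, η, hη⟩ := exists_cylinder_approx (μ := μ) hξ (δ := δ / Real.log (k / ε))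
      (by positivity)
    have hbound : ∀ n : ℕ, joinEntropy T μ ξ n ≤
        shannonEntropy μ (itinerary T α (n + N)) + n * (2 * δ) := by
      intro n
      rw [joinEntropy_eq]
      refine (shannonEntropy_itinerary_le_of_approx hinv hξ hα η hε hε1 n).trans ?_
      gcongr
      rw [hlogε, Fintype.card_fin]
      rw [lt_div_iff₀ hlogk] at hη
      linarith
    have hlim2 : Tendsto (fun n : ℕ => shannonEntropy μ (itinerary T α (n + N)) / n) atTop
        (𝓝 hsub.lim) := by
      have h1 := hlim.comp (tendsto_add_atTop_nat N)
      have h2 : Tendsto (fun n : ℕ => ((n : ℝ) + N) / n) atTop (𝓝 1) := by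
        have h3 : Tendsto (fun n : ℕ => 1 + (N : ℝ) / n) atTop (𝓝 (1 + 0)) :=
          tendsto_const_nhds.add (tendsto_const_div_atTop_nhds_zero_nat _)
        rw [add_zero] at h3
        refine h3.congr' ?_
        filter_upwards [eventually_gt_atTop 0] with n hn
        have : (n : ℝ) ≠ 0 := by positivity
        field_simp
      have h3 := h1.mul h2
      rw [mul_one] at h3
      refine h3.congr' ?_
      filter_upwards [eventually_gt_atTop 0] with n hn
      have : (n : ℝ) ≠ 0 := by positivity
      have : (n : ℝ) + N ≠ 0 := by positivity
      simp only [Function.comp, Nat.cast_add]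
      field_simp
    refine limsup_le_of_le ?_ ?_
    · isBoundedDefault
    filter_upwards [hlim2.eventually_lt_const (lt_add_of_pos_right _ hδ),
      eventually_gt_atTop 0] with n hn hn0
    rw [EReal.coe_le_coe_iff]
    have hn0' : (0 : ℝ) < n := by exact_mod_cast hn0
    rw [div_lt_iff₀ hn0'] at hn
    rw [div_le_iff₀ hn0']
    have := hbound n
    have hz' : z = hsub.lim + 4 * δ := by simp only [δ]; ring
    rw [hz']
    nlinarith
  -- Conversely, the partition by the first letter, with labels renamed in `Fin`, already attains
  -- the limit.
  · set e := Fintype.equivFin A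
    have he : Measurable e := Measurable.of_discrete
    have heα : Measurable fun x => e (α x) := he.comp hα
    refine le_trans ?_ (le_iSup_of_le (Fintype.card A) (le_iSup_of_le (fun x => e (α x))
      (le_iSup_of_le (he.comp hα) le_rfl)))
    have heq : ∀ n, joinEntropy T μ (fun x => e (α x)) n = shannonEntropy μ (itinerary T α n) := by
      intro n
      rw [joinEntropy_eq]
      apply le_antisymm
      · exact shannonEntropy_comp_le (measurable_itinerary hinv.measurable hα n)
          (fun w : Fin n → A => fun i => e (w i))
      · have := shannonEntropy_comp_le (μ := μ)
          (measurable_itinerary hinv.measurable heα n)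
          (fun w : Fin n → Fin (Fintype.card A) => fun i => e.symm (w i))
        refine le_trans (le_of_eq ?_) this
        congr 1
        funext x i
        simp [itinerary]
    simp only [heq]
    exact ((continuous_coe_real_ereal.tendsto _).comp hlim).limsup_eq.ge

variable (φ : C(X.carrier, ℝ))

lemma integrable_continuousMap (μ : Measure X.carrier) [IsFiniteMeasure μ] : Integrable φ μ :=
  Integrable.of_bound φ.continuous.measurable.aestronglyMeasurable ‖φ‖
    (Eventually.of_forall fun x => φ.norm_coe_le_norm x)

lemma integrable_birkhoffSum {μ : Measure X.carrier} [IsFiniteMeasure μ]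
    (hμ : MeasurePreserving (shiftMap X) μ μ) (n : ℕ) :
    Integrable (birkhoffSum (shiftMap X) φ n) μ := by
  unfold birkhoffSum
  exact integrable_finsetSum _ fun i _ =>
    (hμ.iterate i).integrable_comp_of_integrable (integrable_continuousMap φ μ)

lemma integral_birkhoffSum {μ : Measure X.carrier} [IsFiniteMeasure μ]
    (hμ : MeasurePreserving (shiftMap X) μ μ) (n : ℕ) :
    ∫ x, birkhoffSum (shiftMap X) φ n x ∂μ = n * ∫ x, φ x ∂μ := by
  have hint : ∀ i : ℕ, Integrable (fun x => φ ((shiftMap X)^[i] x)) μ := fun i =>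
    (hμ.iterate i).integrable_comp_of_integrable (integrable_continuousMap φ μ)
  unfold birkhoffSum
  rw [integral_finsetSum _ fun i _ => hint i]
  have : ∀ i : ℕ, ∫ x, φ ((shiftMap X)^[i] x) ∂μ = ∫ x, φ x ∂μ := by
    intro i
    have h := hμ.iterate i
    rw [← integral_map h.measurable.aemeasurable
      φ.continuous.measurable.aestronglyMeasurable, h.map_eq]
  simp [this]

/-- The basic estimate for entropy plus energy at level `n`. -/
lemma cylinderEntropy_add_integral_le {μ : Measure X.carrier}
    (hμ : IsInvariantProb (shiftMap X) μ) {P δ C : ℝ} (hδ : 0 < δ) (hC : 0 < C) (n : ℕ)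
    (D : Set (List A))
    (hD : partitionSum X (shiftLanguage X ∩ D) φ n ≤ δ * Real.exp (n * P))
    (hDc : partitionSum X (shiftLanguage X \ D) φ n ≤ C * Real.exp (n * P)) :
    cylinderEntropy μ n + n * ∫ x, φ x ∂μ ≤ Real.log 2 + n * P +
      μ.real (prefixSet X n D) * Real.log δ + μ.real (prefixSet X n D)ᶜ * Real.log C := by
  classical
  obtain ⟨hprob, hinv⟩ := hμ
  set f := itinerary (shiftMap X) (fun x : X.carrier => x.1 0) n
  have hf : Measurable f := measurable_itinerary hinv.measurable (measurable_firstLetter X) n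
  set F : Set (List A) → (Fin n → A) → ℝ := fun E w =>
    if List.ofFn w ∈ E then Real.exp (supBirkhoff X φ (List.ofFn w)) else 0
  have hF0 : ∀ E w, 0 ≤ F E w := by
    intro E w
    simp only [F]
    split_ifs
    exacts [(Real.exp_pos _).le, le_rfl]
  have hFsum : ∀ E, ∑ w, F E w = partitionSum X E φ n := fun E => by
    unfold partitionSum
    exact Finset.sum_congr rfl fun w _ => by simp only [F]
  -- Half of the mass goes to words in `D`, half to the others, each half proportional to `exp
  -- φ_n(w)` and normalised by its assumed bound. Halving costs the `log 2`.
  set q : (Fin n → A) → ℝ := fun w =>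
    F (shiftLanguage X ∩ D) w / (2 * (δ * Real.exp (n * P))) +
    F (shiftLanguage X \ D) w / (2 * (C * Real.exp (n * P)))
  have hq : ∀ x, q (f x) = Real.exp (supBirkhoff X φ (wordPrefix n x.1) - (Real.log 2 + n * P +
      ((prefixSet X n D).indicator (fun _ => Real.log δ) x +
        (prefixSet X n D)ᶜ.indicator (fun _ => Real.log C) x))) := by
    intro x
    have hL := wordPrefix_mem_shiftLanguage n x
    have e : List.ofFn (f x) = wordPrefix n x.1 := ofFn_itinerary n x
    simp only [q, F, e]
    have e2 : Real.exp (Real.log 2) = 2 := Real.exp_log (by norm_num)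
    by_cases hx : wordPrefix n x.1 ∈ D
    · have hx' : x ∈ prefixSet X n D := hx
      rw [if_pos ⟨hL, hx⟩, if_neg fun h => h.2 hx, indicator_of_mem hx',
        indicator_of_notMem (by simpa using hx'), Real.exp_sub, Real.exp_add, Real.exp_add, add_zero,
        Real.exp_log hδ, e2]
      ring
    · have hx' : x ∉ prefixSet X n D := hx
      rw [if_neg fun h => hx h.2, if_pos ⟨hL, hx⟩, indicator_of_notMem hx',
        indicator_of_mem (by simpa using hx'), Real.exp_sub, Real.exp_add, Real.exp_add, zero_add,
        Real.exp_log hC, e2]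
      ring
  have h1 : cylinderEntropy μ n ≤ ∫ x, -Real.log (q (f x)) ∂μ := by
    refine shannonEntropy_le_integral hf (fun w => ?_) ?_ (Eventually.of_forall fun x => ?_)
    · exact add_nonneg (div_nonneg (hF0 _ _) (by positivity)) (div_nonneg (hF0 _ _) (by positivity))
    · simp only [q]
      rw [Finset.sum_add_distrib, ← Finset.sum_div, ← Finset.sum_div, hFsum, hFsum]
      have a1 : partitionSum X (shiftLanguage X ∩ D) φ n / (2 * (δ * Real.exp (n * P))) ≤ 1 / 2 := by
        rw [div_le_div_iff₀ (by positivity) (by norm_num)]; linarith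
      have a2 : partitionSum X (shiftLanguage X \ D) φ n / (2 * (C * Real.exp (n * P))) ≤ 1 / 2 := by
        rw [div_le_div_iff₀ (by positivity) (by norm_num)]; linarith
      linarith
    · rw [hq]; exact Real.exp_pos _
  have hmD := measurableSet_prefixSet (X := X) n D
  have i1 : Integrable ((prefixSet X n D).indicator fun _ => Real.log δ) μ :=
    (integrable_const _).indicator hmD
  have i2 : Integrable ((prefixSet X n D)ᶜ.indicator fun _ => Real.log C) μ :=
    (integrable_const _).indicator hmD.compl
  have i3 : Integrable (fun x => (prefixSet X n D).indicator (fun _ => Real.log δ) x +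
      (prefixSet X n D)ᶜ.indicator (fun _ => Real.log C) x) μ := i1.add i2
  have i4 : Integrable (fun x => Real.log 2 + n * P +
      ((prefixSet X n D).indicator (fun _ => Real.log δ) x +
      (prefixSet X n D)ᶜ.indicator (fun _ => Real.log C) x)) μ := (integrable_const _).add i3
  have h2 : ∫ x, -Real.log (q (f x)) ∂μ ≤ ∫ x, (Real.log 2 + n * P +
      ((prefixSet X n D).indicator (fun _ => Real.log δ) x +
        (prefixSet X n D)ᶜ.indicator (fun _ => Real.log C) x) -
        birkhoffSum (shiftMap X) φ n x) ∂μ := by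
    refine integral_mono (integrable_comp_finite hf fun c => -Real.log (q c))
      (i4.sub (integrable_birkhoffSum φ hinv n)) fun x => ?_
    simp only [hq, Real.log_exp]
    have := birkhoffSum_le_supBirkhoff_wordPrefix (φ := φ) n x
    linarith
  have h3 : ∫ x, (Real.log 2 + n * P +
      ((prefixSet X n D).indicator (fun _ => Real.log δ) x +
        (prefixSet X n D)ᶜ.indicator (fun _ => Real.log C) x) -
        birkhoffSum (shiftMap X) φ n x) ∂μ = Real.log 2 + n * P +
      (μ.real (prefixSet X n D) * Real.log δ + μ.real (prefixSet X n D)ᶜ * Real.log C) -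
        n * ∫ x, φ x ∂μ := by
    rw [integral_sub i4 (integrable_birkhoffSum φ hinv n),
      integral_add (integrable_const _) i3, integral_add i1 i2,
      integral_indicator_const _ hmD, integral_indicator_const _ hmD.compl,
      integral_birkhoffSum φ hinv]
    simp
  linarith

lemma exists_agree_of_isOpen {O : Set X.carrier} (hO : IsOpen O) {x : X.carrier} (hx : x ∈ O) :
    ∃ N, ∀ y : X.carrier, (∀ i < N, x.1 i = y.1 i) → y ∈ O := by
  obtain ⟨O', hO', rfl⟩ := isOpen_induced_iff.1 hO
  obtain ⟨I, u, hu, hsub⟩ := isOpen_pi_iff.1 hO' x.1 hx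
  refine ⟨I.sup id + 1, fun y hy => hsub fun i hi => ?_⟩
  have : i ≤ I.sup id := Finset.le_sup (f := id) hi
  rw [← hy i (by omega)]
  exact (hu i hi).2

/-- Uniform continuity, in terms of letters, from compactness. -/
lemma exists_agree_dist_le {ε : ℝ} (hε : 0 < ε) :
    ∃ N, ∀ x y : X.carrier, (∀ i < N, x.1 i = y.1 i) → |φ x - φ y| ≤ ε := by
  have h : ∀ x : X.carrier, ∃ N, ∀ y : X.carrier, (∀ i < N, x.1 i = y.1 i) →
      |φ y - φ x| < ε / 2 := by
    intro x
    have hO : IsOpen {y : X.carrier | |φ y - φ x| < ε / 2} :=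
      isOpen_lt (by fun_prop) continuous_const
    exact exists_agree_of_isOpen hO (x := x) (by simp [hε])
  choose N hN using h
  obtain ⟨s, hs⟩ := isCompact_univ.elim_finite_subcover
    (fun x : X.carrier => wordCylinder X (wordPrefix (N x) x.1))
    (fun x => (isClopen_wordCylinder _).isOpen)
    (fun x _ => mem_iUnion.2 ⟨x, mem_wordCylinder_wordPrefix _ _⟩)
  refine ⟨s.sup N, fun x y hxy => ?_⟩
  obtain ⟨z, hz, hxz⟩ : ∃ z ∈ s, x ∈ wordCylinder X (wordPrefix (N z) z.1) := by
    simpa using hs (mem_univ x)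
  have hzx : ∀ i < N z, z.1 i = x.1 i := by
    rw [mem_wordCylinder_iff_wordPrefix, length_wordPrefix] at hxz
    exact wordPrefix_eq_iff.1 hxz.symm
  have hle : N z ≤ s.sup N := Finset.le_sup hz
  have h1 := abs_lt.1 (hN z x hzx)
  have h2 := abs_lt.1 (hN z y fun i hi => (hzx i hi).trans (hxy i (by omega)))
  rw [abs_le]
  constructor <;> linarith

/-- At each time but the last `N`, enough common letters remain to keep the variation below `ε`; the
last `N` terms give the constant. For a merely continuous potential this replaces the Bowen
property. -/
lemma exists_birkhoffSum_dist_le {ε : ℝ} (hε : 0 < ε) :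
    ∃ C : ℝ, ∀ (n : ℕ) (x y : X.carrier), (∀ i < n, x.1 i = y.1 i) →
      |birkhoffSum (shiftMap X) φ n x - birkhoffSum (shiftMap X) φ n y| ≤ n * ε + C := by
  obtain ⟨N, hN⟩ := exists_agree_dist_le φ hε
  refine ⟨2 * N * ‖φ‖, fun n x y hxy => ?_⟩
  have key : ∀ m, ∀ x y : X.carrier, (∀ i < m + N, x.1 i = y.1 i) →
      |birkhoffSum (shiftMap X) φ m x - birkhoffSum (shiftMap X) φ m y| ≤ m * ε := by
    intro m x y hxy
    unfold birkhoffSum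
    rw [← Finset.sum_sub_distrib]
    refine (Finset.abs_sum_le_sum_abs _ _).trans ?_
    refine (Finset.sum_le_sum (g := fun _ => ε) fun i hi => hN _ _ fun k hk => ?_).trans (by simp)
    rw [shiftMap_iterate_apply, shiftMap_iterate_apply]
    have := Finset.mem_range.1 hi
    exact hxy _ (by omega)
  have hphi := norm_nonneg φ
  rcases le_total N n with h | h
  · obtain ⟨m, rfl⟩ := Nat.exists_eq_add_of_le' h
    rw [birkhoffSum_add, birkhoffSum_add]
    have h1 := abs_le.1 (key m x y hxy)
    have h2 := abs_le.1 (abs_birkhoffSum_le φ N ((shiftMap X)^[m] x))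
    have h3 := abs_le.1 (abs_birkhoffSum_le φ N ((shiftMap X)^[m] y))
    have h4 : (0 : ℝ) ≤ N * ε := by positivity
    push_cast
    rw [abs_le]
    constructor <;> linarith
  · have h2 := abs_le.1 (abs_birkhoffSum_le φ n x)
    have h3 := abs_le.1 (abs_birkhoffSum_le φ n y)
    have h4 : (0 : ℝ) ≤ n * ε := by positivity
    have h5 : (n : ℝ) * ‖φ‖ ≤ N * ‖φ‖ := by gcongr
    rw [abs_le]
    constructor <;> linarith

/-- An invariant measure with the upper Gibbs bound has large entropy. -/
lemma le_cylinderEntropy_of_upper {μ : Measure X.carrier} (hμ : IsInvariantProb (shiftMap X) μ)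
    {K P : ℝ} (hK : 0 < K) (hup : ∀ w ∈ shiftLanguage X, μ.real (wordCylinder X w) ≤
      K * Real.exp (supBirkhoff X φ w - w.length * P)) {ε : ℝ} (hε : 0 < ε) :
    ∃ C : ℝ, ∀ n : ℕ, n * P ≤ cylinderEntropy μ n + n * ∫ x, φ x ∂μ + n * ε + C := by
  obtain ⟨hprob, hinv⟩ := hμ
  obtain ⟨C, hC⟩ := exists_birkhoffSum_dist_le φ hε
  refine ⟨Real.log K + C, fun n => ?_⟩
  set f := itinerary (shiftMap X) (fun x : X.carrier => x.1 0) n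
  have hf : Measurable f := measurable_itinerary hinv.measurable (measurable_firstLetter X) n
  have h1 : ∫ x, (n * P - Real.log K - n * ε - C - birkhoffSum (shiftMap X) φ n x) ∂μ ≤
      cylinderEntropy μ n := by
    rw [cylinderEntropy, shannonEntropy_eq_integral hf]
    refine integral_mono_ae ((integrable_const _).sub (integrable_birkhoffSum φ hinv n))
      (integrable_comp_finite hf fun c => -Real.log (μ.real (f ⁻¹' {c}))) ?_
    filter_upwards [ae_fiber_pos f] with x hx
    have e : f ⁻¹' {f x} = wordCylinder X (wordPrefix n x.1) := by
      rw [itinerary_preimage, ofFn_itinerary]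
    rw [e] at hx ⊢
    have h2 := Real.log_le_log hx (hup _ (wordPrefix_mem_shiftLanguage n x))
    rw [Real.log_mul hK.ne' (Real.exp_pos _).ne', Real.log_exp, length_wordPrefix] at h2
    have h3 : supBirkhoff X φ (wordPrefix n x.1) ≤
        birkhoffSum (shiftMap X) φ n x + (n * ε + C) := by
      refine supBirkhoff_le (wordPrefix_mem_shiftLanguage n x) fun y hy => ?_
      rw [mem_wordCylinder_iff_wordPrefix, length_wordPrefix, wordPrefix_eq_iff] at hy
      have := (abs_le.1 (hC n y x hy)).2
      rw [length_wordPrefix]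
      linarith
    linarith
  rw [integral_sub (integrable_const _) (integrable_birkhoffSum φ hinv n),
    integral_birkhoffSum φ hinv] at h1
  simp at h1
  linarith

end ShiftEntropy

/-! ### Uniqueness of equilibrium states -/

section Uniqueness

variable {A : Type*} [Fintype A] [TopologicalSpace A] [DiscreteTopology A] [MeasurableSpace A]
  [DiscreteMeasurableSpace A] {X : Subshift A ℕ} [Nonempty X.carrier] {φ : C(X.carrier, ℝ)}
  {Cp G Cs : Set (List A)} {μ : Measure X.carrier}

lemma IsMixingGibbs.lower (h : IsMixingGibbs X φ Cp G Cs μ) (hd : IsDecomposition X Cp G Cs)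
    (M : ℕ) : ∃ c : ℝ, 0 < c ∧ ∀ w ∈ fattened X Cp G Cs M,
      c * Real.exp (supBirkhoff X φ w - w.length * topPressure X φ) ≤
        μ.real (wordCylinder X w) := by
  obtain ⟨c, hc, N, hN⟩ := h.mixing M
  have := h.isProb
  refine ⟨c, hc, fun w hw => ?_⟩
  have := hN w hw [] (hd.subset_fattened M hd.nil_mem.2.1) _ le_rfl
  simpa using this

lemma exists_tendsto_zero_lt {ε : ℕ → ℝ} (h : Tendsto ε atTop (𝓝 0)) {δ : ℝ} (hδ : 0 < δ) :
    ∃ M, ε M < δ := (h.eventually_lt_const hδ).exists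

/-- One half of the variational principle: the entropy estimate with `D = ∅` bounds `n` times the
excess over the pressure independently of `n`. -/
lemma IsMixingGibbs.le_pressure (hg : IsGoodDecomposition X φ Cp G Cs) {ν : Measure X.carrier}
    (hν : IsInvariantProb (shiftMap X) ν) :
    measureEntropy (shiftMap X) ν + ((∫ x, φ x ∂ν : ℝ) : EReal) ≤ (topPressure X φ : ℝ) := by
  obtain ⟨C₀, hC₀, hC, -⟩ := hg.partitionSum_bounds
  obtain ⟨h, hh, -, hle⟩ := exists_measureEntropy_eq hν
  rw [hh, ← EReal.coe_add, EReal.coe_le_coe_iff]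
  have key : ∀ n : ℕ, n * (h + ∫ x, φ x ∂ν - topPressure X φ) ≤ Real.log 2 + Real.log C₀ := by
    intro n
    have hmain := cylinderEntropy_add_integral_le φ hν (P := topPressure X φ) one_pos
      (by linarith : 0 < C₀) n ∅
      (by simpa [partitionSum] using (Real.exp_pos _).le) (by simpa using hC n)
    have h1 := hle n
    have := hν.1
    have h2 : ν.real (prefixSet X n ∅)ᶜ * Real.log C₀ ≤ 1 * Real.log C₀ :=
      mul_le_mul_of_nonneg_right measureReal_le_one (Real.log_nonneg hC₀)
    rw [Real.log_one, mul_zero] at hmain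
    linarith
  by_contra! hlt
  obtain ⟨n, hn⟩ := exists_nat_gt ((Real.log 2 + Real.log C₀) / (h + ∫ x, φ x ∂ν - topPressure X φ))
  rw [div_lt_iff₀ (by linarith)] at hn
  linarith [key n]

/-- The other half, for `μ` only: cylinders of small mass force entropy, and the continuity error
per step is arbitrarily small. -/
lemma IsMixingGibbs.pressure_le (hμ : IsMixingGibbs X φ Cp G Cs μ) :
    ((topPressure X φ : ℝ) : EReal) ≤
      measureEntropy (shiftMap X) μ + ((∫ x, φ x ∂μ : ℝ) : EReal) := by
  have hinv : IsInvariantProb (shiftMap X) μ := ⟨hμ.isProb, hμ.invariant⟩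
  obtain ⟨h, hh, hlim, -⟩ := exists_measureEntropy_eq hinv
  obtain ⟨K, hK, hup⟩ := hμ.upper
  rw [hh, ← EReal.coe_add, EReal.coe_le_coe_iff]
  refine le_of_forall_pos_le_add fun ε hε => ?_
  obtain ⟨C, hC⟩ := le_cylinderEntropy_of_upper φ hinv hK hup hε
  have h1 : Tendsto (fun n : ℕ => cylinderEntropy μ n / n + ∫ x, φ x ∂μ + ε + C / n) atTop
      (𝓝 (h + ∫ x, φ x ∂μ + ε + 0)) :=
    ((hlim.add_const _).add_const _).add (tendsto_const_div_atTop_nhds_zero_nat C)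
  rw [add_zero] at h1
  refine ge_of_tendsto h1 ?_
  filter_upwards [eventually_gt_atTop 0] with n hn
  have hn' : (0 : ℝ) < n := by exact_mod_cast hn
  have h2 := hC n
  have h3 : cylinderEntropy μ n / n + ∫ x, φ x ∂μ + ε + C / n =
      (cylinderEntropy μ n + n * ∫ x, φ x ∂μ + n * ε + C) / n := by field_simp
  rw [h3, le_div_iff₀ hn']
  linarith

theorem IsMixingGibbs.isEquilibriumState (hg : IsGoodDecomposition X φ Cp G Cs)
    (hμ : IsMixingGibbs X φ Cp G Cs μ) : IsEquilibriumState (shiftMap X) φ μ :=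
  ⟨⟨hμ.isProb, hμ.invariant⟩, fun _ hν => (IsMixingGibbs.le_pressure hg hν).trans hμ.pressure_le⟩

/-- Every equilibrium state is absolutely continuous with respect to a Gibbs measure. -/
lemma IsMixingGibbs.absolutelyContinuous (hg : IsGoodDecomposition X φ Cp G Cs)
    (hμ : IsMixingGibbs X φ Cp G Cs μ) {ν : Measure X.carrier}
    (hν : IsEquilibriumState (shiftMap X) φ ν) : ν ≪ μ := by
  have hμp := hμ.isProb
  have hνp := hν.1.1
  obtain ⟨C₀, hC₀, hC, ε, hε, hεb⟩ := hg.partitionSum_bounds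
  have hpress := hμ.pressure_le.trans (hν.2 μ ⟨hμ.isProb, hμ.invariant⟩)
  obtain ⟨h, hh, -, hle⟩ := exists_measureEntropy_eq hν.1
  rw [hh, ← EReal.coe_add, EReal.coe_le_coe_iff] at hpress
  refine Measure.AbsolutelyContinuous.mk fun S hS hS0 => ?_
  by_contra hne
  set a := ν.real S
  have ha : 0 < a := lt_of_le_of_ne measureReal_nonneg fun h0 =>
    hne ((measureReal_eq_zero_iff).1 h0.symm)
  -- A `μ`-null set of `ν`-mass `a` is nearly a set of prefixes of total weight at most δ e^{nP}.
  -- The entropy estimate then gains `a / 2 * log δ`, while maximality of `ν` leaves room only for a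
  -- bounded loss.
  have key : ∀ δ : ℝ, 0 < δ → δ < 1 → 0 ≤ Real.log 2 + a / 2 * Real.log δ + Real.log C₀ := by
    intro δ hδ hδ1
    obtain ⟨M, hM⟩ := exists_tendsto_zero_lt hε (half_pos hδ)
    obtain ⟨c, hc, hlow⟩ := hμ.lower hg.1 M
    -- Using `μ + ν` serves both measures at once. The lower Gibbs bound turns the tolerance `c * (δ
    -- / 2)` into weight at most (δ/2) e^{nP} for the words of `D` in `G(M)`.
    obtain ⟨n, hn⟩ := exists_prefixSet_approx (μ + ν) hS
      (lt_min (half_pos ha) (by positivity : 0 < c * (δ / 2)))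
    obtain ⟨D, hD⟩ := hn n le_rfl
    rw [measureReal_add_apply] at hD
    have hD1 := hD.trans_le (min_le_left _ _)
    have hD2 := hD.trans_le (min_le_right _ _)
    have n1 : 0 ≤ μ.real (symmDiff S (prefixSet X n D)) := measureReal_nonneg
    have n2 : 0 ≤ ν.real (symmDiff S (prefixSet X n D)) := measureReal_nonneg
    have hνD : a / 2 ≤ ν.real (prefixSet X n D) := by
      have : a ≤ ν.real (prefixSet X n D) + ν.real (symmDiff S (prefixSet X n D)) := by
        refine (measureReal_mono ?_ (measure_ne_top _ _)).trans (measureReal_union_le _ _)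
        intro x hx
        by_cases hx' : x ∈ prefixSet X n D
        · exact Or.inl hx'
        · exact Or.inr (Or.inl ⟨hx, hx'⟩)
      linarith
    have hμD : μ.real (prefixSet X n D) ≤ c * (δ / 2) := by
      have : μ.real (prefixSet X n D) ≤ μ.real S + μ.real (symmDiff S (prefixSet X n D)) := by
        refine (measureReal_mono ?_ (measure_ne_top _ _)).trans (measureReal_union_le _ _)
        intro x hx
        by_cases hx' : x ∈ S
        · exact Or.inl hx'
        · exact Or.inr (Or.inr ⟨hx, hx'⟩)
      have h0 : μ.real S = 0 := by rw [Measure.real, hS0]; rfl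
      linarith
    have hcount : partitionSum X (shiftLanguage X ∩ D) φ n ≤
        δ * Real.exp (n * topPressure X φ) := by
      have h1 : partitionSum X (shiftLanguage X ∩ D) φ n ≤
          partitionSum X (fattened X Cp G Cs M ∩ D) φ n +
          partitionSum X (shiftLanguage X \ fattened X Cp G Cs M) φ n := by
        classical
        simp only [partitionSum_eq]
        rw [← Finset.sum_union_inter]
        refine le_trans (Finset.sum_le_sum_of_subset_of_nonneg ?_ fun _ _ _ => (Real.exp_pos _).le)
          (le_add_of_nonneg_right (Finset.sum_nonneg fun _ _ => (Real.exp_pos _).le))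
        intro w hw
        rw [mem_wordsOf] at hw
        rw [Finset.mem_union, mem_wordsOf, mem_wordsOf]
        by_cases hwM : w ∈ fattened X Cp G Cs M
        · exact Or.inl ⟨hw.1, hwM, hw.2.2⟩
        · exact Or.inr ⟨hw.1, hw.2.1, hwM⟩
      have h2 : partitionSum X (fattened X Cp G Cs M ∩ D) φ n ≤
          δ / 2 * Real.exp (n * topPressure X φ) := by
        have h3 : c * Real.exp (-(n * topPressure X φ)) *
            partitionSum X (fattened X Cp G Cs M ∩ D) φ n ≤ μ.real (prefixSet X n D) := by
          rw [partitionSum_eq, Finset.mul_sum, measureReal_prefixSet]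
          refine Finset.sum_le_sum_of_inj id (fun w hw => ?_) (fun _ _ _ _ h => h) (fun w hw => ?_)
            fun _ _ => measureReal_nonneg
          · rw [mem_wordsOf] at hw
            exact mem_wordsOf.2 ⟨hw.1, hw.2.2⟩
          · rw [mem_wordsOf] at hw
            have := hlow w hw.2.1
            rw [hw.1] at this
            refine le_trans (le_of_eq ?_) this
            rw [mul_assoc, ← Real.exp_add]
            congr 2; ring
        have h4 := h3.trans hμD
        rw [mul_assoc, mul_le_mul_iff_right₀ hc, Real.exp_neg, inv_mul_le_iff₀ (Real.exp_pos _)]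
          at h4
        linarith
      have h3 := hεb M n
      have h4 : ε M * Real.exp (n * topPressure X φ) ≤
          δ / 2 * Real.exp (n * topPressure X φ) := by gcongr
      linarith
    have hcount' : partitionSum X (shiftLanguage X \ D) φ n ≤
        C₀ * Real.exp (n * topPressure X φ) :=
      (partitionSum_mono sdiff_subset φ n).trans (hC n)
    have hfin := cylinderEntropy_add_integral_le φ hν.1 hδ (by linarith : 0 < C₀) n D hcount hcount'
    have h5 := hle n
    have h6 : ν.real (prefixSet X n D)ᶜ * Real.log C₀ ≤ 1 * Real.log C₀ :=
      mul_le_mul_of_nonneg_right measureReal_le_one (Real.log_nonneg hC₀)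
    have h7 : ν.real (prefixSet X n D) * Real.log δ ≤ a / 2 * Real.log δ :=
      mul_le_mul_of_nonpos_right hνD (Real.log_nonpos hδ.le hδ1.le)
    have h8 : (n : ℝ) * topPressure X φ ≤ n * (h + ∫ x, φ x ∂ν) := by gcongr
    linarith
  have hlogs : 0 ≤ Real.log 2 + Real.log C₀ :=
    add_nonneg (Real.log_nonneg (by norm_num)) (Real.log_nonneg hC₀)
  -- For this `δ` the right-hand side of `key` equals `-1`.
  have := key (Real.exp (-((Real.log 2 + Real.log C₀ + 1) / (a / 2)))) (Real.exp_pos _) (by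
    rw [← Real.exp_zero, Real.exp_lt_exp, neg_lt_zero]; positivity)
  rw [Real.log_exp] at this
  have e : a / 2 * -((Real.log 2 + Real.log C₀ + 1) / (a / 2)) = -(Real.log 2 + Real.log C₀ + 1) := by
    field_simp
  linarith

/-- Let a set of prefixes `D` approximate an invariant set and its complement approximate the other
side. By invariance almost no mass moves from `D` to the complement of `D` in `n + N` steps, whereas
the mixing bound moves a definite proportion. -/
lemma IsMixingGibbs.ergodic (hg : IsGoodDecomposition X φ Cp G Cs)
    (hμ : IsMixingGibbs X φ Cp G Cs μ) : Ergodic (shiftMap X) μ := by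
  have hμp := hμ.isProb
  refine ⟨hμ.invariant, ⟨fun S hS hinv => ?_⟩⟩
  rw [eventuallyConst_set']
  by_contra! hcon
  have h1 : μ.real S ≠ 0 := fun h0 => hcon.1 (by
    rw [measureReal_eq_zero_iff] at h0
    exact ae_eq_empty.2 h0)
  have h2 : μ.real Sᶜ ≠ 0 := fun h0 => hcon.2 (by
    rw [measureReal_eq_zero_iff] at h0
    exact ae_eq_univ.2 h0)
  set m := min (μ.real S) (μ.real Sᶜ)
  have hm : 0 < m := lt_min (lt_of_le_of_ne measureReal_nonneg h1.symm)
    (lt_of_le_of_ne measureReal_nonneg h2.symm)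
  obtain ⟨C₀, -, -, ε, hε, hεb⟩ := hg.partitionSum_bounds
  obtain ⟨K, hK, hup⟩ := hμ.upper
  obtain ⟨M, hM⟩ := exists_tendsto_zero_lt hε (by positivity : 0 < m / 4 / K)
  obtain ⟨c, hc, N, hN⟩ := hμ.mixing M
  -- An approximation error `m / 4` and mass `m / 4` outside `G(M)` leave `m / 2` on each side. The
  -- second entry puts `2 * τ` below the mixing bound `c / K ^ 2 * (m / 2) ^ 2`.
  set τ := min (m / 4) (c * m ^ 2 / (16 * K ^ 2))
  have hτ : 0 < τ := by positivity
  obtain ⟨n, hn⟩ := exists_prefixSet_approx μ hS hτ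
  obtain ⟨D, hD⟩ := hn n le_rfl
  have hτ1 : τ ≤ m / 4 := min_le_left _ _
  have hτ2 : τ ≤ c * m ^ 2 / (16 * K ^ 2) := min_le_right _ _
  set F := fattened X Cp G Cs M
  have hcomp : symmDiff Sᶜ (prefixSet X n Dᶜ) = symmDiff S (prefixSet X n D) := by
    ext x
    simp only [Set.mem_symmDiff, prefixSet, Set.mem_compl_iff, Set.mem_ofPred_eq]
    tauto
  have htail : μ.real (prefixSet X n (shiftLanguage X \ F)) ≤ m / 4 := by
    rw [measureReal_prefixSet]
    calc ∑ w ∈ wordsOf (shiftLanguage X \ F) n, μ.real (wordCylinder X w)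
        ≤ ∑ w ∈ wordsOf (shiftLanguage X \ F) n,
          K * Real.exp (-(n * topPressure X φ)) * Real.exp (supBirkhoff X φ w) := by
          refine Finset.sum_le_sum fun w hw => ?_
          rw [mem_wordsOf] at hw
          refine (hup w hw.2.1).trans (le_of_eq ?_)
          rw [mul_assoc, ← Real.exp_add, hw.1]; congr 2; ring
      _ = K * Real.exp (-(n * topPressure X φ)) * partitionSum X (shiftLanguage X \ F) φ n := by
          rw [partitionSum_eq, Finset.mul_sum]
      _ ≤ K * Real.exp (-(n * topPressure X φ)) * (m / 4 / K * Real.exp (n * topPressure X φ)) := by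
          refine mul_le_mul_of_nonneg_left ((hεb M n).trans ?_) (by positivity)
          gcongr
      _ = m / 4 := by
          rw [Real.exp_neg]
          field_simp
  have hmass : ∀ (S' : Set X.carrier) (D' : Set (List A)), m ≤ μ.real S' →
      μ.real (symmDiff S' (prefixSet X n D')) < τ →
      m / 2 ≤ ∑ w ∈ wordsOf (D' ∩ F) n, μ.real (wordCylinder X w) := by
    intro S' D' hS' hD'
    rw [← measureReal_prefixSet]
    have : μ.real S' ≤ μ.real (prefixSet X n (D' ∩ F)) +
        μ.real (prefixSet X n (shiftLanguage X \ F)) +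
        μ.real (symmDiff S' (prefixSet X n D')) := by
      refine (measureReal_mono ?_ (measure_ne_top _ _)).trans
        ((measureReal_union_le (prefixSet X n (D' ∩ F) ∪ prefixSet X n (shiftLanguage X \ F)) _).trans
          (add_le_add_left (measureReal_union_le _ _) _))
      intro x hx
      by_cases hxD : wordPrefix n x.1 ∈ D'
      · left
        by_cases hxF : wordPrefix n x.1 ∈ F
        · exact Or.inl ⟨hxD, hxF⟩
        · exact Or.inr ⟨wordPrefix_mem_shiftLanguage n x, hxF⟩
      · exact Or.inr (Or.inl ⟨hx, hxD⟩)
    linarith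
  have hm1 := hmass S D (min_le_left _ _) hD
  have hm2 := hmass Sᶜ Dᶜ (min_le_right _ _) (by rw [hcomp]; exact hD)
  set I := prefixSet X n D ∩ (shiftMap X)^[n + N] ⁻¹' prefixSet X n Dᶜ
  have hIle : μ.real I < 2 * τ := by
    have hinvj : (shiftMap X)^[n + N] ⁻¹' S = S := by
      generalize n + N = j
      induction j with
      | zero => rfl
      | succ j ih => rw [Function.iterate_succ, preimage_comp, ih, hinv]
    have : μ.real I ≤ μ.real (symmDiff S (prefixSet X n D)) +
        μ.real ((shiftMap X)^[n + N] ⁻¹' (symmDiff S (prefixSet X n D))) := by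
      refine (measureReal_mono ?_ (measure_ne_top _ _)).trans (measureReal_union_le _ _)
      rintro x ⟨hx1, hx2⟩
      by_cases hxS : x ∈ S
      · right
        refine Or.inl ⟨?_, hx2⟩
        rw [← hinvj] at hxS
        exact hxS
      · exact Or.inl (Or.inr ⟨hx1, hxS⟩)
    rw [(hμ.invariant.iterate (n + N)).measureReal_preimage
      (hS.symmDiff (measurableSet_prefixSet n D)).nullMeasurableSet] at this
    linarith
  have hIge : c / K ^ 2 * ((m / 2) * (m / 2)) ≤ μ.real I := by
    calc c / K ^ 2 * ((m / 2) * (m / 2))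
        ≤ c / K ^ 2 * ((∑ w ∈ wordsOf (D ∩ F) n, μ.real (wordCylinder X w)) *
          (∑ w ∈ wordsOf (Dᶜ ∩ F) n, μ.real (wordCylinder X w))) := by gcongr
      _ = ∑ p ∈ wordsOf (D ∩ F) n ×ˢ wordsOf (Dᶜ ∩ F) n,
          c / K ^ 2 * (μ.real (wordCylinder X p.1) * μ.real (wordCylinder X p.2)) := by
          rw [Finset.sum_mul_sum, ← Finset.sum_product', Finset.mul_sum]
      _ ≤ ∑ p ∈ wordsOf (D ∩ F) n ×ˢ wordsOf (Dᶜ ∩ F) n,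
          μ.real (wordCylinder X p.1 ∩ (shiftMap X)^[n + N] ⁻¹' wordCylinder X p.2) := by
          refine Finset.sum_le_sum fun p hp => ?_
          rw [Finset.mem_product, mem_wordsOf, mem_wordsOf] at hp
          have h3 := hN p.1 hp.1.2.2 p.2 hp.2.2.2 (n + N) (by rw [hp.1.1])
          refine le_trans ?_ h3
          have h4 := hup p.1 hp.1.2.2.1
          have h5 := hup p.2 hp.2.2.2.1
          have h6 := mul_le_mul h4 h5 measureReal_nonneg (by positivity)
          rw [div_mul_eq_mul_div, div_le_iff₀ (by positivity)]
          refine (mul_le_mul_of_nonneg_left h6 hc.le).trans (le_of_eq (by ring))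
      _ = μ.real (⋃ p ∈ wordsOf (D ∩ F) n ×ˢ wordsOf (Dᶜ ∩ F) n,
          wordCylinder X p.1 ∩ (shiftMap X)^[n + N] ⁻¹' wordCylinder X p.2) := by
          refine (measureReal_biUnion_finset ?_ fun p _ => ?_).symm
          · intro p hp q hq hpq
            refine Set.disjoint_left.2 fun x hx hx' => hpq ?_
            have hp' := Finset.mem_product.1 hp
            have hq' := Finset.mem_product.1 hq
            simp only [mem_wordsOf] at hp' hq'
            exact Prod.ext (eq_of_mem_wordCylinder hx.1 hx'.1 (hp'.1.1.trans hq'.1.1.symm))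
              (eq_of_mem_wordCylinder hx.2 hx'.2 (hp'.2.1.trans hq'.2.1.symm))
          · exact ((isClopen_wordCylinder _).inter
              (isClopen_preimage_iterate _ _)).isOpen.measurableSet
      _ ≤ μ.real I := by
          refine measureReal_mono ?_ (measure_ne_top _ _)
          refine iUnion₂_subset fun p hp x hx => ?_
          rw [Finset.mem_product, mem_wordsOf, mem_wordsOf] at hp
          have e1 := mem_wordCylinder_iff_wordPrefix.1 hx.1
          have e2 := mem_wordCylinder_iff_wordPrefix.1 hx.2
          rw [hp.1.1] at e1
          rw [hp.2.1] at e2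
          refine ⟨?_, ?_⟩
          · change wordPrefix n x.1 ∈ D
            rw [e1]; exact hp.1.2.1
          · change wordPrefix n ((shiftMap X)^[n + N] x).1 ∈ Dᶜ
            rw [e2]; exact hp.2.2.1
  have e3 : c / K ^ 2 * ((m / 2) * (m / 2)) = 4 * (c * m ^ 2 / (16 * K ^ 2)) := by
    field_simp; norm_num
  linarith

/-- An invariant probability absolutely continuous with respect to an ergodic one coincides with it.
-/
theorem IsMixingGibbs.unique (hg : IsGoodDecomposition X φ Cp G Cs)
    (hμ : IsMixingGibbs X φ Cp G Cs μ) {ν : Measure X.carrier}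
    (hν : IsEquilibriumState (shiftMap X) φ ν) : ν = μ := by
  have := hμ.isProb
  have := hν.1.1
  exact (hμ.ergodic hg).eq_of_absolutelyContinuous hν.1.2 (hμ.absolutelyContinuous hg hν)

lemma IsMixingGibbs.hasWeakGibbs (hg : IsGoodDecomposition X φ Cp G Cs)
    (hμ : IsMixingGibbs X φ Cp G Cs μ) : HasWeakGibbs X φ μ Cp G Cs := by
  obtain ⟨K, hK, hup⟩ := hμ.upper
  refine ⟨K, hK, fun M => ?_⟩
  obtain ⟨c, hc, hlow⟩ := hμ.lower hg.1 M
  refine ⟨c, hc, fun w hw => ?_⟩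
  have e : -(w.length : ℝ) * topPressure X φ + supBirkhoff X φ w =
      supBirkhoff X φ w - w.length * topPressure X φ := by ring
  rw [e, le_div_iff₀ (Real.exp_pos _), div_le_iff₀ (Real.exp_pos _)]
  exact ⟨hlow w hw, hup w hw.1⟩

/-- A good decomposition yields a unique equilibrium state, with the weak Gibbs property for this
decomposition, to which the periodic orbit measures converge. -/
theorem IsGoodDecomposition.exists_unique_gibbs (hg : IsGoodDecomposition X φ Cp G Cs) :
    ∃ μ : Measure X.carrier, IsMixingGibbs X φ Cp G Cs μ ∧
      (∀ ν : Measure X.carrier, IsEquilibriumState (shiftMap X) φ ν → ν = μ) ∧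
      ∀ ψ : C(X.carrier, ℝ),
        Tendsto (fun n : ℕ => ∫ x, ψ x ∂(perMeasure X φ n)) atTop (𝓝 (∫ x, ψ x ∂μ)) := by
  classical
  obtain ⟨x₀⟩ := ‹Nonempty X.carrier›
  obtain ⟨c, C, hc, -, hcC⟩ := hg.perSum_univ
  -- A Dirac mass stands in where the periodic orbit measure is not a probability, which does not
  -- happen for large `n`.
  set pm : ℕ → ProbabilityMeasure X.carrier := fun n =>
    if h : IsProbabilityMeasure (perMeasure X φ n) then ⟨perMeasure X φ n, h⟩
    else ⟨Measure.dirac x₀, inferInstance⟩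
  have hpm : ∀ᶠ n in atTop, (pm n : Measure X.carrier) = perMeasure X φ n := by
    filter_upwards [hcC] with n hn
    have h := isProbabilityMeasure_perMeasure φ hn.1 (lt_of_lt_of_le (by positivity) hn.2.1)
    have e : pm n = ⟨perMeasure X φ n, h⟩ := dif_pos h
    rw [e]
    rfl
  have hlim : ∀ U : Ultrafilter ℕ, ↑U ≤ (atTop : Filter ℕ) →
      ∃ ν : ProbabilityMeasure X.carrier, Tendsto pm U (𝓝 ν) ∧
        IsMixingGibbs X φ Cp G Cs (ν : Measure X.carrier) := by
    intro U hU
    obtain ⟨ν, -, hν⟩ := isCompact_univ.ultrafilter_le_nhds (U.map pm) (by simp)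
    exact ⟨ν, hν, hg.isMixingGibbs hpm hU hν⟩
  obtain ⟨μ, -, hμ⟩ := hlim (hyperfilter ℕ) Nat.hyperfilter_le_atTop
  refine ⟨μ, hμ, fun ν hν => hμ.unique hg hν, fun ψ => ?_⟩
  -- Every ultrafilter limit is mixing Gibbs, hence an equilibrium state, hence `μ`.
  have ht : Tendsto pm atTop (𝓝 μ) := by
    rw [tendsto_iff_ultrafilter]
    intro U hU
    obtain ⟨ν, h1, h2⟩ := hlim U hU
    have : ν = μ := Subtype.ext (hμ.unique hg (h2.isEquilibriumState hg))
    rwa [← this]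
  have h1 := ProbabilityMeasure.tendsto_iff_forall_integral_tendsto.1 ht
    (BoundedContinuousFunction.mkOfCompact ψ)
  refine h1.congr' ?_
  filter_upwards [hpm] with n hn
  rw [hn]
  rfl

theorem IsGoodDecomposition.hasUniqueGibbsState (hg : IsGoodDecomposition X φ Cp G Cs) :
    HasUniqueGibbsState X φ := by
  obtain ⟨μ, h1, h2, h3⟩ := hg.exists_unique_gibbs
  exact ⟨μ, h1.isEquilibriumState hg, h2, ⟨Cp, G, Cs, hg, h1.hasWeakGibbs hg⟩, h3⟩

end Uniqueness

/-! ### A potential without the Bowen property -/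

section SingularPotential

variable {A : Type*} [TopologicalSpace A] {X : Subshift A ℕ}

open Classical in
/-- `1 / (n + 1)`, where `n` is the first place at which `x` differs from `p`. -/
def invAgreement (p x : ℕ → A) : ℝ :=
  if h : ∃ n, x n ≠ p n then 1 / ((Nat.find h : ℝ) + 1) else 0

lemma invAgreement_self (p : ℕ → A) : invAgreement p p = 0 := by simp [invAgreement]

lemma invAgreement_eq {p x : ℕ → A} {n : ℕ} (h : ∀ i < n, x i = p i) (hn : x n ≠ p n) :
    invAgreement p x = 1 / ((n : ℝ) + 1) := by
  classical
  have hex : ∃ n, x n ≠ p n := ⟨n, hn⟩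
  have : Nat.find hex = n := by
    rw [Nat.find_eq_iff]
    exact ⟨hn, fun m hm => not_not.2 (h m hm)⟩
  rw [invAgreement, dif_pos hex, this]

lemma invAgreement_nonneg (p x : ℕ → A) : 0 ≤ invAgreement p x := by
  unfold invAgreement
  split_ifs <;> positivity

lemma invAgreement_le {p x : ℕ → A} {n : ℕ} (h : ∀ i < n, x i = p i) :
    invAgreement p x ≤ 1 / ((n : ℝ) + 1) := by
  classical
  by_cases hex : ∃ n, x n ≠ p n
  · have hle : n ≤ Nat.find hex := by
      by_contra! hlt
      exact Nat.find_spec hex (h _ hlt)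
    rw [invAgreement, dif_pos hex]
    gcongr
  · rw [invAgreement, dif_neg hex]; positivity

lemma invAgreement_le_one (p x : ℕ → A) : invAgreement p x ≤ 1 := by
  simpa using invAgreement_le (p := p) (x := x) (n := 0) (by simp)

/-- The first difference with `p` is visible in both points. -/
lemma invAgreement_congr {p x y : ℕ → A} {n : ℕ} (hxy : ∀ i < n, x i = y i)
    (h : ∃ i < n, x i ≠ p i) : invAgreement p x = invAgreement p y := by
  classical
  obtain ⟨i, hi, hne⟩ := h
  have hex : ∃ n, x n ≠ p n := ⟨i, hne⟩
  have hlt : Nat.find hex < n := (Nat.find_le hne).trans_lt hi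
  have hmin : ∀ j < Nat.find hex, x j = p j := fun j hj => not_not.1 (Nat.find_min hex hj)
  rw [invAgreement_eq hmin (Nat.find_spec hex), invAgreement_eq (n := Nat.find hex)
    (fun j hj => (hxy j (hj.trans hlt)).symm.trans (hmin j hj))
    (by rw [← hxy _ hlt]; exact Nat.find_spec hex)]

variable [DiscreteTopology A]

lemma continuous_of_agree {f : X.carrier → ℝ} (h : ∀ x : X.carrier, ∀ ε > 0, ∃ N : ℕ,
    ∀ y : X.carrier, (∀ i < N, x.1 i = y.1 i) → |f y - f x| < ε) : Continuous f := by
  rw [Metric.continuous_iff']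
  intro x ε hε
  obtain ⟨N, hN⟩ := h x ε hε
  filter_upwards [(isClopen_wordCylinder (X := X) (wordPrefix N x.1)).isOpen.mem_nhds
    (mem_wordCylinder_wordPrefix N x)] with y hy
  rw [mem_wordCylinder_iff_wordPrefix, length_wordPrefix, wordPrefix_eq_iff] at hy
  exact hN y fun i hi => (hy i hi).symm

/-- The potential `-c / (n + 1)`, where `n` is the first place at which `x` differs from `p`. -/
def singularPotential (X : Subshift A ℕ) (p : ℕ → A) (c : ℝ) : C(X.carrier, ℝ) where
  toFun x := -(c * invAgreement p x.1)
  continuous_toFun := by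
    refine (Continuous.const_smul (continuous_of_agree fun x ε hε => ?_) c).neg
    by_cases hx : ∃ n, x.1 n ≠ p n
    · obtain ⟨n, hn⟩ := hx
      refine ⟨n + 1, fun y hy => ?_⟩
      rw [invAgreement_congr hy ⟨n, by omega, hn⟩]
      simpa using hε
    · push Not at hx
      have hx' : x.1 = p := funext hx
      obtain ⟨N, hN⟩ := exists_nat_one_div_lt hε
      refine ⟨N, fun y hy => ?_⟩
      rw [hx', invAgreement_self, sub_zero, abs_of_nonneg (invAgreement_nonneg _ _)]
      refine (invAgreement_le fun i hi => ?_).trans_lt hN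
      rw [← hy i hi, hx']

lemma singularPotential_apply (p : ℕ → A) (c : ℝ) (x : X.carrier) :
    singularPotential X p c x = -(c * invAgreement p x.1) := rfl

lemma singularPotential_nonpos {p : ℕ → A} {c : ℝ} (hc : 0 ≤ c) (x : X.carrier) :
    singularPotential X p c x ≤ 0 :=
  neg_nonpos.2 (mul_nonneg hc (invAgreement_nonneg _ _))

lemma le_singularPotential {p : ℕ → A} {c : ℝ} (hc : 0 ≤ c) (x : X.carrier) :
    -c ≤ singularPotential X p c x := by
  rw [singularPotential_apply, neg_le_neg_iff]
  exact mul_le_of_le_one_right hc (invAgreement_le_one _ _)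

/-- A tail that differs from `p` inside the word has its first difference, hence its value,
determined by the word. Only the last `L` terms can vary. -/
lemma hasBowenOn_singularPotential [Finite A] {p : ℕ → A} {c : ℝ} {D : Set (List A)} (L : ℕ)
    (hD : ∀ w ∈ D, ∀ x ∈ wordCylinder X w, ∀ j, j + L < w.length →
      ∃ i, j + i < w.length ∧ x.1 (j + i) ≠ p i) :
    HasBowenOn X D (singularPotential X p c) := by
  set φ := singularPotential X p c
  refine ⟨2 * L * ‖φ‖, fun w hw x hx y hy => ?_⟩
  have hxy : ∀ i < w.length, x.1 i = y.1 i := fun i hi => by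
    rw [mem_wordCylinder.1 hx i hi, mem_wordCylinder.1 hy i hi]
  have hL : ∀ z : X.carrier, |birkhoffSum (shiftMap X) φ L z| ≤ L * ‖φ‖ := abs_birkhoffSum_le φ L
  rcases le_total L w.length with h | h
  · obtain ⟨m, hm⟩ := Nat.exists_eq_add_of_le' h
    have h0 : birkhoffSum (shiftMap X) φ m x = birkhoffSum (shiftMap X) φ m y := by
      unfold birkhoffSum
      refine Finset.sum_congr rfl fun j hj => ?_
      rw [Finset.mem_range] at hj
      simp only [φ, singularPotential_apply]
      congr 2
      obtain ⟨i, hi, hne⟩ := hD w hw x hx j (by omega)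
      refine invAgreement_congr (n := w.length - j) (fun k hk => ?_) ⟨i, by omega, ?_⟩
      · rw [shiftMap_iterate_apply, shiftMap_iterate_apply]
        exact hxy _ (by omega)
      · rwa [shiftMap_iterate_apply]
    rw [hm, birkhoffSum_add, birkhoffSum_add, h0]
    have h1 := abs_le.1 (hL ((shiftMap X)^[m] x))
    have h2 := abs_le.1 (hL ((shiftMap X)^[m] y))
    rw [abs_le]
    constructor <;> linarith
  · have h2 := abs_le.1 (abs_birkhoffSum_le φ w.length x)
    have h3 := abs_le.1 (abs_birkhoffSum_le φ w.length y)
    have h5 : (w.length : ℝ) * ‖φ‖ ≤ L * ‖φ‖ := by gcongr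
    rw [abs_le]
    constructor <;> linarith

lemma periodic_apply {p : X.carrier} {q : ℕ} (hp : (shiftMap X)^[q] p = p) (k i : ℕ) :
    p.1 (q * k + i) = p.1 i := by
  induction k with
  | zero => simp
  | succ k ih =>
    rw [← ih]
    conv_rhs => rw [← hp]
    rw [shiftMap_iterate_apply]
    have : q * (k + 1) + i = q + (q * k + i) := by ring
    rw [this]

/-- The singular potential at a periodic point that is not isolated is not Bowen. -/
lemma not_hasBowen_singularPotential [Fintype A] {p : X.carrier} {q : ℕ} (hq : 0 < q)
    (hp : (shiftMap X)^[q] p = p) (hiso : ∀ N, ∃ y : X.carrier, y ≠ p ∧ ∀ i < N, y.1 i = p.1 i)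
    {c : ℝ} (hc : 0 < c) : ¬ HasBowen X (singularPotential X p.1 c) := by
  classical
  rintro ⟨V, hV⟩
  have hq' : (0 : ℝ) < q := by exact_mod_cast hq
  have hdiv := Real.tendsto_sum_range_one_div_nat_succ_atTop
  -- `K₀` periods of agreement with `p` produce a harmonic sum too large for the bound `V`.
  obtain ⟨K₀, hK₀⟩ := (hdiv.eventually_gt_atTop (2 * q * (V / c + q))).exists
  obtain ⟨y, hyp, hy⟩ := hiso (q * K₀)
  have hex : ∃ n, y.1 n ≠ p.1 n := by
    by_contra! h
    exact hyp (carrier_ext h)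
  set n := Nat.find hex
  have hn : y.1 n ≠ p.1 n := Nat.find_spec hex
  have hagree : ∀ i < n, y.1 i = p.1 i := fun i hi => not_not.1 (Nat.find_min hex hi)
  have hnK : q * K₀ ≤ n := by
    by_contra! hlt
    exact hn (hy _ hlt)
  set K := n / q
  have hKn : q * K ≤ n := Nat.mul_div_le n q
  have hnK' : n < q * K + q := Nat.lt_mul_div_succ n hq
  have hKK : K₀ ≤ K := (Nat.le_div_iff_mul_le hq).2 (by rwa [mul_comm])
  set d : ℕ → ℝ := fun j => invAgreement p.1 ((shiftMap X)^[j] y).1 -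
    invAgreement p.1 ((shiftMap X)^[j] p).1
  have hmul : ∀ k, q * k < n → d (q * k) = 1 / (((n - q * k : ℕ) : ℝ) + 1) := by
    intro k hk
    have h1 : (shiftMap X)^[q * k] p = p := by
      apply carrier_ext
      intro i
      rw [shiftMap_iterate_apply, periodic_apply hp]
    simp only [d]
    rw [h1, invAgreement_self, sub_zero]
    refine invAgreement_eq (fun i hi => ?_) ?_
    · rw [shiftMap_iterate_apply, hagree _ (by omega), periodic_apply hp]
    · rw [shiftMap_iterate_apply, Nat.add_sub_of_le hk.le]
      rwa [← periodic_apply hp k (n - q * k), Nat.add_sub_of_le hk.le]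
  -- If `σ^j p ≠ p`, the two differ within `q` letters; the orbit of `y` still agrees there, so the
  -- two terms cancel. This can fail only at the last places, where `n < j + q`, and each of these
  -- costs at most 1.
  have hd : ∀ j < n, 0 ≤ d j + if n < j + q then 1 else 0 := by
    intro j hj
    by_cases h : n < j + q
    · rw [if_pos h]
      have h1 := invAgreement_le_one p.1 ((shiftMap X)^[j] p).1
      have h2 := invAgreement_nonneg p.1 ((shiftMap X)^[j] y).1
      simp only [d]; linarith
    · rw [if_neg h, add_zero]
      simp only [d]
      by_cases hjp : (shiftMap X)^[j] p = p
      · rw [hjp, invAgreement_self, sub_zero]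
        exact invAgreement_nonneg _ _
      · have : ∃ i < q, ((shiftMap X)^[j] p).1 i ≠ p.1 i := by
          by_contra! hcon
          refine hjp (iterate_eq_of_agree hq ?_ hp hcon)
          rw [← Function.iterate_add_apply, add_comm, Function.iterate_add_apply, hp]
        rw [sub_nonneg]
        refine (invAgreement_congr (n := q) (fun i hi => ?_) this).le
        rw [shiftMap_iterate_apply, shiftMap_iterate_apply, hagree _ (by omega)]
  -- The multiples of `q` alone give the harmonic sum, indexed by the periods left before the
  -- disagreement at `n`.
  have hsum : ∑ k ∈ Finset.range K, 1 / (2 * q * ((K - 1 - k : ℕ) + 1 : ℝ)) ≤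
      ∑ j ∈ Finset.range n, (d j + if n < j + q then 1 else 0) := by
    refine Finset.sum_le_sum_of_inj (fun k => q * k) (fun k hk => ?_) (fun k _ k' _ h => ?_)
      (fun k hk => ?_) fun j hj => hd j (Finset.mem_range.1 hj)
    · rw [Finset.mem_range] at hk ⊢
      exact (Nat.mul_lt_mul_of_pos_left hk hq).trans_le hKn
    · exact Nat.eq_of_mul_eq_mul_left hq h
    · rw [Finset.mem_range] at hk
      have hlt : q * k < n := (Nat.mul_lt_mul_of_pos_left hk hq).trans_le hKn
      rw [hmul k hlt]
      have h1 : (1 : ℝ) / (2 * q * ((K - 1 - k : ℕ) + 1 : ℝ)) ≤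
          1 / (((n - q * k : ℕ) : ℝ) + 1) := by
        refine one_div_le_one_div_of_le (by positivity) ?_
        have e : K - 1 - k + 1 = K - k := by omega
        have h2 : n - q * k + 1 ≤ 2 * q * (K - 1 - k + 1) := by
          rw [e]
          obtain ⟨a, ha⟩ : ∃ a, K = k + (a + 1) := ⟨K - k - 1, by omega⟩
          rw [ha] at hnK'
          rw [ha, Nat.add_sub_cancel_left]
          ring_nf at hnK' ⊢
          have : q * a ≤ q * a * 2 := by omega
          omega
        exact_mod_cast h2
      have h3 : (0 : ℝ) ≤ if n < q * k + q then 1 else 0 := by split_ifs <;> norm_num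
      linarith
  have hleft : ∑ k ∈ Finset.range K, 1 / (2 * q * ((K - 1 - k : ℕ) + 1 : ℝ)) =
      1 / (2 * q) * ∑ i ∈ Finset.range K, 1 / ((i : ℝ) + 1) := by
    rw [Finset.mul_sum, ← Finset.sum_range_reflect (fun i : ℕ => 1 / (2 * (q : ℝ)) * (1 / ((i : ℝ) + 1)))]
    refine Finset.sum_congr rfl fun k _ => ?_
    rw [one_div_mul_one_div]
  have hmono : ∑ i ∈ Finset.range K₀, 1 / ((i : ℝ) + 1) ≤ ∑ i ∈ Finset.range K, 1 / ((i : ℝ) + 1) :=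
    Finset.sum_le_sum_of_subset_of_nonneg (Finset.range_mono hKK) fun _ _ _ => by positivity
  have hcard : ∑ j ∈ Finset.range n, (if n < j + q then (1 : ℝ) else 0) ≤ q := by
    rw [Finset.sum_boole]
    have : (Finset.range n).filter (fun j => n < j + q) ⊆ Finset.Ico (n - q) n := by
      intro j hj
      simp only [Finset.mem_filter, Finset.mem_range, Finset.mem_Ico] at hj ⊢
      omega
    have h1 := Finset.card_le_card this
    rw [Nat.card_Ico] at h1
    exact_mod_cast (by omega : ((Finset.range n).filter (fun j => n < j + q)).card ≤ q)
  have hw : wordPrefix n p.1 ∈ shiftLanguage X := wordPrefix_mem_shiftLanguage n p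
  have hyw : y ∈ wordCylinder X (wordPrefix n p.1) := by
    rw [mem_wordCylinder_iff_wordPrefix, length_wordPrefix, wordPrefix_eq_iff]
    exact hagree
  have hfin := (abs_le.1 (hV _ hw p (mem_wordCylinder_wordPrefix n p) y hyw)).2
  rw [length_wordPrefix] at hfin
  have heq : birkhoffSum (shiftMap X) (singularPotential X p.1 c) n p -
      birkhoffSum (shiftMap X) (singularPotential X p.1 c) n y =
      c * ∑ j ∈ Finset.range n, d j := by
    unfold birkhoffSum
    rw [← Finset.sum_sub_distrib, Finset.mul_sum]
    refine Finset.sum_congr rfl fun j _ => ?_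
    simp only [singularPotential_apply, d]; ring
  rw [heq] at hfin
  rw [Finset.sum_add_distrib, hleft] at hsum
  have h1 : ∑ j ∈ Finset.range n, d j ≤ V / c := by rw [le_div_iff₀ hc]; linarith
  have h2 : 1 / (2 * (q : ℝ)) * ∑ i ∈ Finset.range K, 1 / ((i : ℝ) + 1) ≤ V / c + q := by linarith
  rw [one_div_mul_eq_div, div_le_iff₀ (by positivity)] at h2
  linarith

variable [Fintype A] [Nonempty X.carrier]

/-- Two words of the same length that can be concatenated freely produce positive pressure. -/
lemma topPressure_zero_pos {a b : List A} (hab : a ≠ b) (hlen : a.length = b.length) {t : ℕ}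
    (hglue : ∀ ws : List (List A), ws ≠ [] → (∀ w ∈ ws, w = a ∨ w = b) →
      ∃ p : X.carrier, Follows X t ws p) :
    0 < topPressure X (0 : C(X.carrier, ℝ)) := by
  classical
  have hU : PrefixFree X (({a, b} : Finset (List A)) : Set (List A)) := by
    rintro u hu v hv ⟨x, hxu, hxv⟩
    have : u.length = v.length := by
      simp only [Finset.coe_insert, Finset.coe_singleton, mem_insert_iff, mem_singleton_iff] at hu hv
      rcases hu with rfl | rfl <;> rcases hv with rfl | rfl <;> simp [hlen]
    exact eq_of_mem_wordCylinder hxu hxv this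
  have h := kraft_inequality (0 : C(X.carrier, ℝ)) {a, b} hU (t := t) (V := 0)
    (fun ws h1 h2 => hglue ws h1 fun w hw => by simpa using h2 w hw)
    (by simp [birkhoffSum])
  have hs : ∀ w, supBirkhoff X (0 : C(X.carrier, ℝ)) w ≥ 0 := by
    intro w
    apply Real.sSup_nonneg
    rintro _ ⟨x, -, rfl⟩
    simp [birkhoffSum]
  rw [Finset.sum_pair hab, norm_zero, mul_zero, add_zero, Real.exp_zero] at h
  -- At nonpositive pressure both terms are at least 1, while their sum is at most 1.
  by_contra! hP
  have h1 : ∀ w : List A, 1 ≤ Real.exp (supBirkhoff X (0 : C(X.carrier, ℝ)) w -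
      (w.length + t) * topPressure X (0 : C(X.carrier, ℝ))) := by
    intro w
    rw [← Real.exp_zero, Real.exp_le_exp]
    have : ((w.length : ℝ) + t) * topPressure X (0 : C(X.carrier, ℝ)) ≤ 0 :=
      mul_nonpos_of_nonneg_of_nonpos (by positivity) hP
    linarith [hs w]
  linarith [h1 a, h1 b]

lemma topPressure_zero_sub_le {φ : C(X.carrier, ℝ)} {c : ℝ} (h : ∀ x, -c ≤ φ x) :
    topPressure X (0 : C(X.carrier, ℝ)) - c ≤ topPressure X φ := by
  refine le_topPressure_of_frequently φ (Eventually.frequently (Eventually.of_forall fun n => ?_))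
  rw [mul_sub, Real.exp_sub, div_le_iff₀ (Real.exp_pos _)]
  refine (exp_topPressure_le (0 : C(X.carrier, ℝ)) n).trans ?_
  rw [partitionSum_eq, partitionSum_eq, Finset.sum_mul]
  refine Finset.sum_le_sum fun w hw => ?_
  obtain ⟨rfl, hwL⟩ := mem_wordsOf.1 hw
  rw [← Real.exp_add, Real.exp_le_exp]
  refine supBirkhoff_le hwL fun x hx => ?_
  have h1 := birkhoffSum_le_supBirkhoff (φ := φ) hx
  have h2 : -(w.length * c) ≤ birkhoffSum (shiftMap X) φ w.length x := by
    unfold birkhoffSum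
    calc -(w.length * c) = ∑ _k ∈ Finset.range w.length, -c := by simp
      _ ≤ _ := Finset.sum_le_sum fun k _ => h _
  have h3 : birkhoffSum (shiftMap X) (0 : C(X.carrier, ℝ)) w.length x = 0 := by simp [birkhoffSum]
  linarith

/-- For a nonpositive potential each word weighs at most one, so it is enough that the number of
words grows more slowly than the pressure. -/
lemma summable_of_card_le {φ : C(X.carrier, ℝ)} (hφ : ∀ x, φ x ≤ 0) {D : Set (List A)}
    (hD : D ⊆ shiftLanguage X) {C ε : ℝ}
    (hcard : ∀ n : ℕ, ((wordsOf D n).card : ℝ) ≤ C * Real.exp (n * ε))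
    (hP : ε < topPressure X φ) :
    Summable fun n : ℕ => partitionSum X D φ (n + 1) *
      Real.exp (-((n + 1 : ℕ) : ℝ) * topPressure X φ) := by
  have hle : ∀ n, partitionSum X D φ n ≤ C * Real.exp (n * ε) := by
    intro n
    refine le_trans ?_ (hcard n)
    rw [partitionSum_eq, ← nsmul_one, ← Finset.sum_const]
    refine Finset.sum_le_sum fun w hw => ?_
    rw [Real.exp_le_one_iff]
    refine supBirkhoff_le (hD (mem_wordsOf.1 hw).2) fun x _ => ?_
    exact Finset.sum_nonpos fun k _ => hφ _
  have hgeo : Summable fun n : ℕ => C * (Real.exp (ε - topPressure X φ)) ^ (n + 1) := by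
    refine Summable.mul_left _ ?_
    exact (summable_nat_add_iff 1).2 (summable_geometric_of_lt_one (Real.exp_pos _).le
      (by rw [Real.exp_lt_one_iff]; linarith))
  refine hgeo.of_nonneg_of_le
    (fun n => mul_nonneg (partitionSum_nonneg _ _ _) (Real.exp_pos _).le) fun n => ?_
  refine (mul_le_mul_of_nonneg_right (hle (n + 1)) (Real.exp_pos _).le).trans (le_of_eq ?_)
  rw [mul_assoc, ← Real.exp_add, ← Real.exp_nat_mul]
  congr 2
  ring

end SingularPotential

/-! ### Shifts with the specification property -/

section Specification

variable {A : Type*} [TopologicalSpace A] {X : Subshift A ℕ}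

lemma append_left_mem {u v w : List A} (h : u ++ v ++ w ∈ shiftLanguage X) :
    v ∈ shiftLanguage X := (shiftLanguage_of_append (shiftLanguage_of_append h).1).2

lemma getElem_flatten_replicate {W : List A} {k i : ℕ}
    (h : i < (List.replicate k W).flatten.length) (h' : i % W.length < W.length) :
    (List.replicate k W).flatten[i] = W[i % W.length] := by
  induction k generalizing i with
  | zero => simp at h
  | succ k ih =>
    simp only [List.replicate_succ, List.flatten_cons] at h ⊢
    by_cases hi : i < W.length
    · rw [List.getElem_append_left hi]
      simp only [Nat.mod_eq_of_lt hi]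
    · rw [List.getElem_append_right (by omega)]
      rw [List.length_append] at h
      have e : (i - W.length) % W.length = i % W.length := by
        rw [← Nat.mod_eq_sub_mod (by omega)]
      rw [ih (by omega) (by rw [e]; exact h')]
      simp only [e]

/-- A word whose powers all lie in the language spans a periodic point. -/
lemma exists_periodic_of_powers [DiscreteTopology A] {W : List A} (hW : W ≠ [])
    (h : ∀ k : ℕ, (List.replicate k W).flatten ∈ shiftLanguage X) :
    ∃ p ∈ wordCylinder X W, (shiftMap X)^[W.length] p = p := by
  have hpos : 0 < W.length := List.length_pos_iff.2 hW
  set x : ℕ → A := fun i => W[i % W.length]'(Nat.mod_lt _ hpos)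
  have hx : x ∈ X.carrier := by
    refine mem_carrier_of_wordPrefix fun n => ?_
    have h1 := h n
    have e : (List.replicate n W).flatten = wordPrefix (n * W.length) x := by
      apply List.ext_getElem (by simp)
      intro i h1 h2
      rw [getElem_flatten_replicate h1 (Nat.mod_lt _ hpos)]
      simp [wordPrefix, x]
    rw [e] at h1
    have e2 : n * W.length = n + (n * W.length - n) := by
      have := Nat.le_mul_of_pos_right n hpos
      omega
    rw [e2, wordPrefix_add] at h1
    exact (shiftLanguage_of_append h1).1
  refine ⟨⟨x, hx⟩, mem_wordCylinder.2 fun i hi => ?_, carrier_ext fun i => ?_⟩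
  · simp only [x, Nat.mod_eq_of_lt hi]
  · rw [shiftMap_iterate_apply]
    simp only [x, Nat.add_mod_left]

lemma HasSpecification.exists_connector (h : HasSpecification X) :
    ∃ t : ℕ, ∀ u ∈ shiftLanguage X, ∀ w ∈ shiftLanguage X,
      ∃ v : List A, v.length = t ∧ u ++ v ++ w ∈ shiftLanguage X := by
  obtain ⟨t, ht⟩ := h
  refine ⟨t, fun u hu w hw => ?_⟩
  obtain ⟨v, hv, hg⟩ := ht 1 ![u, w] (fun i => by fin_cases i <;> simpa)
  refine ⟨v 0, (hv 0).2, ?_⟩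
  simpa [glue] using hg

/-- A shift with specification has a synchronizing word. -/
lemma exists_synchronizing [Finite A] [Nonempty X.carrier] {t : ℕ}
    (h : ∀ u ∈ shiftLanguage X, ∀ w ∈ shiftLanguage X,
      ∃ v : List A, v.length = t ∧ u ++ v ++ w ∈ shiftLanguage X) :
    ∃ s ∈ shiftLanguage X, ∀ x y : List A, x ++ s ∈ shiftLanguage X → s ++ y ∈ shiftLanguage X →
      x ++ s ++ y ∈ shiftLanguage X := by
  classical
  -- The connectors of length `t`. Extending `u` to the left or `w` to the right can only remove
  -- connectors, so for a pair with the fewest of them none is ever lost, and `u ++ v ++ w`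
  -- synchronizes.
  set C : List A → List A → Set (List A) := fun u w =>
    {v | v.length = t ∧ u ++ v ++ w ∈ shiftLanguage X}
  have hfin : ∀ u w, (C u w).Finite := fun u w =>
    (List.finite_length_eq A t).subset fun v hv => hv.1
  have hnil : ([] : List A) ∈ shiftLanguage X := by
    obtain ⟨x⟩ := ‹Nonempty X.carrier›
    exact wordPrefix_mem_shiftLanguage 0 x
  have hex : ∃ n, ∃ u ∈ shiftLanguage X, ∃ w ∈ shiftLanguage X, (C u w).ncard = n :=
    ⟨_, [], hnil, [], hnil, rfl⟩
  obtain ⟨u, hu, w, hw, hn⟩ := Nat.find_spec hex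
  obtain ⟨v, hv⟩ := h u hu w hw
  refine ⟨u ++ v ++ w, hv.2, fun x y hx hy => ?_⟩
  have hxu : x ++ u ∈ shiftLanguage X := by
    rw [List.append_assoc, ← List.append_assoc] at hx
    exact (shiftLanguage_of_append hx).1
  have hwy : w ++ y ∈ shiftLanguage X := by
    rw [List.append_assoc] at hy
    exact (shiftLanguage_of_append hy).2
  have hsub : C (x ++ u) (w ++ y) ⊆ C u w := by
    rintro v' ⟨h1, h2⟩
    refine ⟨h1, ?_⟩
    have : x ++ (u ++ v' ++ w) ++ y ∈ shiftLanguage X := by simpa using h2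
    exact append_left_mem this
  have hle : (C u w).ncard ≤ (C (x ++ u) (w ++ y)).ncard := by
    rw [hn]
    exact Nat.find_min' hex ⟨_, hxu, _, hwy, rfl⟩
  have heq := Set.eq_of_subset_of_ncard_le hsub hle (hfin u w)
  have hv' : v ∈ C (x ++ u) (w ++ y) := heq ▸ hv
  simpa using hv'.2

/-- Consecutive blocks `b u a s` are the glued word with gaps `a s b`, up to pieces at the two ends.
-/
lemma flatten_ofFn_blocks (a b : List A → List A) (s : List A) {m : ℕ}
    (w : Fin (m + 1) → List A) :
    (List.ofFn fun i => b (w i) ++ w i ++ a (w i) ++ s).flatten =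
      b (w 0) ++ glue w (fun i : Fin m => a (w i.castSucc) ++ s ++ b (w i.succ)) ++
        a (w (Fin.last m)) ++ s := by
  induction m with
  | zero => simp [glue_zero]
  | succ m ih =>
    rw [List.ofFn_succ, List.flatten_cons, ih (fun i => w i.succ), glue_succ]
    simp only [List.append_assoc, Fin.castSucc_zero, Fin.succ_castSucc, Fin.succ_last]

lemma flatten_replicate_conj {U W b : List A} (h : U ++ b = b ++ W) (k : ℕ) :
    (List.replicate k U).flatten ++ b = b ++ (List.replicate k W).flatten := by
  induction k with
  | zero => simp
  | succ k ih =>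
    rw [List.replicate_succ, List.flatten_cons, List.append_assoc, ih, ← List.append_assoc, h,
      List.append_assoc, List.replicate_succ, List.flatten_cons]

/-- Specification of the whole language implies periodic specification. -/
theorem HasSpecification.hasPerSpecificationOn [DiscreteTopology A] [Finite A]
    [Nonempty X.carrier] (h : HasSpecification X) :
    HasPerSpecificationOn X (shiftLanguage X) := by
  obtain ⟨t, ht⟩ := h.exists_connector
  obtain ⟨s, hs, hsync⟩ := exists_synchronizing ht
  have hab : ∀ u ∈ shiftLanguage X, ∃ a b : List A, a.length = t ∧ b.length = t ∧
      s ++ b ++ u ++ a ++ s ∈ shiftLanguage X := by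
    intro u hu
    obtain ⟨b, hb, h1⟩ := ht s hs u hu
    obtain ⟨a, ha, h2⟩ := ht _ h1 s hs
    exact ⟨a, b, ha, hb, h2⟩
  choose! a b ha hb hblock using hab
  -- A block may start wherever `s` has just been read, and it ends with `s`; synchronization
  -- therefore chains blocks freely.
  set B : List A → List A := fun u => b u ++ u ++ a u ++ s
  have hchain : ∀ us : List (List A), (∀ u ∈ us, u ∈ shiftLanguage X) → ∀ x : List A,
      x ++ s ∈ shiftLanguage X → ∃ y, x ++ s ++ (us.map B).flatten = y ++ s ∧
        x ++ s ++ (us.map B).flatten ∈ shiftLanguage X := by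
    intro us
    induction us with
    | nil => intro _ x hx; exact ⟨x, by simp, by simpa using hx⟩
    | cons u us ih =>
      intro hus x hx
      have h1 := hsync x (B u) hx (by
        simpa [B] using hblock u (hus u (by simp)))
      obtain ⟨y, h2, h3⟩ := ih (fun v hv => hus v (by simp [hv])) (x ++ s ++ b u ++ u ++ a u)
        (by simpa [B] using h1)
      refine ⟨y, ?_, ?_⟩
      · rw [← h2]; simp [B]
      · simpa [B] using h3
  have hflat : ∀ us : List (List A), (∀ u ∈ us, u ∈ shiftLanguage X) →
      (us.map B).flatten ∈ shiftLanguage X := by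
    intro us hus
    obtain ⟨-, -, h1⟩ := hchain us hus [] (by simpa using hs)
    exact (shiftLanguage_of_append h1).2
  refine ⟨t + s.length + t, fun m w hw => ?_⟩
  set v : Fin m → List A := fun i => a (w i.castSucc) ++ s ++ b (w i.succ)
  -- The glued word closed by one more gap. It is a rotation of the product `U` of blocks, so its
  -- powers occur inside chains of blocks.
  set W := glue w v ++ (a (w (Fin.last m)) ++ s ++ b (w 0))
  set U := ((List.ofFn w).map B).flatten
  have hUW : U ++ b (w 0) = b (w 0) ++ W := by
    have := flatten_ofFn_blocks a b s w
    simp only [U, W, List.map_ofFn]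
    rw [show B ∘ w = fun i => b (w i) ++ w i ++ a (w i) ++ s from rfl, this]
    simp [v]
  have hmem : ∀ u ∈ List.ofFn w, u ∈ shiftLanguage X := by
    intro u hu
    obtain ⟨i, rfl⟩ := (List.mem_ofFn' _ _).1 hu
    exact hw i
  have hpow : ∀ k : ℕ, (List.replicate k W).flatten ∈ shiftLanguage X := by
    intro k
    have h1 := hflat ((List.replicate k (List.ofFn w)).flatten ++ [w 0]) (by
      intro u hu
      simp only [List.mem_append, List.mem_flatten, List.mem_replicate, List.mem_singleton] at hu
      rcases hu with ⟨l, ⟨-, rfl⟩, hl⟩ | rfl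
      exacts [hmem u hl, hw 0])
    have e : (((List.replicate k (List.ofFn w)).flatten ++ [w 0]).map B).flatten =
        b (w 0) ++ (List.replicate k W).flatten ++ (w 0 ++ a (w 0) ++ s) := by
      rw [← flatten_replicate_conj hUW]
      have : (((List.replicate k (List.ofFn w)).flatten).map B).flatten =
          (List.replicate k U).flatten := by
        clear h1 hUW
        induction k with
        | zero => simp
        | succ k ih =>
          rw [List.replicate_succ, List.flatten_cons, List.map_append, List.flatten_append, ih,
            List.replicate_succ, List.flatten_cons]
      rw [List.map_append, List.flatten_append, this]
      simp [B]
    rw [e] at h1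
    exact append_left_mem h1
  have hWL : W ∈ shiftLanguage X := by simpa using hpow 1
  have hgL : glue w v ∈ shiftLanguage X := (shiftLanguage_of_append hWL).1
  have hlen : W.length = (glue w v).length + (t + s.length + t) := by
    simp only [W, List.length_append, ha _ (hw _), hb _ (hw _)]
  refine ⟨v, fun i => ⟨?_, ?_⟩, hgL, ?_⟩
  · have h1 := hflat [w i.castSucc, w i.succ] (by simp [hw])
    have e : ([w i.castSucc, w i.succ].map B).flatten = (b (w i.castSucc) ++ w i.castSucc) ++ v i ++
        (w i.succ ++ a (w i.succ) ++ s) := by simp [B, v]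
    rw [e] at h1
    exact append_left_mem h1
  · simp only [v, List.length_append, ha _ (hw _), hb _ (hw _)]
  · by_cases hWn : W = []
    · obtain ⟨p, hp⟩ := hgL
      refine ⟨p, hp, ?_⟩
      rw [← hlen, hWn]; rfl
    · obtain ⟨p, hp, hper⟩ := exists_periodic_of_powers hWn hpow
      refine ⟨p, (mem_wordCylinder_append.1 hp).1, ?_⟩
      rw [← hlen]; exact hper

variable [DiscreteTopology A] [Fintype A] [MeasurableSpace A] [DiscreteMeasurableSpace A]

/-- The whole language serves as `G`; the outer collections contain only the empty word, which the
sum over `n ≥ 1` does not see. -/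
theorem HasSpecification.hasUniqueGibbsState_of_hasBowen [Nonempty X.carrier]
    (h : HasSpecification X) {φ : C(X.carrier, ℝ)} (hφ : HasBowen X φ) :
    HasUniqueGibbsState X φ := by
  have hnil : ([] : List A) ∈ shiftLanguage X := by
    obtain ⟨x⟩ := ‹Nonempty X.carrier›
    exact wordPrefix_mem_shiftLanguage 0 x
  refine IsGoodDecomposition.hasUniqueGibbsState (Cp := {[]}) (G := shiftLanguage X) (Cs := {[]})
    ⟨⟨by simpa, le_rfl, by simpa, fun z hz => ⟨[], rfl, z, hz, [], rfl, by simp⟩⟩,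
      fun M => h.hasPerSpecificationOn.mono (fattened_subset M), hφ, ?_⟩
  have : ∀ n : ℕ, partitionSum X ({[]} ∪ {[]}) φ (n + 1) = 0 := by
    intro n
    rw [partitionSum_eq]
    apply Finset.sum_eq_zero
    intro w hw
    obtain ⟨h1, h2⟩ := mem_wordsOf.1 hw
    simp only [union_self, mem_singleton_iff] at h2
    simp [h2] at h1
  simp only [this, zero_mul]
  exact summable_zero

/-- The words all of whose suffixes longer than `q` leave the orbit of `p`. -/
def leavingWords (X : Subshift A ℕ) (p : ℕ → A) (q : ℕ) : Set (List A) :=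
  {w | w ∈ shiftLanguage X ∧ ∀ x ∈ wordCylinder X w, ∀ j, j + q < w.length →
    ∃ i, j + i < w.length ∧ x.1 (j + i) ≠ p i}

/-- Let `k` be the first place from which the word follows `p` to its end, and cut `q` letters
later. If a tail from `j < k` followed `p` up to the cut, then `σ^(k-j) p` would agree with `p` on a
full period and equal it, so the word would follow `p` already from `j`. -/
lemma exists_leavingWords_decomposition {p : X.carrier} {q : ℕ} (hq : 0 < q)
    (hp : (shiftMap X)^[q] p = p) {z : List A} (hz : z ∈ shiftLanguage X) :
    ∃ v ∈ leavingWords X p.1 q, ∃ n, z = v ++ wordPrefix n p.1 := by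
  classical
  obtain ⟨x, hx⟩ := hz
  rw [mem_wordCylinder_iff_wordPrefix] at hx
  set n := z.length
  have hex : ∃ k, ∀ i, k + i < n → x.1 (k + i) = p.1 i := ⟨n, fun i hi => by omega⟩
  set k := Nat.find hex
  have hk : ∀ i, k + i < n → x.1 (k + i) = p.1 i := Nat.find_spec hex
  have hmin : ∀ j < k, ∃ i, j + i < n ∧ x.1 (j + i) ≠ p.1 i := by
    intro j hj
    have := Nat.find_min hex hj
    push Not at this
    exact this
  have hagree : ∀ m, ∀ y ∈ wordCylinder X (wordPrefix m x.1), ∀ i < m, y.1 i = x.1 i := by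
    intro m y hy
    rwa [mem_wordCylinder_iff_wordPrefix, length_wordPrefix, wordPrefix_eq_iff] at hy
  rcases le_or_gt n (k + q) with hle | hlt
  · refine ⟨z, ⟨⟨x, mem_wordCylinder_iff_wordPrefix.2 hx⟩, fun y hy j hj => ?_⟩, 0, by
      simp [wordPrefix]⟩
    obtain ⟨i, hi, hne⟩ := hmin j (by omega)
    rw [← hx] at hy
    exact ⟨i, hi, by rwa [hagree n y hy _ hi]⟩
  · refine ⟨wordPrefix (k + q) x.1, ⟨wordPrefix_mem_shiftLanguage _ _, fun y hy j hj => ?_⟩,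
      n - (k + q), ?_⟩
    · rw [length_wordPrefix] at hj ⊢
      by_contra! hcon
      have hj' : j < k := by omega
      have hper : (shiftMap X)^[k - j] p = p := by
        refine iterate_eq_of_agree hq ?_ hp fun i hi => ?_
        · rw [← Function.iterate_add_apply, add_comm, Function.iterate_add_apply, hp]
        · rw [shiftMap_iterate_apply]
          have h1 := hcon (k - j + i) (by omega)
          rw [hagree _ y hy _ (by omega)] at h1
          have e : j + (k - j + i) = k + i := by omega
          rw [← h1, e, hk i (by omega)]
      obtain ⟨i, hi, hne⟩ := hmin j hj'
      apply hne
      rcases lt_or_ge (j + i) (k + q) with h1 | h1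
      · rw [← hcon i h1, hagree _ y hy _ h1]
      · obtain ⟨l, rfl⟩ : ∃ l, i = k - j + l := ⟨i - (k - j), by omega⟩
        have e : j + (k - j + l) = k + l := by omega
        rw [e, hk l (by omega)]
        conv_lhs => rw [← hper]
        rw [shiftMap_iterate_apply]
    · rw [← hx]
      have e : n = (k + q) + (n - (k + q)) := by omega
      conv_lhs => rw [e, wordPrefix_add]
      congr 1
      rw [wordPrefix_eq_iff]
      intro i hi
      rw [add_assoc, hk (q + i) (by omega)]
      simpa using periodic_apply hp 1 i

/-- A non-trivial shift with specification carries a potential without the Bowen property that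
admits a good decomposition. -/
theorem HasSpecification.exists_not_hasBowen (h : HasSpecification X)
    (hX : X.carrier.Nontrivial) :
    ∃ φ : C(X.carrier, ℝ), ¬ HasBowen X φ ∧ HasUniqueGibbsState X φ := by
  obtain ⟨x, hx, y, hy, hxy⟩ := hX
  have : Nonempty X.carrier := ⟨⟨x, hx⟩⟩
  have hper := h.hasPerSpecificationOn
  obtain ⟨t, ht⟩ := hper.gluesPer
  obtain ⟨n, hn⟩ : ∃ n, x n ≠ y n := Function.ne_iff.1 hxy
  set a := wordPrefix (n + 1) x
  set b := wordPrefix (n + 1) y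
  have haL : a ∈ shiftLanguage X := wordPrefix_mem_shiftLanguage (n + 1) ⟨x, hx⟩
  have hbL : b ∈ shiftLanguage X := wordPrefix_mem_shiftLanguage (n + 1) ⟨y, hy⟩
  have hab : a ≠ b := fun hab => hn (wordPrefix_eq_iff.1 hab n (by omega))
  have hlen : a.length = b.length := by simp [a, b]
  have hP0 : 0 < topPressure X (0 : C(X.carrier, ℝ)) := by
    refine topPressure_zero_pos hab hlen (t := t) fun ws h1 h2 => ?_
    obtain ⟨p, hp, -⟩ := ht ws h1 fun w hw => by rcases h2 w hw with rfl | rfl <;> assumption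
    exact ⟨p, hp⟩
  obtain ⟨p, -, hp⟩ := ht [a] (by simp) (by simpa)
  set q := gapLength t [a]
  have hq : 0 < q := by simp [q, gapLength, a]
  -- Since the potential is at least `-c`, its pressure is at least `c > 0`, while `Cp ∪ Cs` has at
  -- most one word of each length.
  set c := topPressure X (0 : C(X.carrier, ℝ)) / 2
  have hc : 0 < c := by positivity
  set φ := singularPotential X p.1 c
  refine ⟨φ, not_hasBowen_singularPotential hq hp (fun N => ?_) hc, ?_⟩
  -- `p` is not isolated: its prefix can be continued by `a` or by `b`, and at most one of these
  -- points is `p`.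
  · have hN : wordPrefix N p.1 ∈ shiftLanguage X := wordPrefix_mem_shiftLanguage N p
    obtain ⟨ya, ⟨h1, h2, -⟩, -⟩ := ht [wordPrefix N p.1, a] (by simp) (by simp [hN, haL])
    obtain ⟨yb, ⟨h3, h4, -⟩, -⟩ := ht [wordPrefix N p.1, b] (by simp) (by simp [hN, hbL])
    rw [mem_wordCylinder_iff_wordPrefix, length_wordPrefix, wordPrefix_eq_iff] at h1 h3
    by_cases hya : ya = p
    · refine ⟨yb, fun hyb => hab ?_, h3⟩
      rw [hya] at h2; rw [hyb] at h4
      exact eq_of_mem_wordCylinder h2 h4 hlen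
    · exact ⟨ya, hya, h1⟩
  have hpre : ∀ n, wordPrefix n p.1 ∈ shiftLanguage X := fun n => wordPrefix_mem_shiftLanguage n p
  have hnil : ([] : List A) ∈ shiftLanguage X := hpre 0
  set Cs : Set (List A) := range fun n => wordPrefix n p.1
  refine IsGoodDecomposition.hasUniqueGibbsState (Cp := {[]}) (G := leavingWords X p.1 q)
    (Cs := Cs) ⟨⟨by simpa, fun w hw => hw.1, ?_, fun z hz => ?_⟩,
      fun M => hper.mono (fattened_subset M),
      hasBowenOn_singularPotential q fun w hw => hw.2, ?_⟩
  · rintro _ ⟨n, rfl⟩; exact hpre n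
  · obtain ⟨v, hv, n, hz'⟩ := exists_leavingWords_decomposition hq hp hz
    exact ⟨[], rfl, v, hv, _, ⟨n, rfl⟩, by simpa using hz'⟩
  · refine summable_of_card_le (singularPotential_nonpos hc.le) (C := 1) (ε := 0) ?_
      (fun n => ?_) ?_
    · rintro w (rfl | ⟨n, rfl⟩)
      exacts [hnil, hpre n]
    · have : wordsOf ({[]} ∪ Cs) n ⊆ {wordPrefix n p.1} := by
        intro w hw
        obtain ⟨rfl, h2⟩ := mem_wordsOf.1 hw
        rw [Finset.mem_singleton]
        rcases h2 with rfl | ⟨m, rfl⟩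
        · rfl
        · simp
      have h1 := Finset.card_le_card this
      rw [Finset.card_singleton] at h1
      simpa using (by exact_mod_cast h1 : ((wordsOf ({[]} ∪ Cs) n).card : ℝ) ≤ 1)
    · have := topPressure_zero_sub_le (φ := φ) (le_singularPotential (p := p.1) hc.le)
      have : topPressure X (0 : C(X.carrier, ℝ)) = c + c := by simp only [c]; ring
      linarith

end Specification

/-! ### Lexicographically defined shifts -/

section LexShift

variable {b : ℕ} {X : Subshift (Fin b) ℕ} {w : ℕ → Fin b}

/-- `X` consists of the sequences all of whose tails are lexicographically at most `w`; here `w`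
itself lies in `X`, starts with a nonzero digit and does not end in zeros. -/
structure IsLexShift (X : Subshift (Fin b) ℕ) (w : ℕ → Fin b) : Prop where
  mem_iff : ∀ x : ℕ → Fin b, x ∈ X.carrier ↔
    ∀ k n, (∀ i < n, x (k + i) = w i) → x (k + n) ≤ w n
  self_mem : w ∈ X.carrier
  head_pos : 0 < (w 0 : ℕ)
  exists_pos : ∀ n, ∃ m ≥ n, 0 < (w m : ℕ)

/-- The sequence that starts with the word `v` and continues with `x`. -/
def prependWord {A : Type*} (v : List A) (x : ℕ → A) : ℕ → A :=
  fun i => if h : i < v.length then v[i] else x (i - v.length)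

lemma prependWord_of_lt {A : Type*} {v : List A} {x : ℕ → A} {i : ℕ} (h : i < v.length) :
    prependWord v x i = v[i] := dif_pos h

lemma prependWord_add {A : Type*} (v : List A) (x : ℕ → A) (i : ℕ) :
    prependWord v x (v.length + i) = x i := by
  simp [prependWord]

/-- The words in which every suffix is seen to be lexicographically strictly smaller than `w`. -/
def lexFree (w : ℕ → Fin b) : Set (List (Fin b)) :=
  {v | ∀ j < v.length, ∃ i, ∃ h : j + i < v.length, v[j + i] < w i ∧
    ∀ l, ∀ hl : l < i, v[j + l] = w l}

lemma nil_mem_lexFree : [] ∈ lexFree w := fun j hj => by simp at hj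

/-- The comparison of each suffix with `w` is decided inside its own factor, so appending further
letters cannot disturb it. -/
lemma append_mem_lexFree {u v : List (Fin b)} (hu : u ∈ lexFree w) (hv : v ∈ lexFree w) :
    u ++ v ∈ lexFree w := by
  intro j hj
  rw [List.length_append] at hj
  rcases lt_or_ge j u.length with h | h
  · obtain ⟨i, hi, h1, h2⟩ := hu j h
    refine ⟨i, by rw [List.length_append]; omega, ?_, fun l hl => ?_⟩
    · rwa [List.getElem_append_left hi]
    · rw [List.getElem_append_left (by omega)]
      exact h2 l hl
  · obtain ⟨j, rfl⟩ : ∃ j', j = u.length + j' := ⟨j - u.length, by omega⟩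
    obtain ⟨i, hi, h1, h2⟩ := hv j (by omega)
    refine ⟨i, by rw [List.length_append]; omega, ?_, fun l hl => ?_⟩
    · rw [List.getElem_append_right (by omega)]
      simpa only [add_assoc, Nat.add_sub_cancel_left] using h1
    · rw [List.getElem_append_right (by omega)]
      simpa only [add_assoc, Nat.add_sub_cancel_left] using h2 l hl

lemma flatten_mem_lexFree {ws : List (List (Fin b))} (h : ∀ u ∈ ws, u ∈ lexFree w) :
    ws.flatten ∈ lexFree w := by
  induction ws with
  | nil => exact nil_mem_lexFree
  | cons u ws ih =>
    rw [List.flatten_cons]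
    exact append_mem_lexFree (h u (by simp)) (ih fun v hv => h v (by simp [hv]))

lemma follows_zero_of_mem_flatten {A : Type*} [TopologicalSpace A] {X : Subshift A ℕ}
    {ws : List (List A)} {p : X.carrier} (hp : p ∈ wordCylinder X ws.flatten) :
    Follows X 0 ws p := by
  induction ws generalizing p with
  | nil => trivial
  | cons u ws ih =>
    rw [List.flatten_cons, mem_wordCylinder_append] at hp
    exact ⟨hp.1, ih hp.2⟩

namespace IsLexShift

variable (hX : IsLexShift X w)
include hX

/-- A tail that starts inside `v` falls strictly below `w` within `v`; the other tails are tails of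
`x`. -/
lemma prependWord_mem {v : List (Fin b)} (hv : v ∈ lexFree w) {x : ℕ → Fin b}
    (hx : x ∈ X.carrier) : prependWord v x ∈ X.carrier := by
  rw [hX.mem_iff] at hx ⊢
  intro k n h
  rcases lt_or_ge k v.length with hk | hk
  · obtain ⟨i, hi, h1, h2⟩ := hv k hk
    rcases lt_trichotomy n i with hn | rfl | hn
    · rw [prependWord_of_lt (by omega), h2 n hn]
    · rw [prependWord_of_lt hi]; exact h1.le
    · have := h i hn
      rw [prependWord_of_lt hi] at this
      exact absurd this h1.ne
  · obtain ⟨k, rfl⟩ : ∃ k', k = v.length + k' := ⟨k - v.length, by omega⟩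
    simp only [add_assoc, prependWord_add] at h ⊢
    exact hx k n h

lemma nonempty : Nonempty X.carrier := ⟨⟨w, hX.self_mem⟩⟩

lemma append_wordPrefix_mem {v : List (Fin b)} (hv : v ∈ lexFree w) (x : X.carrier) (n : ℕ) :
    v ++ wordPrefix n x.1 ∈ shiftLanguage X := by
  refine ⟨⟨prependWord v x.1, hX.prependWord_mem hv x.2⟩, mem_wordCylinder_append.2 ⟨?_, ?_⟩⟩
  · exact mem_wordCylinder.2 fun i hi => prependWord_of_lt hi
  · rw [mem_wordCylinder_iff_wordPrefix, length_wordPrefix, wordPrefix_eq_iff]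
    intro i _
    rw [shiftMap_iterate_apply]
    exact prependWord_add _ _ _

lemma lexFree_subset : lexFree w ⊆ shiftLanguage X := fun _ hv =>
  (shiftLanguage_of_append (hX.append_wordPrefix_mem hv ⟨w, hX.self_mem⟩ 0)).1

lemma shift_le {k n : ℕ} (h : ∀ i < n, w (k + i) = w i) : w (k + n) ≤ w n :=
  (hX.mem_iff w).1 hX.self_mem k n h

/-- Every word of the language is a free word followed by a prefix of `w`; the free part contains
any given free prefix. -/
lemma exists_decomposition {z : List (Fin b)} (hz : z ∈ shiftLanguage X) :
    ∃ v ∈ lexFree w, ∃ n, z = v ++ wordPrefix n w ∧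
      ∀ g ∈ lexFree w, ∀ s, z = g ++ s → n ≤ s.length := by
  classical
  obtain ⟨x, hx⟩ := hz
  rw [mem_wordCylinder_iff_wordPrefix] at hx
  set n := z.length
  have hxX := (hX.mem_iff x.1).1 x.2
  have hex : ∃ k, ∀ i, k + i < n → x.1 (k + i) = w i := ⟨n, fun i hi => by omega⟩
  -- The first place from which the word follows `w` to its end.
  set k := Nat.find hex
  have hk : ∀ i, k + i < n → x.1 (k + i) = w i := Nat.find_spec hex
  have hkn : k ≤ n := Nat.find_min' hex fun i hi => by omega
  refine ⟨wordPrefix k x.1, fun j hj => ?_, n - k, ?_, fun g hg s hs => ?_⟩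
  · rw [length_wordPrefix] at hj
    have h1 := Nat.find_min hex hj
    push Not at h1
    set i := Nat.find h1
    have hi : j + i < n ∧ x.1 (j + i) ≠ w i := Nat.find_spec h1
    have hagree : ∀ l < i, x.1 (j + l) = w l := by
      intro l hl
      have h2 := Nat.find_min h1 hl
      push Not at h2
      exact h2 (by omega)
    have hlt : x.1 (j + i) < w i := lt_of_le_of_ne (hxX j i hagree) hi.2
    have hik : j + i < k := by
      -- Beyond `k` the comparison would be between `w` and a tail of `w` that has matched so far;
      -- since that tail is at most `w`, the strict inequality is impossible.
      by_contra! hge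
      obtain ⟨e, he⟩ : ∃ e, j + i = k + e := ⟨j + i - k, by omega⟩
      have hie : i = k - j + e := by omega
      have h3 : w (k - j + e) ≤ w e := by
        refine hX.shift_le fun a ha => ?_
        have e1 : j + (k - j + a) = k + a := by omega
        rw [← hagree (k - j + a) (by omega), e1, hk a (by omega)]
      rw [he, hk e (by omega), hie] at hlt
      exact absurd hlt (not_lt.2 h3)
    refine ⟨i, by rw [length_wordPrefix]; exact hik, ?_, fun l hl => ?_⟩
    · simpa [wordPrefix] using hlt
    · simpa [wordPrefix] using hagree l hl
  · rw [← hx]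
    have e : n = k + (n - k) := by omega
    conv_lhs => rw [e, wordPrefix_add]
    congr 1
    rw [wordPrefix_eq_iff]
    intro i hi
    exact hk i (by omega)
  · have hn : n = g.length + s.length := by simp [n, hs]
    -- Otherwise `k` lies inside `g`, which falls strictly below `w` from there.
    by_contra! hlt
    obtain ⟨i, hi, h1, -⟩ := hg k (by omega)
    have hgx : x ∈ wordCylinder X g := by
      have : x ∈ wordCylinder X z := mem_wordCylinder_iff_wordPrefix.2 hx
      rw [hs] at this
      exact (mem_wordCylinder_append.1 this).1
    rw [← mem_wordCylinder.1 hgx, hk i (by omega)] at h1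
    exact h1.false

variable [NeZero b]

lemma zero_lt_head : 0 < w 0 := Fin.lt_def.2 hX.head_pos

lemma replicate_zero_mem_lexFree (k : ℕ) : List.replicate k (0 : Fin b) ∈ lexFree w := by
  intro j hj
  refine ⟨0, hj, ?_, fun l hl => by omega⟩
  simpa using hX.zero_lt_head

lemma zero_mem : (fun _ => 0 : ℕ → Fin b) ∈ X.carrier := by
  rw [hX.mem_iff]
  intro k n _
  exact Fin.zero_le _

/-- A bounded number of zeros makes a prefix of `w` of bounded length free. -/
lemma exists_gap (M : ℕ) : ∃ t : ℕ, ∀ n ≤ M,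
    wordPrefix n w ++ List.replicate t (0 : Fin b) ∈ lexFree w := by
  -- A nonzero digit of `w` opposite a padded zero decides the comparison.
  have h : ∀ n, ∃ t, ∃ m, n ≤ m ∧ m < n + t ∧ 0 < w m := by
    intro n
    obtain ⟨m, hm, h1⟩ := hX.exists_pos n
    exact ⟨m - n + 1, m, hm, by omega, Fin.lt_def.2 h1⟩
  choose t ht using h
  refine ⟨∑ n ∈ Finset.range (M + 1), t n, fun n hn => ?_⟩
  set T := ∑ n ∈ Finset.range (M + 1), t n
  have hT : ∀ i ≤ M, ∃ m, i ≤ m ∧ m < i + T ∧ 0 < w m := by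
    intro i hi
    obtain ⟨m, h1, h2, h3⟩ := ht i
    have : t i ≤ T := Finset.single_le_sum (f := t) (fun _ _ => Nat.zero_le _)
      (Finset.mem_range.2 (by omega))
    exact ⟨m, h1, by omega, h3⟩
  set y : ℕ → Fin b := fun i => if i < n then w i else 0
  have hy : wordPrefix n w ++ List.replicate T (0 : Fin b) = wordPrefix (n + T) y := by
    rw [wordPrefix_add]
    congr 1
    · rw [wordPrefix_eq_iff]
      intro i hi
      simp [y, hi]
    · apply List.ext_getElem (by simp)
      intro i h1 h2
      simp [wordPrefix, y]
  rw [hy]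
  intro j hj
  rw [length_wordPrefix] at hj
  suffices h : ∃ i, j + i < n + T ∧ y (j + i) < w i ∧ ∀ l < i, y (j + l) = w l by
    obtain ⟨i, h1, h2, h3⟩ := h
    refine ⟨i, by rwa [length_wordPrefix], by simpa [wordPrefix] using h2, fun l hl => ?_⟩
    simpa [wordPrefix] using h3 l hl
  rcases lt_or_ge j n with hjn | hjn
  · classical
    have hex : ∃ i, j + i < n + T ∧ y (j + i) ≠ w i := by
      obtain ⟨m, h1, h2, h3⟩ := hT (n - j) (by omega)
      refine ⟨m, by omega, ?_⟩
      have : y (j + m) = 0 := if_neg (by omega)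
      rw [this]
      exact h3.ne
    obtain ⟨h1, h2⟩ := Nat.find_spec hex
    have hmin : ∀ l < Nat.find hex, y (j + l) = w l := by
      intro l hl
      by_contra hne
      exact Nat.find_min hex hl ⟨by omega, hne⟩
    refine ⟨Nat.find hex, h1, lt_of_le_of_ne ?_ h2, hmin⟩
    rcases lt_or_ge (j + Nat.find hex) n with h3 | h3
    · have : y (j + Nat.find hex) = w (j + Nat.find hex) := if_pos h3
      rw [this]
      refine hX.shift_le fun i hi => ?_
      rw [← hmin i hi]
      exact (if_pos (by omega)).symm
    · have : y (j + Nat.find hex) = 0 := if_neg (by omega)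
      rw [this]
      exact Fin.zero_le _
  · refine ⟨0, hj, ?_, fun l hl => by omega⟩
    have : y (j + 0) = 0 := if_neg (by omega)
    rw [this]
    exact hX.zero_lt_head

/-- The part of `g ++ s` that is not free is a prefix of `w` no longer than `s`, so a number of
zeros depending only on `M` repairs it. -/
lemma exists_append_zeros_mem (M : ℕ) : ∃ t : ℕ, ∀ g ∈ lexFree w, ∀ s : List (Fin b),
    s.length ≤ M → g ++ s ∈ shiftLanguage X →
      g ++ s ++ List.replicate t (0 : Fin b) ∈ lexFree w := by
  obtain ⟨t, ht⟩ := hX.exists_gap M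
  refine ⟨t, fun g hg s hs hgs => ?_⟩
  obtain ⟨v, hv, n, h1, h2⟩ := hX.exists_decomposition hgs
  rw [h1, List.append_assoc]
  exact append_mem_lexFree hv (ht n ((h2 g hg s rfl).trans hs))

/-- Words that become free after adding boundedly many zeros have periodic specification. -/
lemma hasPerSpecificationOn {D : Set (List (Fin b))} {t : ℕ}
    (hD : ∀ z ∈ D, z ++ List.replicate t (0 : Fin b) ∈ lexFree w) :
    HasPerSpecificationOn X D := by
  refine ⟨t, fun m z hz => ?_⟩
  set v : Fin m → List (Fin b) := fun _ => List.replicate t 0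
  have hfree : glue z v ++ List.replicate t (0 : Fin b) ∈ lexFree w := by
    induction m with
    | zero => rw [glue_zero]; exact hD _ (hz 0)
    | succ m ih =>
      rw [glue_succ, ← List.append_assoc, List.append_assoc]
      exact append_mem_lexFree (hD _ (hz 0)) (ih (fun i => z i.succ) fun i => hz _)
  set W := glue z v ++ List.replicate t (0 : Fin b)
  have hlen : W.length = (glue z v).length + t := by simp [W]
  have hWL := hX.lexFree_subset hfree
  refine ⟨v, fun i => ⟨hX.lexFree_subset (hX.replicate_zero_mem_lexFree t), by simp [v]⟩,
    (shiftLanguage_of_append hWL).1, ?_⟩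
  by_cases hW : W = []
  · obtain ⟨p, hp⟩ := (shiftLanguage_of_append hWL).1
    refine ⟨p, hp, ?_⟩
    rw [← hlen, hW]; rfl
  · obtain ⟨p, hp, hper⟩ := exists_periodic_of_powers hW fun k =>
      hX.lexFree_subset (flatten_mem_lexFree fun _ hu => by
        rw [(List.mem_replicate.1 hu).2]; exact hfree)
    exact ⟨p, (mem_wordCylinder_append.1 hp).1, by rw [← hlen]; exact hper⟩

lemma hasPerSpecificationOn_fattened {G Cs : Set (List (Fin b))} (hG : G ⊆ lexFree w) (M : ℕ) :
    HasPerSpecificationOn X (fattened X {[]} G Cs M) := by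
  obtain ⟨t, ht⟩ := hX.exists_append_zeros_mem M
  refine hX.hasPerSpecificationOn (t := t) ?_
  rintro z ⟨hz, _, rfl, v, hv, s, -, -, hs, rfl⟩
  exact ht v (hG hv) s hs hz

end IsLexShift

end LexShift

/-! ### Gibbs states on lexicographic shifts, with and without the Bowen property -/

section LexShiftStates

variable {b : ℕ} [NeZero b] {X : Subshift (Fin b) ℕ} {w : ℕ → Fin b}

namespace IsLexShift

variable (hX : IsLexShift X w)
include hX

/-- The endings `e j` make the words free and prefix-free at a bounded cost. Free words concatenate
without gaps, so `kraft_inequality` applies with `t = 0`. -/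
lemma exists_sum_exp_le {φ : C(X.carrier, ℝ)} (hφ : HasBowen X φ) (R : ℕ) :
    ∃ C : ℝ, 0 < C ∧ ∀ (s : Finset ℕ) (u e : ℕ → List (Fin b)),
      (∀ j ∈ s, u j ++ e j ∈ lexFree w ∧ (e j).length = R) →
      (∀ j ∈ s, ∀ k ∈ s, ∀ x ∈ wordCylinder X (u j ++ e j),
        x ∈ wordCylinder X (u k ++ e k) → j = k) →
      ∑ j ∈ s, Real.exp (supBirkhoff X φ (u j) - (u j).length * topPressure X φ) ≤ C := by
  classical
  have := hX.nonempty
  obtain ⟨V, hV⟩ := hφ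
  set P := topPressure X φ
  set Q := V + R * (‖φ‖ + |P|)
  refine ⟨Real.exp V * Real.exp Q, by positivity, fun s u e hue hpf => ?_⟩
  have hL : ∀ j ∈ s, u j ++ e j ∈ shiftLanguage X := fun j hj => hX.lexFree_subset (hue j hj).1
  have hinj : ∀ j ∈ s, ∀ k ∈ s, u j ++ e j = u k ++ e k → j = k := by
    intro j hj k hk hjk
    obtain ⟨x, hx⟩ := hL j hj
    exact hpf j hj k hk x hx (hjk ▸ hx)
  have hU : PrefixFree X ((s.image fun j => u j ++ e j : Finset (List (Fin b))) :
      Set (List (Fin b))) := by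
    intro v hv v' hv' hne
    obtain ⟨j, hj, rfl⟩ := Finset.mem_image.1 (Finset.mem_coe.1 hv)
    obtain ⟨k, hk, rfl⟩ := Finset.mem_image.1 (Finset.mem_coe.1 hv')
    obtain ⟨x, hx, hx'⟩ := hne
    rw [hpf j hj k hk x hx hx']
  have hkr := kraft_inequality φ _ hU (t := 0) (V := V) (fun ws _ h2 => by
      have h3 : ws.flatten ∈ lexFree w := flatten_mem_lexFree fun v hv => by
        obtain ⟨j, hj, rfl⟩ := Finset.mem_image.1 (h2 v hv)
        exact (hue j hj).1
      obtain ⟨p, hp⟩ := hX.lexFree_subset h3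
      exact ⟨p, follows_zero_of_mem_flatten hp⟩) (fun v hv => by
      obtain ⟨j, hj, rfl⟩ := Finset.mem_image.1 hv
      exact hV _ (hL j hj))
  rw [Finset.sum_image fun j hj k hk => hinj j hj k hk] at hkr
  simp only [Nat.cast_zero, add_zero, zero_mul] at hkr
  calc ∑ j ∈ s, Real.exp (supBirkhoff X φ (u j) - (u j).length * P)
      ≤ ∑ j ∈ s, Real.exp (supBirkhoff X φ (u j ++ e j) - (u j ++ e j).length * P) *
          Real.exp Q := ?_
    _ ≤ _ := by rw [← Finset.sum_mul]; gcongr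
  refine Finset.sum_le_sum fun j hj => ?_
  rw [← Real.exp_add, Real.exp_le_exp]
  obtain ⟨x, hx⟩ := hL j hj
  have h1 := birkhoffSum_le_supBirkhoff (φ := φ) hx
  have hlen : (u j ++ e j).length = (u j).length + R := by
    rw [List.length_append, (hue j hj).2]
  have h2 := supBirkhoff_le_of_bowen (hV (u j) (shiftLanguage_of_append (hL j hj)).1)
    (mem_wordCylinder_append.1 hx).1
  rw [hlen, birkhoffSum_add] at h1
  have h3 := abs_le.1 (abs_birkhoffSum_le φ R ((shiftMap X)^[(u j).length] x))
  rw [hlen]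
  push_cast
  have h4 : (R : ℝ) * P ≤ R * |P| := by gcongr; exact le_abs_self P
  simp only [Q]
  linarith

/-- Append `w 0` and enough zeros: the result is free, and `m` is the place of its first nonzero
letter. -/
lemma exists_sum_replicate_le {φ : C(X.carrier, ℝ)} (hφ : HasBowen X φ) :
    ∃ C : ℝ, 0 < C ∧ ∀ s : Finset ℕ, ∑ m ∈ s, Real.exp
      (supBirkhoff X φ (List.replicate m (0 : Fin b)) - m * topPressure X φ) ≤ C := by
  obtain ⟨t, ht⟩ := hX.exists_gap 1
  obtain ⟨C, hC, h⟩ := hX.exists_sum_exp_le hφ (1 + t)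
  refine ⟨C, hC, fun s => ?_⟩
  have h1 := h s (fun m => List.replicate m 0) (fun _ => [w 0] ++ List.replicate t 0)
    (fun m _ => ⟨append_mem_lexFree (hX.replicate_zero_mem_lexFree m)
      (by simpa [wordPrefix] using ht 1 le_rfl), by simp [add_comm]⟩) (by
      have key : ∀ m, ∀ x ∈ wordCylinder X (List.replicate m (0 : Fin b) ++
          ([w 0] ++ List.replicate t 0)), (∀ i < m, x.1 i = 0) ∧ x.1 m ≠ 0 := by
        intro m x hx
        rw [mem_wordCylinder_append, mem_wordCylinder_append] at hx
        refine ⟨fun i hi => ?_, ?_⟩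
        · rw [mem_wordCylinder.1 hx.1 i (by simpa), List.getElem_replicate]
        have := mem_wordCylinder.1 hx.2.1 0 (by simp)
        rw [shiftMap_iterate_apply] at this
        simp only [List.length_replicate, add_zero, List.getElem_cons_zero] at this
        rw [this]
        exact hX.zero_lt_head.ne'
      intro j _ k _ x hj hk
      obtain ⟨a1, a2⟩ := key j x hj
      obtain ⟨b1, b2⟩ := key k x hk
      rcases lt_trichotomy j k with h | h | h
      exacts [absurd (b1 j h) a2, h, absurd (a1 k h) b2])
  simpa using h1

/-- Putting `0` in place of the nonzero digit `w j` makes the prefix free, and `j` is the first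
place where the new word leaves `w`. -/
lemma exists_sum_wordPrefix_le {φ : C(X.carrier, ℝ)} (hφ : HasBowen X φ) :
    ∃ C : ℝ, 0 < C ∧ ∀ s : Finset ℕ, (∀ j ∈ s, 0 < w j) → ∑ j ∈ s, Real.exp
      (supBirkhoff X φ (wordPrefix j w) - j * topPressure X φ) ≤ C := by
  obtain ⟨C, hC, h⟩ := hX.exists_sum_exp_le hφ 1
  refine ⟨C, hC, fun s hs => ?_⟩
  have h1 := h s (fun j => wordPrefix j w) (fun _ => [0]) (fun j hj => ⟨?_, by simp⟩) (by
      have key : ∀ j, ∀ x ∈ wordCylinder X (wordPrefix j w ++ [(0 : Fin b)]),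
          (∀ i < j, x.1 i = w i) ∧ x.1 j = 0 := by
        intro j x hx
        rw [mem_wordCylinder_append, mem_wordCylinder_iff_wordPrefix, length_wordPrefix,
          wordPrefix_eq_iff] at hx
        refine ⟨hx.1, ?_⟩
        have := mem_wordCylinder.1 hx.2 0 (by simp)
        rw [shiftMap_iterate_apply] at this
        simpa using this
      intro j hj k hk x hjx hkx
      obtain ⟨a1, a2⟩ := key j x hjx
      obtain ⟨b1, b2⟩ := key k x hkx
      rcases lt_trichotomy j k with h | h | h
      · rw [b1 j h] at a2; exact absurd a2 (hs j hj).ne'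
      · exact h
      · rw [a1 k h] at b2; exact absurd b2 (hs k hk).ne')
  · simpa using h1
  · set y : ℕ → Fin b := fun i => if i < j then w i else 0
    have hy : wordPrefix j w ++ [(0 : Fin b)] = wordPrefix (j + 1) y := by
      rw [wordPrefix_add]
      congr 1
      · rw [wordPrefix_eq_iff]
        intro i hi
        simp [y, hi]
      · simp [wordPrefix, y]
    rw [hy]
    intro k hk
    rw [length_wordPrefix] at hk
    suffices h : ∃ i, k + i < j + 1 ∧ y (k + i) < w i ∧ ∀ l < i, y (k + l) = w l by
      obtain ⟨i, h1, h2, h3⟩ := h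
      refine ⟨i, by rwa [length_wordPrefix], by simpa [wordPrefix, -List.ofFn_succ] using h2, fun l hl => ?_⟩
      simpa [wordPrefix, -List.ofFn_succ] using h3 l hl
    classical
    have hwy : ∀ i, k + i < j → y (k + i) = w (k + i) := fun i hi => if_pos hi
    -- A suffix matching `w` to the end would give `w (j - k) = 0`, against `0 < w j ≤ w (j - k)`.
    have hex : ∃ i, k + i < j + 1 ∧ y (k + i) ≠ w i := by
      by_contra! hcon
      have e : k + (j - k) = j := by omega
      have h1 : w (k + (j - k)) ≤ w (j - k) := hX.shift_le fun i hi => by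
        rw [← hwy i (by omega)]
        exact hcon i (by omega)
      rw [← hcon (j - k) (by omega), e] at h1
      have h2 : y j = 0 := if_neg (lt_irrefl j)
      rw [h2] at h1
      exact absurd (hs j hj) (not_lt.2 h1)
    obtain ⟨h1, h2⟩ := Nat.find_spec hex
    have hmin : ∀ l < Nat.find hex, y (k + l) = w l := by
      intro l hl
      by_contra hne
      exact Nat.find_min hex hl ⟨by omega, hne⟩
    refine ⟨Nat.find hex, h1, lt_of_le_of_ne ?_ h2, hmin⟩
    rcases lt_or_ge (k + Nat.find hex) j with h3 | h3
    · rw [hwy _ h3]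
      refine hX.shift_le fun i hi => ?_
      rw [← hmin i hi, hwy i (by omega)]
    · have : y (k + Nat.find hex) = 0 := if_neg (by omega)
      rw [this]
      exact Fin.zero_le _

/-- Split a prefix of `w` at its last nonzero digit into a shorter prefix, that digit and a run of
zeros. The place of the digit and the number of zeros determine the length, so the series is at most
a constant times the product of the two preceding sums. -/
lemma summable_wordPrefix {φ : C(X.carrier, ℝ)} (hφ : HasBowen X φ) :
    Summable fun n : ℕ => Real.exp
      (supBirkhoff X φ (wordPrefix (n + 1) w) - (n + 1 : ℕ) * topPressure X φ) := by
  classical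
  obtain ⟨C₁, hC₁, h₁⟩ := hX.exists_sum_wordPrefix_le hφ
  obtain ⟨C₂, hC₂, h₂⟩ := hX.exists_sum_replicate_le hφ
  set P := topPressure X φ
  set f : ℕ → ℝ := fun j => Real.exp (supBirkhoff X φ (wordPrefix j w) - j * P)
  set g : ℕ → ℝ := fun m => Real.exp (supBirkhoff X φ (List.replicate m (0 : Fin b)) - m * P)
  have hlast : ∀ n : ℕ, ∃ j ≤ n, 0 < w j ∧ ∀ i, j < i → i ≤ n → w i = 0 := by
    intro n
    induction n with
    | zero => exact ⟨0, le_rfl, hX.zero_lt_head, fun i h1 h2 => by omega⟩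
    | succ n ih =>
      by_cases hw : w (n + 1) = 0
      · obtain ⟨j, h1, h2, h3⟩ := ih
        refine ⟨j, by omega, h2, fun i h4 h5 => ?_⟩
        rcases Nat.lt_or_ge n i with h | h
        · rwa [show i = n + 1 by omega]
        · exact h3 i h4 h
      · exact ⟨n + 1, le_rfl, Fin.pos_iff_ne_zero.2 hw, fun i h1 h2 => by omega⟩
  choose J hJn hJpos hJ using hlast
  refine summable_of_sum_range_le (c := Real.exp (‖φ‖ + |P|) * (C₁ * C₂))
    (fun _ => (Real.exp_pos _).le) fun N => ?_
  have hterm : ∀ n, f (n + 1) ≤ Real.exp (‖φ‖ + |P|) * (f (J n) * g (n - J n)) := by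
    intro n
    have e : n + 1 = J n + (1 + (n - J n)) := by have := hJn n; omega
    have hz : wordPrefix (n - J n) (fun i => w (J n + (1 + i))) = List.replicate (n - J n) 0 := by
      apply List.ext_getElem (by simp)
      intro i h1 h2
      simp only [length_wordPrefix] at h1
      simp only [wordPrefix, List.getElem_ofFn, List.getElem_replicate]
      exact hJ n _ (by omega) (by omega)
    have hword : wordPrefix (n + 1) w = wordPrefix (J n) w ++ ([w (J n)] ++
        List.replicate (n - J n) 0) := by
      conv_lhs => rw [e, wordPrefix_add, wordPrefix_add, hz]
      simp [wordPrefix]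
    have hL : wordPrefix (n + 1) w ∈ shiftLanguage X :=
      wordPrefix_mem_shiftLanguage (n + 1) ⟨w, hX.self_mem⟩
    rw [hword] at hL
    have a1 := supBirkhoff_append_le (φ := φ) hL
    have hL2 := (shiftLanguage_of_append hL).2
    have a2 := supBirkhoff_append_le (φ := φ) hL2
    have a3 := (abs_le.1 (abs_supBirkhoff_le (φ := φ) (shiftLanguage_of_append hL2).1)).2
    simp only [List.length_singleton, Nat.cast_one, one_mul] at a3
    simp only [f, g]
    rw [← Real.exp_add, ← Real.exp_add, Real.exp_le_exp, hword]
    have e' : ((n + 1 : ℕ) : ℝ) = J n + (1 + ((n - J n : ℕ) : ℝ)) := by exact_mod_cast e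
    rw [e']
    have := neg_abs_le P
    linarith
  have hf : ∀ j, 0 ≤ f j := fun j => (Real.exp_pos _).le
  have hg : ∀ j, 0 ≤ g j := fun j => (Real.exp_pos _).le
  set S := (Finset.range N).filter fun j => 0 < w j
  calc ∑ n ∈ Finset.range N, f (n + 1)
      ≤ ∑ n ∈ Finset.range N, Real.exp (‖φ‖ + |P|) * (f (J n) * g (n - J n)) :=
        Finset.sum_le_sum fun n _ => hterm n
    _ = Real.exp (‖φ‖ + |P|) * ∑ n ∈ Finset.range N, f (J n) * g (n - J n) := by
        rw [Finset.mul_sum]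
    _ ≤ Real.exp (‖φ‖ + |P|) * ∑ p ∈ S ×ˢ Finset.range N, f p.1 * g p.2 := by
        gcongr
        refine Finset.sum_le_sum_of_inj (fun n => (J n, n - J n)) (fun n hn => ?_)
          (fun n _ m _ h => ?_) (fun _ _ => le_rfl) fun p _ => mul_nonneg (hf _) (hg _)
        · have := Finset.mem_range.1 hn
          have := hJn n
          simp only [S, Finset.mem_product, Finset.mem_filter, Finset.mem_range]
          exact ⟨⟨by omega, hJpos n⟩, by omega⟩
        · obtain ⟨h1, h2⟩ := Prod.mk.inj h
          have := hJn n
          have := hJn m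
          omega
    _ = Real.exp (‖φ‖ + |P|) * ((∑ j ∈ S, f j) * ∑ m ∈ Finset.range N, g m) := by
        rw [Finset.sum_product, Finset.sum_mul_sum]
    _ ≤ _ := by
        have h0 : 0 ≤ ∑ m ∈ Finset.range N, g m := Finset.sum_nonneg fun m _ => hg m
        gcongr
        · exact h₁ S fun j hj => (Finset.mem_filter.1 hj).2
        · exact h₂ _

lemma nil_mem_shiftLanguage : [] ∈ shiftLanguage X := hX.lexFree_subset nil_mem_lexFree

lemma isGoodDecomposition {φ : C(X.carrier, ℝ)} (hφ : HasBowen X φ) :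
    IsGoodDecomposition X φ {[]} (lexFree w) (range fun n => wordPrefix n w) := by
  have hw : ∀ n, wordPrefix n w ∈ shiftLanguage X := fun n =>
    wordPrefix_mem_shiftLanguage n ⟨w, hX.self_mem⟩
  refine ⟨⟨by simpa using hX.nil_mem_shiftLanguage, hX.lexFree_subset, ?_, fun z hz => ?_⟩,
    fun M => hX.hasPerSpecificationOn_fattened le_rfl M, hφ.mono hX.lexFree_subset, ?_⟩
  · rintro _ ⟨n, rfl⟩; exact hw n
  · obtain ⟨v, hv, n, h, -⟩ := hX.exists_decomposition hz
    exact ⟨[], rfl, v, hv, _, ⟨n, rfl⟩, by simpa using h⟩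
  · refine (hX.summable_wordPrefix hφ).congr fun n => ?_
    have : wordsOf ({[]} ∪ range fun n => wordPrefix n w) (n + 1) = {wordPrefix (n + 1) w} := by
      ext z
      rw [mem_wordsOf, Finset.mem_singleton]
      constructor
      · rintro ⟨h1, rfl | ⟨m, rfl⟩⟩
        · simp at h1
        · rw [length_wordPrefix] at h1
          rw [h1]
      · rintro rfl
        exact ⟨by simp, Or.inr ⟨n + 1, rfl⟩⟩
    rw [partitionSum_eq, this, Finset.sum_singleton, ← Real.exp_add]
    congr 1
    ring

theorem hasUniqueGibbsState_of_hasBowen {φ : C(X.carrier, ℝ)} (hφ : HasBowen X φ) :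
    HasUniqueGibbsState X φ := by
  have := hX.nonempty
  exact (hX.isGoodDecomposition hφ).hasUniqueGibbsState

end IsLexShift

/-- Concatenations of prefixes of `w`, separated by blocks of `L` zeros. -/
inductive IsSeparated (w : ℕ → Fin b) (L : ℕ) : List (Fin b) → Prop
  | wordPrefix (n : ℕ) : IsSeparated w L (wordPrefix n w)
  | append {s : List (Fin b)} (n : ℕ) : IsSeparated w L s →
      IsSeparated w L (s ++ List.replicate L 0 ++ _root_.wordPrefix n w)

/-- A word of `G` ending in many zeros would spoil the Bowen property of the singular potential at
0^∞. Such an ending is stripped and the rest decomposed again; the stripped pieces collect in the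
separated suffix. -/
lemma IsSeparated.exists_decomposition (hX : IsLexShift X w) {L : ℕ} (hL : 0 < L) (n : ℕ) :
    ∀ z ∈ shiftLanguage X, z.length = n → ∃ v ∈ lexFree w,
      (∀ y, v ≠ y ++ List.replicate L 0) ∧ ∃ s, IsSeparated w L s ∧ z = v ++ s := by
  induction n using Nat.strong_induction_on with
  | _ n ih =>
    rintro z hz rfl
    obtain ⟨v, hv, n, h1, -⟩ := hX.exists_decomposition hz
    by_cases h : ∃ y, v = y ++ List.replicate L 0
    · obtain ⟨y, rfl⟩ := h
      have hy : y ∈ shiftLanguage X := (shiftLanguage_of_append (hX.lexFree_subset hv)).1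
      obtain ⟨v', hv', h2, s, hs, h3⟩ := ih y.length (by simp [h1]; omega) y hy rfl
      exact ⟨v', hv', h2, _, hs.append n, by rw [h1, h3]; simp⟩
    · push Not at h
      exact ⟨v, hv, h, _, .wordPrefix n, h1⟩

/-- Such a word is a prefix of `w`, or it is determined by the separated word before its last block
of zeros, of length at most `n - L`. -/
lemma card_isSeparated_le_sum (L n : ℕ) :
    (wordsOf {s | IsSeparated w L s} n).card ≤
      1 + ∑ i ∈ Finset.range (n + 1 - L), (wordsOf {s | IsSeparated w L s} i).card := by
  classical
  have hsub : wordsOf {s | IsSeparated w L s} n ⊆ {wordPrefix n w} ∪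
      (Finset.range (n + 1 - L)).biUnion fun i => (wordsOf {s | IsSeparated w L s} i).image
        fun s => s ++ List.replicate L 0 ++ wordPrefix (n - L - i) w := by
    intro z hz
    obtain ⟨hn, hz⟩ := mem_wordsOf.1 hz
    rw [Finset.mem_union, Finset.mem_singleton, Finset.mem_biUnion]
    rcases hz with m | @⟨s, m, hs⟩
    · left
      rw [length_wordPrefix] at hn
      rw [hn]
    · right
      simp only [List.length_append, List.length_replicate, length_wordPrefix] at hn
      refine ⟨s.length, Finset.mem_range.2 (by omega),
        Finset.mem_image.2 ⟨s, mem_wordsOf.2 ⟨rfl, hs⟩, ?_⟩⟩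
      rw [show n - L - s.length = m by omega]
  refine (Finset.card_le_card hsub).trans ((Finset.card_union_le _ _).trans ?_)
  rw [Finset.card_singleton]
  gcongr
  exact Finset.card_biUnion_le.trans (Finset.sum_le_sum fun i _ => Finset.card_image_le)

/-- Well separated words are few. -/
lemma exists_card_isSeparated_le (w : ℕ → Fin b) {ε : ℝ} (hε : 0 < ε) : ∃ L : ℕ, 0 < L ∧
    ∀ n : ℕ, ((wordsOf {s | IsSeparated w L s} n).card : ℝ) ≤ 2 * Real.exp (n * ε) := by
  set a := Real.exp ε
  have ha : 1 < a := Real.one_lt_exp_iff.2 hε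
  have ha0 : 0 < a - 1 := by linarith
  -- For this `L` the geometric sum in the recursion is at most `a ^ n`; with `1 ≤ a ^ n` the
  -- induction closes with constant 2.
  obtain ⟨L, hL⟩ := pow_unbounded_of_one_lt (2 * a / (a - 1)) ha
  rw [div_lt_iff₀ ha0] at hL
  have hL0 : 0 < L := by
    rcases Nat.eq_zero_or_pos L with rfl | h
    · rw [pow_zero] at hL; linarith
    · exact h
  refine ⟨L, hL0, fun n => ?_⟩
  have hexp : ∀ n : ℕ, Real.exp (n * ε) = a ^ n := fun n => Real.exp_nat_mul ε n
  rw [hexp]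
  induction n using Nat.strong_induction_on with
  | _ n ih =>
    have h1 : ((wordsOf {s | IsSeparated w L s} n).card : ℝ) ≤
        1 + ∑ i ∈ Finset.range (n + 1 - L), ((wordsOf {s | IsSeparated w L s} i).card : ℝ) := by
      exact_mod_cast card_isSeparated_le_sum L n
    have h2 : ∑ i ∈ Finset.range (n + 1 - L), ((wordsOf {s | IsSeparated w L s} i).card : ℝ) ≤
        2 * ∑ i ∈ Finset.range (n + 1 - L), a ^ i := by
      rw [Finset.mul_sum]
      refine Finset.sum_le_sum fun i hi => ?_
      have := Finset.mem_range.1 hi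
      exact ih i (by omega)
    have h3 : 1 ≤ a ^ n := one_le_pow₀ ha.le
    have h4 : 2 * ∑ i ∈ Finset.range (n + 1 - L), a ^ i ≤ a ^ n := by
      rcases Nat.lt_or_ge n L with h | h
      · rw [show n + 1 - L = 0 by omega]; simp; positivity
      · rw [geom_sum_eq ha.ne', mul_div_assoc', div_le_iff₀ ha0]
        have e : a ^ n = a ^ (n - L) * a ^ L := by rw [← pow_add]; congr 1; omega
        have e2 : a ^ (n + 1 - L) = a ^ (n - L) * a := by
          rw [← pow_succ]; congr 1; omega
        rw [e, e2]
        have h5 : 0 < a ^ (n - L) := by positivity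
        nlinarith
    linarith

namespace IsLexShift

variable (hX : IsLexShift X w)
include hX

lemma topPressure_zero_pos : 0 < topPressure X (0 : C(X.carrier, ℝ)) := by
  have := hX.nonempty
  obtain ⟨t, ht⟩ := hX.exists_gap 1
  have h1 : [w 0] ++ List.replicate t 0 ∈ lexFree w := by simpa [wordPrefix] using ht 1 le_rfl
  refine _root_.topPressure_zero_pos (a := [w 0] ++ List.replicate t 0)
    (b := List.replicate (t + 1) 0) (fun h => ?_) (by simp) (t := 0) fun ws _ h2 => ?_
  · rw [List.replicate_succ, List.singleton_append] at h
    exact hX.zero_lt_head.ne' (List.cons.inj h).1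
  · have h3 : ws.flatten ∈ lexFree w := flatten_mem_lexFree fun v hv => by
      rcases h2 v hv with rfl | rfl
      exacts [h1, hX.replicate_zero_mem_lexFree _]
    obtain ⟨p, hp⟩ := hX.lexFree_subset h3
    exact ⟨p, follows_zero_of_mem_flatten hp⟩

/-- A potential without the Bowen property that admits a good decomposition. -/
theorem exists_not_hasBowen :
    ∃ φ : C(X.carrier, ℝ), ¬ HasBowen X φ ∧ HasUniqueGibbsState X φ := by
  have := hX.nonempty
  have hP0 := hX.topPressure_zero_pos
  set P₀ := topPressure X (0 : C(X.carrier, ℝ))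
  have hc : 0 < P₀ / 2 := by positivity
  set p : X.carrier := ⟨fun _ => 0, hX.zero_mem⟩
  set φ := singularPotential X p.1 (P₀ / 2)
  have hP : P₀ / 2 ≤ topPressure X φ := by
    have := topPressure_zero_sub_le (φ := φ) (le_singularPotential (p := p.1) hc.le)
    linarith
  -- The rate `P₀ / 4` lies below `P₀ / 2`, which bounds the pressure of `φ` from below.
  obtain ⟨L, hL, hcard⟩ := exists_card_isSeparated_le w (ε := P₀ / 4) (by positivity)
  refine ⟨φ, not_hasBowen_singularPotential (q := 1) one_pos
    (carrier_ext fun i => by rw [shiftMap_iterate_apply]) (fun N => ?_) hc, ?_⟩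
  · refine ⟨⟨prependWord (List.replicate N 0) w,
      hX.prependWord_mem (hX.replicate_zero_mem_lexFree N) hX.self_mem⟩, fun h => ?_,
      fun i hi => ?_⟩
    · have h1 := congrFun (congrArg Subtype.val h) ((List.replicate N (0 : Fin b)).length + 0)
      simp only [prependWord_add] at h1
      exact hX.zero_lt_head.ne' h1
    · show prependWord (List.replicate N 0) w i = 0
      rw [prependWord_of_lt (by simpa), List.getElem_replicate]
  have hG : {v | v ∈ lexFree w ∧ ∀ y, v ≠ y ++ List.replicate L 0} ⊆ lexFree w := fun v hv => hv.1
  refine IsGoodDecomposition.hasUniqueGibbsState (Cp := {[]})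
    (G := {v | v ∈ lexFree w ∧ ∀ y, v ≠ y ++ List.replicate L 0})
    (Cs := {s | s ∈ shiftLanguage X ∧ IsSeparated w L s})
    ⟨⟨by simpa using hX.nil_mem_shiftLanguage, fun v hv => hX.lexFree_subset hv.1,
      fun s hs => hs.1, fun z hz => ?_⟩,
      fun M => hX.hasPerSpecificationOn_fattened hG M,
      hasBowenOn_singularPotential L ?_, ?_⟩
  · obtain ⟨v, hv, h1, s, hs, h2⟩ := IsSeparated.exists_decomposition hX hL _ z hz rfl
    refine ⟨[], rfl, v, ⟨hv, h1⟩, s, ⟨?_, hs⟩, by simpa using h2⟩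
    rw [h2] at hz
    exact (shiftLanguage_of_append hz).2
  · rintro v ⟨-, hv⟩ x hx j hj
    -- A tail from `j` consisting of zeros only would make `v` end in `L` zeros.
    by_contra! hcon
    apply hv (v.take (v.length - L))
    rw [mem_wordCylinder] at hx
    apply List.ext_getElem
    · simp only [List.length_append, List.length_take, List.length_replicate]; omega
    · intro i h1 h2
      rcases lt_or_ge i (v.length - L) with h | h
      · rw [List.getElem_append_left (by simp only [List.length_take]; omega), List.getElem_take]
      · rw [List.getElem_append_right (by simp only [List.length_take]; omega),
          List.getElem_replicate, ← hx i h1]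
        have := hcon (i - j) (by omega)
        rwa [Nat.add_sub_of_le (by omega)] at this
  · refine summable_of_card_le (singularPotential_nonpos hc.le) (C := 2) (ε := P₀ / 4) ?_
      (fun n => le_trans ?_ (hcard n)) (by linarith)
    · rintro s (rfl | hs)
      exacts [hX.nil_mem_shiftLanguage, hs.1]
    · have : wordsOf ({[]} ∪ {s | s ∈ shiftLanguage X ∧ IsSeparated w L s}) n ⊆
          wordsOf {s | IsSeparated w L s} n := by
        intro s hs
        obtain ⟨h1, h2⟩ := mem_wordsOf.1 hs
        refine mem_wordsOf.2 ⟨h1, ?_⟩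
        rcases h2 with rfl | h2
        exacts [.wordPrefix 0, h2.2]
      exact_mod_cast Finset.card_le_card this

end IsLexShift

end LexShiftStates

/-! ### β-shifts -/

section BetaShift

variable {β : ℝ}

lemma betaRemainder_succ (β : ℝ) (n : ℕ) :
    betaRemainder β (n + 1) = β * betaRemainder β n - betaDigit β n := by
  simp [betaRemainder, betaDigit]

lemma betaRemainder_pos_le_one (β : ℝ) (n : ℕ) :
    0 < betaRemainder β n ∧ betaRemainder β n ≤ 1 := by
  cases n with
  | zero => simp [betaRemainder]
  | succ n =>
    rw [betaRemainder]
    have h1 := Int.ceil_lt_add_one (β * betaRemainder β n)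
    have h2 := Int.le_ceil (β * betaRemainder β n)
    constructor <;> linarith

lemma betaDigit_nonneg (hβ : 1 < β) (n : ℕ) : 0 ≤ betaDigit β n := by
  have h := (betaRemainder_pos_le_one β n).1
  have : 0 < ⌈β * betaRemainder β n⌉ := Int.ceil_pos.2 (by positivity)
  unfold betaDigit
  omega

lemma betaDigit_lt (hβ : 1 < β) (n : ℕ) : betaDigit β n < ⌈β⌉₊ := by
  have h := (betaRemainder_pos_le_one β n).2
  have h1 : ⌈β * betaRemainder β n⌉ ≤ ⌈β⌉ :=
    Int.ceil_le_ceil (mul_le_of_le_one_right (by linarith) h)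
  rw [Int.natCast_ceil_eq_ceil (by linarith)]
  unfold betaDigit
  omega

/-- The largest element `w^β` of the `β`-shift, with digits in the alphabet. -/
theorem exists_isLexShift_betaShift (hβ : 1 < β) : ∃ w : ℕ → Fin ⌈β⌉₊,
    (∀ n, ((w n : ℕ) : ℤ) = betaDigit β n) ∧ IsLexShift (betaShift β) w := by
  set w : ℕ → Fin ⌈β⌉₊ := fun n => ⟨(betaDigit β n).toNat, by
    have h1 := betaDigit_nonneg hβ n
    have h2 := betaDigit_lt hβ n
    omega⟩
  have hw : ∀ n, ((w n : ℕ) : ℤ) = betaDigit β n := fun n =>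
    Int.toNat_of_nonneg (betaDigit_nonneg hβ n)
  have hmem : ∀ x : ℕ → Fin ⌈β⌉₊, x ∈ (betaShift β).carrier ↔
      ∀ k n, (∀ i < n, x (k + i) = w i) → x (k + n) ≤ w n := by
    intro x
    show (∀ k : ℕ, LexLE (fun i => ((x (k + i) : ℕ) : ℤ)) (betaDigit β)) ↔ _
    simp only [LexLE, ← hw, Nat.cast_inj, Nat.cast_le, Fin.val_inj, Fin.val_fin_le]
  refine ⟨w, hw, hmem, (hmem w).2 fun k n h => ?_, ?_, fun n => ?_⟩
  -- Equal digits preserve the order of remainders, starting from `r_k ≤ 1 = r_0`, and digits are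
  -- monotone in the remainder.
  · have hr : ∀ i ≤ n, betaRemainder β (k + i) ≤ betaRemainder β i := by
      intro i
      induction i with
      | zero => exact fun _ => (betaRemainder_pos_le_one β k).2
      | succ i ih =>
        intro hi
        rw [← add_assoc, betaRemainder_succ, betaRemainder_succ, ← hw, ← hw, h i (by omega)]
        have := ih (by omega)
        gcongr
    rw [← Fin.val_fin_le, ← Nat.cast_le (α := ℤ), hw, hw]
    unfold betaDigit
    gcongr
    exact hr n le_rfl
  · have h1 : (2 : ℤ) ≤ ⌈β⌉ := by
      have : (1 : ℤ) < ⌈β⌉ := Int.lt_ceil.2 (by simpa)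
      omega
    have h2 : betaDigit β 0 = ⌈β⌉ - 1 := by simp [betaDigit, betaRemainder]
    have h3 := hw 0
    omega
  -- Zero digits from `n` on would multiply a positive remainder by `β` at every step, past 1.
  · by_contra! hcon
    have hz : ∀ m, betaDigit β (n + m) = 0 := by
      intro m
      rw [← hw, Nat.le_zero.1 (hcon (n + m) (by omega)), Nat.cast_zero]
    have hr : ∀ m, betaRemainder β (n + m) = β ^ m * betaRemainder β n := by
      intro m
      induction m with
      | zero => simp
      | succ m ih => rw [← add_assoc, betaRemainder_succ, ih, hz, pow_succ]; push_cast; ring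
    have hpos := (betaRemainder_pos_le_one β n).1
    obtain ⟨m, hm⟩ := pow_unbounded_of_one_lt (1 / betaRemainder β n) hβ
    rw [div_lt_iff₀ hpos] at hm
    have := (betaRemainder_pos_le_one β (n + m)).2
    rw [hr] at this
    linarith

theorem betaShift_states (hβ : 1 < β) :
    (∀ φ : C((betaShift β).carrier, ℝ), HasBowen (betaShift β) φ →
      HasUniqueGibbsState (betaShift β) φ) ∧
    ∃ φ : C((betaShift β).carrier, ℝ), ¬ HasBowen (betaShift β) φ ∧
      HasUniqueGibbsState (betaShift β) φ := by
  obtain ⟨w, -, hX⟩ := exists_isLexShift_betaShift hβ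
  have : NeZero ⌈β⌉₊ := ⟨(Nat.ceil_pos.2 (by linarith)).ne'⟩
  exact ⟨fun φ hφ => hX.hasUniqueGibbsState_of_hasBowen hφ, hX.exists_not_hasBowen⟩

end BetaShift

/-! ### Equilibrium states of β-transformations -/

section Coding

variable {Ω Ω' : Type*} [MeasurableSpace Ω] [MeasurableSpace Ω'] [MeasurableEq Ω']

/-- Existence and uniqueness of equilibrium states pass to a system that embeds measurably, provided
that the unique equilibrium state of the larger system is carried by the image. -/
theorem existsUnique_isEquilibriumState_of_coding {S : Ω → Ω} {T : Ω' → Ω'} (hS : Measurable S)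
    (hT : Measurable T) {h : Ω' → Ω} {π : Ω → Ω'} (hh : Measurable h) (hπ : Measurable π)
    (hπh : ∀ y, π (h y) = y) (hcomm : ∀ y, h (T y) = S (h y)) {ψ : Ω → ℝ}
    (hψ : StronglyMeasurable ψ) {μ : Measure Ω} (hμ : IsEquilibriumState S ψ μ)
    (huniq : ∀ ν, IsEquilibriumState S ψ ν → ν = μ) (hμh : ∀ᵐ x ∂μ, h (π x) = x) :
    ∃! ν : Measure Ω', IsEquilibriumState T (fun y => ψ (h y)) ν := by
  -- Since `π` inverts `h`, each system is a factor of the other, so neither entropy exceeds the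
  -- other.
  have hpush : ∀ ν : Measure Ω', IsInvariantProb T ν → IsInvariantProb S (ν.map h) ∧
      measureEntropy S (ν.map h) = measureEntropy T ν ∧
      ∫ x, ψ x ∂(ν.map h) = ∫ y, ψ (h y) ∂ν := by
    rintro ν ⟨h1, h2⟩
    have hinv : MeasurePreserving S (ν.map h) (ν.map h) := by
      refine ⟨hS, ?_⟩
      rw [Measure.map_map hS hh, ← show h ∘ T = S ∘ h from funext hcomm,
        ← Measure.map_map hh hT, h2.map_eq]
    have hae : ∀ᵐ x ∂(ν.map h), π (S x) = T (π x) := by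
      refine (ae_map_iff hh.aemeasurable (measurableSet_eq_fun (hπ.comp hS) (hT.comp hπ))).2
        (Eventually.of_forall fun y => ?_)
      show π (S (h y)) = T (π (h y))
      rw [← hcomm, hπh, hπh]
    have hback : (ν.map h).map π = ν := by
      rw [Measure.map_map hπ hh, show π ∘ h = id from funext hπh, Measure.map_id]
    refine ⟨⟨Measure.isProbabilityMeasure_map hh.aemeasurable, hinv⟩, le_antisymm ?_ ?_,
      integral_map hh.aemeasurable hψ.aestronglyMeasurable⟩
    · exact measureEntropy_map_le h2 hS hh (Eventually.of_forall hcomm)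
    · have := measureEntropy_map_le hinv hT hπ hae
      rwa [hback] at this
  obtain ⟨⟨hprob, hinv⟩, hmax⟩ := hμ
  have hback : (μ.map π).map h = μ := by
    rw [Measure.map_map hh hπ]
    conv_rhs => rw [← Measure.map_id (μ := μ)]
    exact Measure.map_congr hμh
  have hinv' : IsInvariantProb T (μ.map π) := by
    refine ⟨Measure.isProbabilityMeasure_map hπ.aemeasurable, hT, ?_⟩
    rw [Measure.map_map hT hπ]
    conv_rhs => rw [← hinv.map_eq, Measure.map_map hπ hS]
    refine Measure.map_congr ?_
    filter_upwards [hμh] with x hx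
    show T (π x) = π (S x)
    conv_rhs => rw [← hx, ← hcomm, hπh]
  refine ⟨μ.map π, ⟨hinv', fun ν hν => ?_⟩, fun ν hν => ?_⟩
  · obtain ⟨a1, a2, a3⟩ := hpush ν hν
    obtain ⟨-, b2, b3⟩ := hpush _ hinv'
    rw [hback] at b2 b3
    rw [← a2, ← a3, ← b2, ← b3]
    exact hmax _ a1
  · obtain ⟨a1, a2, a3⟩ := hpush ν hν.1
    obtain ⟨-, b2, b3⟩ := hpush _ hinv'
    rw [hback] at b2 b3
    have : ν.map h = μ := by
      refine huniq _ ⟨a1, fun ρ hρ => (hmax ρ hρ).trans ?_⟩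
      rw [a2, a3, b2, b3]
      exact hν.2 _ hinv'
    rw [← this, Measure.map_map hπ hh, show π ∘ h = id from funext hπh, Measure.map_id]

end Coding

/-! ### Coding of [0, 1) by greedy expansions -/

section BetaValue

variable {β : ℝ}

/-- The number with `β`-expansion `x`. -/
def betaValue (β : ℝ) {n : ℕ} (x : ℕ → Fin n) : ℝ := ∑' i, ((x i : ℕ) : ℝ) * β⁻¹ ^ (i + 1)

lemma betaValue_term_le (hβ : 1 < β) {n : ℕ} (x : ℕ → Fin n) (i : ℕ) :
    ((x i : ℕ) : ℝ) * β⁻¹ ^ (i + 1) ≤ n * β⁻¹ ^ (i + 1) := by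
  gcongr
  exact (x i).2.le

lemma summable_inv_pow_succ (hβ : 1 < β) : Summable fun i : ℕ => β⁻¹ ^ (i + 1) :=
  (summable_nat_add_iff 1).2 (summable_geometric_of_lt_one (by positivity) (inv_lt_one_of_one_lt₀ hβ))

lemma summable_betaValue (hβ : 1 < β) {n : ℕ} (x : ℕ → Fin n) :
    Summable fun i => ((x i : ℕ) : ℝ) * β⁻¹ ^ (i + 1) :=
  ((summable_inv_pow_succ hβ).mul_left (n : ℝ)).of_nonneg_of_le (fun i => by positivity)
    (betaValue_term_le hβ x)

lemma betaValue_nonneg (hβ : 1 < β) {n : ℕ} (x : ℕ → Fin n) : 0 ≤ betaValue β x :=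
  tsum_nonneg fun i => by positivity

lemma betaValue_le (hβ : 1 < β) {n : ℕ} (x : ℕ → Fin n) :
    betaValue β x ≤ ∑' i : ℕ, n * β⁻¹ ^ (i + 1) :=
  (summable_betaValue hβ x).tsum_le_tsum (betaValue_term_le hβ x) ((summable_inv_pow_succ hβ).mul_left (n : ℝ))

lemma betaValue_shift (hβ : 1 < β) {n : ℕ} (x : ℕ → Fin n) :
    betaValue β (fun i => x (1 + i)) = β * betaValue β x - (x 0 : ℕ) := by
  have h := (summable_betaValue hβ x).tsum_eq_zero_add
  unfold betaValue
  rw [h, mul_add, ← tsum_mul_left]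
  have h0 : β ≠ 0 := by positivity
  have e : ∀ i : ℕ, β * (((x (i + 1) : ℕ) : ℝ) * β⁻¹ ^ (i + 1 + 1)) =
      ((x (1 + i) : ℕ) : ℝ) * β⁻¹ ^ (i + 1) := by
    intro i
    rw [add_comm 1 i, pow_succ _ (i + 1)]
    field_simp
  simp only [e]
  rw [zero_add, pow_one, mul_left_comm, mul_inv_cancel₀ h0]
  ring

lemma betaValue_shiftMap (hβ : 1 < β) (x : (betaShift β).carrier) :
    betaValue β (shiftMap (betaShift β) x).1 = β * betaValue β x.1 - (x.1 0 : ℕ) :=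
  betaValue_shift hβ x.1

lemma betaValue_iterate_sub (hβ : 1 < β) {x y : (betaShift β).carrier} {n : ℕ} (h : ∀ i < n, x.1 i = y.1 i) :
    betaValue β ((shiftMap (betaShift β))^[n] x).1 - betaValue β ((shiftMap (betaShift β))^[n] y).1 =
      β ^ n * (betaValue β x.1 - betaValue β y.1) := by
  induction n with
  | zero => simp
  | succ n ih =>
    rw [Function.iterate_succ_apply', Function.iterate_succ_apply', betaValue_shiftMap hβ,
      betaValue_shiftMap hβ, shiftMap_iterate_apply, shiftMap_iterate_apply, h (n + 0) (by omega)]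
    have := ih fun i hi => h i (by omega)
    rw [pow_succ]
    linear_combination β * this

variable {w : ℕ → Fin ⌈β⌉₊}

lemma betaValue_iterate_sub_betaRemainder (hβ : 1 < β)
    (hw : ∀ n, ((w n : ℕ) : ℤ) = betaDigit β n) {x : (betaShift β).carrier} {n : ℕ} (h : ∀ i < n, x.1 i = w i) :
    betaValue β ((shiftMap (betaShift β))^[n] x).1 - betaRemainder β n =
      β ^ n * (betaValue β x.1 - 1) := by
  induction n with
  | zero => simp [betaRemainder]
  | succ n ih =>
    rw [Function.iterate_succ_apply', betaValue_shiftMap hβ, shiftMap_iterate_apply,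
      h (n + 0) (by omega), betaRemainder_succ, ← hw, pow_succ]
    have := ih fun i hi => h i (by omega)
    push_cast
    rw [add_zero]
    linear_combination β * this

/-- At the first place below `w` the digit drops by at least one, and the next remainder of `1` is
positive; together they give a strict gain over pure expansion by `β`. -/
lemma exists_betaValue_sub_one_lt (hβ : 1 < β) (hw : ∀ n, ((w n : ℕ) : ℤ) = betaDigit β n)
    (hX : IsLexShift (betaShift β) w) {x : (betaShift β).carrier} (hx : x.1 ≠ w) : ∃ n : ℕ,
      β ^ (n + 1) * (betaValue β x.1 - 1) <
        betaValue β ((shiftMap (betaShift β))^[n + 1] x).1 - 1 := by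
  classical
  have hex : ∃ n, x.1 n ≠ w n := Function.ne_iff.1 hx
  set n := Nat.find hex
  have hn : x.1 n ≠ w n := Nat.find_spec hex
  have hagree : ∀ i < n, x.1 i = w i := fun i hi => not_not.1 (Nat.find_min hex hi)
  have hle := (hX.mem_iff x.1).1 x.2 0 n (by simpa using hagree)
  rw [zero_add] at hle
  have hlt : ((x.1 n : ℕ) : ℝ) + 1 ≤ ((w n : ℕ) : ℝ) := by
    have : (x.1 n : ℕ) < (w n : ℕ) := Fin.lt_def.1 (lt_of_le_of_ne hle hn)
    exact_mod_cast this
  refine ⟨n, ?_⟩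
  have h1 := betaValue_iterate_sub_betaRemainder hβ hw hagree
  rw [Function.iterate_succ_apply', betaValue_shiftMap hβ, shiftMap_iterate_apply, add_zero]
  have h2 := betaRemainder_succ β n
  rw [← hw] at h2
  push_cast at h2
  have h3 := (betaRemainder_pos_le_one β (n + 1)).1
  have h4 : β ^ (n + 1) * (betaValue β x.1 - 1) = β * (β ^ n * (betaValue β x.1 - 1)) := by ring
  rw [h4, ← h1]
  linarith

/-- An excess over `1` would reappear along the orbit multiplied by at least `β` each time, while
all values are bounded by `B`. For `w` itself the remainders give the bound directly. -/
lemma betaValue_le_one (hβ : 1 < β) (x : (betaShift β).carrier) : betaValue β x.1 ≤ 1 := by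
  obtain ⟨w, hw, hX⟩ := exists_isLexShift_betaShift hβ
  set B := ∑' i : ℕ, (⌈β⌉₊ : ℝ) * β⁻¹ ^ (i + 1)
  have hB : ∀ x : (betaShift β).carrier, betaValue β x.1 ≤ B := fun x => betaValue_le hβ x.1
  have hB0 : 0 ≤ B := tsum_nonneg fun i => by positivity
  have key : ∀ N : ℕ, ∀ x : (betaShift β).carrier, β ^ N * (betaValue β x.1 - 1) ≤ B := by
    intro N
    induction N with
    | zero => intro x; have := hB x; linarith
    | succ N ih =>
      intro x
      rcases le_or_gt (betaValue β x.1) 1 with h | h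
      · exact (mul_nonpos_of_nonneg_of_nonpos (by positivity) (by linarith)).trans hB0
      by_cases hx : x.1 = w
      · rw [← betaValue_iterate_sub_betaRemainder hβ hw (n := N + 1) (x := x) (fun i _ => by rw [hx])]
        have := hB ((shiftMap (betaShift β))^[N + 1] x)
        have := (betaRemainder_pos_le_one β (N + 1)).1
        linarith
      · obtain ⟨n, hn⟩ := exists_betaValue_sub_one_lt hβ hw hX hx
        have h1 := ih ((shiftMap (betaShift β))^[n + 1] x)
        have h2 : β ≤ β ^ (n + 1) := le_self_pow₀ hβ.le (by omega)
        calc β ^ (N + 1) * (betaValue β x.1 - 1) = β ^ N * (β * (betaValue β x.1 - 1)) := by ring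
          _ ≤ β ^ N * (β ^ (n + 1) * (betaValue β x.1 - 1)) := by
            have : 0 ≤ betaValue β x.1 - 1 := by linarith
            gcongr
          _ ≤ β ^ N * (betaValue β ((shiftMap (betaShift β))^[n + 1] x).1 - 1) := by gcongr
          _ ≤ B := h1
  by_contra! h
  have h0 : 0 < betaValue β x.1 - 1 := by linarith
  obtain ⟨N, hN⟩ := pow_unbounded_of_one_lt (B / (betaValue β x.1 - 1)) hβ
  rw [div_lt_iff₀ h0] at hN
  exact absurd (key N x) (not_le.2 hN)

/-- Value at least `1` at a point other than `w` would push a later tail above `1`. -/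
lemma betaValue_lt_one (hβ : 1 < β) (hw : ∀ n, ((w n : ℕ) : ℤ) = betaDigit β n)
    (hX : IsLexShift (betaShift β) w) {x : (betaShift β).carrier} (hx : x.1 ≠ w) : betaValue β x.1 < 1 := by
  obtain ⟨n, hn⟩ := exists_betaValue_sub_one_lt hβ hw hX hx
  have h1 := betaValue_le_one hβ ((shiftMap (betaShift β))^[n + 1] x)
  by_contra! h
  have : 0 ≤ β ^ (n + 1) * (betaValue β x.1 - 1) := mul_nonneg (by positivity) (by linarith)
  linarith

lemma abs_betaValue_sub_le (hβ : 1 < β) {x y : (betaShift β).carrier} {n : ℕ} (h : ∀ i < n, x.1 i = y.1 i) :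
    |betaValue β x.1 - betaValue β y.1| ≤ β⁻¹ ^ n := by
  have h1 := betaValue_iterate_sub hβ h
  have h2 : |betaValue β ((shiftMap (betaShift β))^[n] x).1 -
      betaValue β ((shiftMap (betaShift β))^[n] y).1| ≤ 1 := by
    have a1 := betaValue_le_one hβ ((shiftMap (betaShift β))^[n] x)
    have a2 := betaValue_le_one hβ ((shiftMap (betaShift β))^[n] y)
    have a3 := betaValue_nonneg hβ ((shiftMap (betaShift β))^[n] x).1
    have a4 := betaValue_nonneg hβ ((shiftMap (betaShift β))^[n] y).1
    rw [abs_le]; constructor <;> linarith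
  have hpos : 0 < β ^ n := by positivity
  rw [h1, abs_mul, abs_of_pos hpos] at h2
  rwa [inv_pow, ← one_div, le_div_iff₀ hpos, mul_comm]

lemma measurable_betaValue (hβ : 1 < β) : Measurable fun x : (betaShift β).carrier => betaValue β x.1 := by
  refine (continuous_of_agree fun x ε hε => ?_).measurable
  obtain ⟨N, hN⟩ := exists_pow_lt_of_lt_one hε (inv_lt_one_of_one_lt₀ hβ)
  refine ⟨N, fun y hy => ?_⟩
  rw [abs_sub_comm]
  exact (abs_betaValue_sub_le hβ hy).trans_lt hN

open Classical in
/-- The point of `[0, 1)` coded by `x`; the value `1` is sent to `0`. -/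
def betaPoint (hβ : 1 < β) (x : (betaShift β).carrier) : Set.Ico (0 : ℝ) 1 :=
  ⟨if betaValue β x.1 < 1 then betaValue β x.1 else 0, by
    split_ifs with h
    exacts [⟨betaValue_nonneg hβ x.1, h⟩, ⟨le_rfl, one_pos⟩]⟩

lemma betaPoint_of_lt (hβ : 1 < β) {x : (betaShift β).carrier} (h : betaValue β x.1 < 1) :
    (betaPoint hβ x).1 = betaValue β x.1 := if_pos h

lemma measurable_betaPoint (hβ : 1 < β) : Measurable (betaPoint hβ) := by
  refine Measurable.subtype_mk (Measurable.ite ?_ (measurable_betaValue hβ) measurable_const)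
  exact measurable_betaValue hβ measurableSet_Iio

/-- The greedy expansion of a point of `[0, 1)`. -/
def betaCodeSeq (hβ : 1 < β) (y : Set.Ico (0 : ℝ) 1) (k : ℕ) : Fin ⌈β⌉₊ :=
  ⟨⌊β * ((betaTransformation β)^[k] y).1⌋₊, by
    have h0 := ((betaTransformation β)^[k] y).2.1
    have h1 := ((betaTransformation β)^[k] y).2.2
    rw [Nat.floor_lt (by positivity)]
    exact (mul_lt_of_lt_one_right (by linarith) h1).trans_le (Nat.le_ceil β)⟩

lemma betaTransformation_eq (hβ : 1 < β) (y : Set.Ico (0 : ℝ) 1) (k : ℕ) :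
    ((betaTransformation β)^[k + 1] y).1 =
      β * ((betaTransformation β)^[k] y).1 - (betaCodeSeq hβ y k : ℕ) := by
  have h0 := ((betaTransformation β)^[k] y).2.1
  rw [Function.iterate_succ_apply']
  show Int.fract _ = _
  rw [Int.fract]
  congr 1
  exact (natCast_floor_eq_intCast_floor (by positivity)).symm

/-- While the digits agree, the orbit of `y` stays strictly below the remainders of `1`. Strictness
turns the floor of the one into at most the ceiling minus one of the other. -/
lemma betaCodeSeq_mem (hβ : 1 < β) (y : Set.Ico (0 : ℝ) 1) : betaCodeSeq hβ y ∈ (betaShift β).carrier := by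
  intro k n h
  have hlt : ∀ i ≤ n, ((betaTransformation β)^[k + i] y).1 < betaRemainder β i := by
    intro i
    induction i with
    | zero => exact fun _ => by simpa [betaRemainder] using ((betaTransformation β)^[k] y).2.2
    | succ i ih =>
      intro hi
      have h1 := h i (by omega)
      rw [← add_assoc, betaTransformation_eq hβ, betaRemainder_succ, ← h1]
      have := ih (by omega)
      push_cast
      gcongr
  have h1 := hlt n le_rfl
  have h0 := ((betaTransformation β)^[k + n] y).2.1
  have h2 : β * ((betaTransformation β)^[k + n] y).1 < β * betaRemainder β n := by gcongr
  show ((⌊_⌋₊ : ℕ) : ℤ) ≤ _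
  rw [Int.natCast_floor_eq_floor (by positivity), betaDigit, Int.le_sub_one_iff, Int.floor_lt]
  exact h2.trans_le (Int.le_ceil _)

/-- The greedy expansion as a point of the `β`-shift. -/
def betaCode (hβ : 1 < β) (y : Set.Ico (0 : ℝ) 1) : (betaShift β).carrier := ⟨betaCodeSeq hβ y, betaCodeSeq_mem hβ y⟩

lemma measurable_betaTransformation (β : ℝ) : Measurable (betaTransformation β) :=
  (measurable_fract.comp (measurable_subtype_coe.const_mul β)).subtype_mk

lemma measurable_betaCode (hβ : 1 < β) : Measurable (betaCode hβ) := by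
  refine Measurable.subtype_mk (measurable_pi_lambda _ fun k => ?_)
  have h1 : Measurable fun y : Set.Ico (0 : ℝ) 1 => ⌊β * ((betaTransformation β)^[k] y).1⌋₊ :=
    Nat.measurable_floor.comp
      ((measurable_subtype_coe.comp ((measurable_betaTransformation β).iterate k)).const_mul β)
  refine measurable_to_countable' fun a => ?_
  have : (fun y => betaCodeSeq hβ y k) ⁻¹' {a} =
      (fun y : Set.Ico (0 : ℝ) 1 => ⌊β * ((betaTransformation β)^[k] y).1⌋₊) ⁻¹' {(a : ℕ)} := by
    ext y
    simp [betaCodeSeq, Fin.ext_iff]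
  rw [this]
  exact h1 (measurableSet_singleton _)

lemma betaCode_betaTransformation (hβ : 1 < β) (y : Set.Ico (0 : ℝ) 1) :
    betaCode hβ (betaTransformation β y) = shiftMap (betaShift β) (betaCode hβ y) := by
  refine carrier_ext fun i => Fin.ext ?_
  show ⌊β * ((betaTransformation β)^[i] (betaTransformation β y)).1⌋₊ =
    ⌊β * ((betaTransformation β)^[1 + i] y).1⌋₊
  rw [add_comm, Function.iterate_add_apply, Function.iterate_one]

/-- Both orbits subtract the same digits, so their difference is multiplied by `β` at each step and
yet stays bounded by 1. -/
lemma betaValue_betaCode (hβ : 1 < β) (y : Set.Ico (0 : ℝ) 1) :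
    betaValue β (betaCode hβ y).1 = y.1 := by
  have key : ∀ n : ℕ, β ^ n * (betaValue β (betaCode hβ y).1 - y.1) =
      betaValue β ((shiftMap (betaShift β))^[n] (betaCode hβ y)).1 -
        ((betaTransformation β)^[n] y).1 := by
    intro n
    induction n with
    | zero => simp
    | succ n ih =>
      rw [betaTransformation_eq hβ, Function.iterate_succ_apply', betaValue_shiftMap hβ,
        shiftMap_iterate_apply, pow_succ]
      show _ = _ - ((betaCodeSeq hβ y (n + 0) : ℕ) : ℝ) - _
      rw [add_zero]
      linear_combination β * ih
  have hb : ∀ n : ℕ, β ^ n * |betaValue β (betaCode hβ y).1 - y.1| ≤ 1 := by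
    intro n
    have hpos : 0 < β ^ n := by positivity
    rw [← abs_of_pos hpos, ← abs_mul, key n]
    have a1 := betaValue_le_one hβ ((shiftMap (betaShift β))^[n] (betaCode hβ y))
    have a3 := betaValue_nonneg hβ ((shiftMap (betaShift β))^[n] (betaCode hβ y)).1
    have a2 := ((betaTransformation β)^[n] y).2.1
    have a4 := ((betaTransformation β)^[n] y).2.2
    rw [abs_le]; constructor <;> linarith
  by_contra hne
  have h0 : 0 < |betaValue β (betaCode hβ y).1 - y.1| := abs_pos.2 (sub_ne_zero.2 hne)
  obtain ⟨N, hN⟩ := pow_unbounded_of_one_lt (1 / |betaValue β (betaCode hβ y).1 - y.1|) hβ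
  rw [div_lt_iff₀ h0] at hN
  exact absurd (hb N) (not_le.2 hN)

lemma betaPoint_betaCode (hβ : 1 < β) (y : Set.Ico (0 : ℝ) 1) :
    betaPoint hβ (betaCode hβ y) = y := by
  have h := betaValue_betaCode hβ y
  refine Subtype.ext ?_
  rw [betaPoint_of_lt hβ (by rw [h]; exact y.2.2), h]

/-- If no tail has value `1`, each fractional part is the value of the next tail, so the greedy
digits are the letters of `x`. -/
lemma betaCode_betaPoint (hβ : 1 < β) {x : (betaShift β).carrier}
    (hx : ∀ k, betaValue β ((shiftMap (betaShift β))^[k] x).1 < 1) :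
    betaCode hβ (betaPoint hβ x) = x := by
  have hdig : ∀ z : (betaShift β).carrier, betaValue β (shiftMap (betaShift β) z).1 < 1 →
      ⌊β * betaValue β z.1⌋ = ((z.1 0 : ℕ) : ℤ) := by
    intro z hz
    have h1 := betaValue_shiftMap hβ z
    have h2 := betaValue_nonneg hβ (shiftMap (betaShift β) z).1
    rw [Int.floor_eq_iff]
    push_cast
    constructor <;> linarith
  have hit : ∀ k, ((betaTransformation β)^[k] (betaPoint hβ x)).1 =
      betaValue β ((shiftMap (betaShift β))^[k] x).1 := by
    intro k
    induction k with
    | zero => rw [Function.iterate_zero_apply, Function.iterate_zero_apply,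
        betaPoint_of_lt hβ (by exact hx 0)]
    | succ k ih =>
      have h1 := hdig _ (by have := hx (k + 1); rwa [Function.iterate_succ_apply'] at this)
      rw [Function.iterate_succ_apply', Function.iterate_succ_apply', betaValue_shiftMap hβ]
      show Int.fract _ = _
      rw [ih, Int.fract, h1, Int.cast_natCast]
  refine carrier_ext fun k => Fin.ext ?_
  show ⌊β * ((betaTransformation β)^[k] (betaPoint hβ x)).1⌋₊ = _
  rw [hit]
  have h1 := hdig ((shiftMap (betaShift β))^[k] x)
    (by have := hx (k + 1); rwa [Function.iterate_succ_apply'] at this)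
  rw [shiftMap_iterate_apply, add_zero] at h1
  rw [← Nat.cast_inj (R := ℤ), Int.natCast_floor_eq_floor, h1]
  exact mul_nonneg (by linarith) (betaValue_nonneg hβ _)

end BetaValue

/-! ### Hölder potentials for the β-transformation -/

section BetaEquilibrium

variable {β : ℝ}

/-- A Hölder function on `[0, 1)` has a Hölder limit at `1`. -/
lemma exists_limit_of_holderWith {φ : Set.Ico (0 : ℝ) 1 → ℝ} {C r : ℝ≥0} (hr : 0 < r)
    (hφ : HolderWith C r φ) : ∃ L : ℝ, ∀ y, |φ y - L| ≤ C * |y.1 - 1| ^ (r : ℝ) := by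
  set u : ℕ → Set.Ico (0 : ℝ) 1 := fun n => ⟨1 - 1 / ((n : ℝ) + 1), by
    constructor
    · rw [sub_nonneg, div_le_one (by positivity)]
      have : (0 : ℝ) ≤ n := by positivity
      linarith
    · have : (0 : ℝ) < 1 / ((n : ℝ) + 1) := by positivity
      linarith⟩
  have hu : Tendsto (fun n => (u n).1) atTop (𝓝 1) := by
    have := (tendsto_const_nhds (x := (1 : ℝ))).sub tendsto_one_div_add_atTop_nhds_zero_nat
    rwa [sub_zero] at this
  have hcau : CauchySeq u := by
    have := hu.cauchySeq
    rw [Metric.cauchySeq_iff] at this ⊢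
    exact this
  obtain ⟨L, hL⟩ := cauchySeq_tendsto_of_complete ((hφ.uniformContinuous hr).comp_cauchySeq hcau)
  refine ⟨L, fun y => ?_⟩
  have h1 : Tendsto (fun n => |φ y - φ (u n)|) atTop (𝓝 |φ y - L|) :=
    (tendsto_const_nhds.sub hL).abs
  have h2 : Tendsto (fun n => (C : ℝ) * |y.1 - (u n).1| ^ (r : ℝ)) atTop
      (𝓝 (C * |y.1 - 1| ^ (r : ℝ))) :=
    (((tendsto_const_nhds.sub hu).abs).rpow_const (Or.inr r.2)).const_mul _
  exact le_of_tendsto_of_tendsto' h1 h2 fun n => hφ.dist_le y (u n)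

/-- A Hölder function on `[0, 1)` lifts to a potential on the `β`-shift with the Bowen property. -/
lemma exists_bowen_lift (hβ : 1 < β) {φ : Set.Ico (0 : ℝ) 1 → ℝ} {C r : ℝ≥0} (hr : 0 < r)
    (hφ : HolderWith C r φ) : ∃ ψ : C((betaShift β).carrier, ℝ), HasBowen (betaShift β) ψ ∧
      ∀ y, ψ (betaCode hβ y) = φ y := by
  classical
  obtain ⟨L, hL⟩ := exists_limit_of_holderWith hr hφ
  set V : (betaShift β).carrier → ℝ := fun x => betaValue β x.1
  -- `betaPoint` sends the value `1` to `0`; using the limit of `φ` at `1` there instead makes `f`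
  -- Hölder in the value.
  set f : (betaShift β).carrier → ℝ := fun x => if V x < 1 then φ (betaPoint hβ x) else L
  have hf1 : ∀ x, V x < 1 → f x = φ (betaPoint hβ x) := fun x hx => if_pos hx
  have hf2 : ∀ x, ¬ V x < 1 → f x = L := fun x hx => if_neg hx
  have hV1 : ∀ x, ¬ V x < 1 → V x = 1 := fun x hx =>
    le_antisymm (betaValue_le_one hβ x) (not_lt.1 hx)
  have hr' : (0 : ℝ) < r := by exact_mod_cast hr
  have hhol : ∀ x y, |f x - f y| ≤ C * |V x - V y| ^ (r : ℝ) := by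
    intro x y
    by_cases hx : V x < 1 <;> by_cases hy : V y < 1
    · rw [hf1 x hx, hf1 y hy]
      have := hφ.dist_le (betaPoint hβ x) (betaPoint hβ y)
      rwa [Real.dist_eq, Subtype.dist_eq, Real.dist_eq, betaPoint_of_lt hβ hx,
        betaPoint_of_lt hβ hy] at this
    · rw [hf1 x hx, hf2 y hy, hV1 y hy]
      have := hL (betaPoint hβ x)
      rwa [betaPoint_of_lt hβ hx] at this
    · rw [hf2 x hx, hf1 y hy, hV1 x hx, abs_sub_comm, abs_sub_comm 1]
      have := hL (betaPoint hβ y)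
      rwa [betaPoint_of_lt hβ hy] at this
    · rw [hf2 x hx, hf2 y hy, sub_self, abs_zero]
      positivity
  set θ : ℝ := β⁻¹ ^ (r : ℝ)
  have hθ0 : 0 ≤ θ := by positivity
  have hθ1 : θ < 1 := Real.rpow_lt_one (by positivity) (inv_lt_one_of_one_lt₀ hβ) hr'
  have hagree : ∀ n, ∀ x y : (betaShift β).carrier, (∀ i < n, x.1 i = y.1 i) →
      |f x - f y| ≤ C * θ ^ n := by
    intro n x y h
    refine (hhol x y).trans ?_
    have h1 : |V x - V y| ^ (r : ℝ) ≤ (β⁻¹ ^ n) ^ (r : ℝ) :=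
      Real.rpow_le_rpow (abs_nonneg _) (abs_betaValue_sub_le hβ h) hr'.le
    have h2 : (β⁻¹ ^ n) ^ (r : ℝ) = θ ^ n := by
      rw [← Real.rpow_natCast, ← Real.rpow_natCast, ← Real.rpow_mul (by positivity),
        ← Real.rpow_mul (by positivity), mul_comm]
    rw [← h2]
    gcongr
  have hcont : Continuous f := by
    refine continuous_of_agree fun x ε hε => ?_
    have hlim : Tendsto (fun n : ℕ => (C : ℝ) * θ ^ n) atTop (𝓝 0) := by
      simpa using (tendsto_pow_atTop_nhds_zero_of_lt_one hθ0 hθ1).const_mul (C : ℝ)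
    obtain ⟨N, hN⟩ := (hlim.eventually_lt_const hε).exists
    refine ⟨N, fun y hy => ?_⟩
    rw [abs_sub_comm]
    exact (hagree N x y hy).trans_lt hN
  refine ⟨⟨f, hcont⟩, ⟨C * (1 - θ)⁻¹, fun u _ x hx y hy => ?_⟩, fun y => ?_⟩
  · show |birkhoffSum (shiftMap (betaShift β)) f u.length x -
      birkhoffSum (shiftMap (betaShift β)) f u.length y| ≤ _
    rw [mem_wordCylinder] at hx hy
    unfold birkhoffSum
    rw [← Finset.sum_sub_distrib]
    calc |∑ k ∈ Finset.range u.length, (f ((shiftMap (betaShift β))^[k] x) -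
          f ((shiftMap (betaShift β))^[k] y))|
        ≤ ∑ k ∈ Finset.range u.length, (C : ℝ) * θ ^ (u.length - 1 - k) := by
          refine (Finset.abs_sum_le_sum_abs _ _).trans (Finset.sum_le_sum fun k hk => ?_)
          have := Finset.mem_range.1 hk
          -- At time `k` there are `u.length - k` common letters; one fewer is used so that the
          -- exponents match the reflected sum.
          refine hagree _ _ _ fun i hi => ?_
          rw [shiftMap_iterate_apply, shiftMap_iterate_apply, hx _ (by omega), hy _ (by omega)]
      _ = C * ∑ k ∈ Finset.range u.length, θ ^ k := by
          rw [← Finset.mul_sum, Finset.sum_range_reflect (fun k => θ ^ k)]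
      _ ≤ C * (1 - θ)⁻¹ := by
          rw [← tsum_geometric_of_lt_one hθ0 hθ1]
          gcongr
          exact (summable_geometric_of_lt_one hθ0 hθ1).sum_le_tsum _ fun i _ => by positivity
  · show f (betaCode hβ y) = φ y
    rw [hf1, betaPoint_betaCode]
    show betaValue β _ < 1
    rw [betaValue_betaCode]
    exact y.2.2

/-- The Gibbs state of a potential with the Bowen property does not charge the point `w`. -/
lemma IsLexShift.measure_singleton_eq_zero {b : ℕ} [NeZero b] {X : Subshift (Fin b) ℕ}
    {w : ℕ → Fin b} (hX : IsLexShift X w) {φ : C(X.carrier, ℝ)} (hφ : HasBowen X φ)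
    {μ : Measure X.carrier} [IsFiniteMeasure μ] {K : ℝ}
    (hK : ∀ v ∈ shiftLanguage X, μ.real (wordCylinder X v) ≤
      K * Real.exp (supBirkhoff X φ v - v.length * topPressure X φ)) :
    μ {x | x.1 = w} = 0 := by
  -- The cylinders of the prefixes of `w` all contain the point, and their mass bounds are terms of
  -- a convergent series.
  have hlim := ((hX.summable_wordPrefix hφ).tendsto_atTop_zero).const_mul K
  rw [mul_zero] at hlim
  have hle : μ.real {x : X.carrier | x.1 = w} ≤ 0 := by
    refine ge_of_tendsto' hlim fun n => ?_
    have h1 := hK _ (wordPrefix_mem_shiftLanguage (X := X) (n + 1) ⟨w, hX.self_mem⟩)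
    rw [length_wordPrefix] at h1
    refine (measureReal_mono fun x hx => ?_).trans h1
    have hx' : x.1 = w := hx
    rw [mem_wordCylinder_iff_wordPrefix, length_wordPrefix, hx']
  exact (measureReal_eq_zero_iff).1 (le_antisymm hle measureReal_nonneg)

/-- Hölder potentials have unique equilibrium states for the `β`-transformation. -/
theorem existsUnique_isEquilibriumState_betaTransformation (hβ : 1 < β)
    {φ : Set.Ico (0 : ℝ) 1 → ℝ} {C r : ℝ≥0} (hr : 0 < r) (hφ : HolderWith C r φ) :
    ∃! μ : Measure (Set.Ico (0 : ℝ) 1), IsEquilibriumState (betaTransformation β) φ μ := by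
  obtain ⟨ψ, hψ, hψφ⟩ := exists_bowen_lift hβ hr hφ
  obtain ⟨w, hw, hX⟩ := exists_isLexShift_betaShift hβ
  have : NeZero ⌈β⌉₊ := ⟨(Nat.ceil_pos.2 (by linarith)).ne'⟩
  have := hX.nonempty
  have hg := hX.isGoodDecomposition hψ
  obtain ⟨μ, hμ, huniq, -⟩ := hg.exists_unique_gibbs
  have := hμ.isProb
  obtain ⟨K, -, hK⟩ := hμ.upper
  have hnull := hX.measure_singleton_eq_zero hψ hK
  have hae : ∀ᵐ x ∂μ, betaCode hβ (betaPoint hβ x) = x := by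
    -- Only `w` can have value `1`, and by invariance its preimages are null as well.
    have h1 : ∀ᵐ x ∂μ, ∀ k, ((shiftMap (betaShift β))^[k] x).1 ≠ w := by
      rw [ae_all_iff]
      intro k
      refine (hμ.invariant.iterate k).quasiMeasurePreserving.ae (p := fun x => x.1 ≠ w) ?_
      rw [ae_iff]
      simpa using hnull
    filter_upwards [h1] with x hx
    exact betaCode_betaPoint hβ fun k => betaValue_lt_one hβ hw hX (hx k)
  have := existsUnique_isEquilibriumState_of_coding (measurable_shiftMap (betaShift β))
    (measurable_betaTransformation β) (measurable_betaCode hβ) (measurable_betaPoint hβ)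
    (betaPoint_betaCode hβ) (betaCode_betaTransformation hβ) ψ.continuous.stronglyMeasurable
    (hμ.isEquilibriumState hg) huniq hae
  rwa [show (fun y => ψ (betaCode hβ y)) = φ from funext hψφ] at this

end BetaEquilibrium

end

/-! ### Assembly -/

theorem theoremA :
    -- non-trivial shifts with the specification property
    (∀ {A : Type*} [Fintype A] [TopologicalSpace A] [DiscreteTopology A] [MeasurableSpace A]
        [DiscreteMeasurableSpace A] (X : Subshift A ℕ),
      X.carrier.Nontrivial → HasSpecification X →
        ∃ B : Set C(X.carrier, ℝ), {φ : C(X.carrier, ℝ) | HasBowen X φ} ⊂ B ∧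
          ∀ φ ∈ B, HasUniqueGibbsState X φ) ∧
    -- beta-shifts
    (∀ β : ℝ, 1 < β →
        ∃ B : Set C((betaShift β).carrier, ℝ),
          {φ : C((betaShift β).carrier, ℝ) | HasBowen (betaShift β) φ} ⊂ B ∧
          ∀ φ ∈ B, HasUniqueGibbsState (betaShift β) φ) ∧
    -- beta-transformations
    (∀ β : ℝ, 1 < β → ∀ φ : Set.Ico (0 : ℝ) 1 → ℝ,
        (∃ C r : ℝ≥0, 0 < r ∧ HolderWith C r φ) →
          ∃! μ : Measure (Set.Ico (0 : ℝ) 1), IsEquilibriumState (betaTransformation β) φ μ) := by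
  -- The largest admissible class is taken, so strictness needs just one potential in it without the
  -- Bowen property.
  refine ⟨fun X hX hS => ⟨{φ | HasUniqueGibbsState X φ}, ?_, fun φ hφ => hφ⟩,
    fun β hβ => ⟨{φ | HasUniqueGibbsState (betaShift β) φ}, ?_, fun φ hφ => hφ⟩,
    fun β hβ φ ⟨C, r, hr, hφ⟩ => existsUnique_isEquilibriumState_betaTransformation hβ hr hφ⟩
  · have : Nonempty X.carrier := hX.nonempty.to_subtype
    obtain ⟨φ, h1, h2⟩ := hS.exists_not_hasBowen hX
    exact ⟨fun φ hφ => hS.hasUniqueGibbsState_of_hasBowen hφ, fun h => h1 (h h2)⟩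
  · obtain ⟨h, φ, h1, h2⟩ := betaShift_states hβ
    exact ⟨fun φ hφ => h φ hφ, fun h' => h1 (h' h2)⟩
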